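/- We work over $\mathbb C$. Let $X\subset\mathbb P^N$ be a closed irreducible subvariety of dimension $n$, with smooth locus $X_{\rm sm}$, and let $\gamma_X\colon X_{\rm sm}\to\mathbb G(n,N)$, $x\mapsto \tilde T_xX$, be its Gauss map, sending a smooth point to the embedded tangent $n$-plane. Let $B=\gamma_X(X_{\rm sm})$ be the Gauss image (with the Grassmannian in its Plücker embedding) and $g=\dim B$ the Gauss dimension of $X$. Assume that $$g(g+1)\le n .$$ Then at least one of the following holds. (1) $X$ is a cone: there is a point $O\in X$ such that for every $x\in X$ the linear span of $O$ and $x$ is contained in $X$. (So linear spaces, including a single point, count as cones.) (2) $X$ is an inflated tangent scroll: for general $b\in B$ the closure of the Gauss fibre $\gamma_X^{-1}(b)$ is a linear subspace $L_b\subset\mathbb P^N$, and there is a rational map $p\colon B\dashrightarrow\mathbb P^N$, non-constant, with $p(b)\in L_b$ for general $b\in B$ (a section of the family $\{L_b\}$ over $B$), such that, if $S\subset\mathbb P^N$ denotes the closure of the image of $p$, then for general $b\in B$ the point $p(b)$ is a smooth point of $S$ and $$\tilde T_{p(b)}S\subset L_b .$$ Here "for general $b\in B$" means for all $b$ in a nonempty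 Zariski open subset of $B$. -/

import Mathlib

open scoped LinearAlgebra.Projectivization

noncomputable section

namespace GaussScroll

/-- The Zariski topology on the projective space `ℙ(ℂ^ι)`: the basic open sets are the
complements of hypersurfaces `F = 0`, with `F` a homogeneous polynomial. -/
instance zariskiTopology (ι : Type) : TopologicalSpace (ℙ ℂ (ι → ℂ)) :=
  TopologicalSpace.generateFrom
    {U | ∃ (d : ℕ) (F : MvPolynomial ι ℂ), F.IsHomogeneous d ∧
      U = {P | MvPolynomial.eval P.rep F ≠ 0}}

/-- The (punctured) affine cone over a subset of projective space. -/
def affineCone {ι : Type} (X : Set (ℙ ℂ (ι → ℂ))) : Set (ι → ℂ) :=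
  {v | ∃ hv : v ≠ 0, Projectivization.mk ℂ v hv ∈ X}

/-- The homogeneous ideal of a subset of projective space. -/
def homIdeal {ι : Type} (X : Set (ℙ ℂ (ι → ℂ))) : Ideal (MvPolynomial ι ℂ) :=
  MvPolynomial.vanishingIdeal ℂ (affineCone X)

/-- The homogeneous coordinate ring of (the Zariski closure of) `X`. -/
abbrev coordRing {ι : Type} (X : Set (ℙ ℂ (ι → ℂ))) : Type :=
  MvPolynomial ι ℂ ⧸ homIdeal X

/-- `X`, or equivalently its Zariski closure, has dimension `n`: the homogeneous coordinate
ring has Krull dimension `n + 1`. -/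
def HasDim {ι : Type} (X : Set (ℙ ℂ (ι → ℂ))) (n : ℕ) : Prop :=
  ringKrullDim (coordRing X) = ((n + 1 : ℕ) : WithBot ℕ∞)

/-- The linear subspace `ℙ(W)` of projective space. -/
def linearSubspace {ι : Type} (W : Submodule ℂ (ι → ℂ)) : Set (ℙ ℂ (ι → ℂ)) :=
  {P | P.submodule ≤ W}

/-- The linear subspace of `ℂ^ι` whose projectivization is the embedded (Zariski) tangent space
of `X` at `P`: the common zeros of the differentials at `P` of the equations of `X`. -/
def tangentSpace {ι : Type} [Fintype ι] (X : Set (ℙ ℂ (ι → ℂ))) (P : ℙ ℂ (ι → ℂ)) :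
    Submodule ℂ (ι → ℂ) where
  carrier := {w | ∀ F ∈ homIdeal X,
    ∑ i, w i * MvPolynomial.eval P.rep (MvPolynomial.pderiv i F) = 0}
  zero_mem' := by
    intro F _
    simp
  add_mem' := by
    intro a b ha hb F hF
    simp only [Pi.add_apply, add_mul, Finset.sum_add_distrib, ha F hF, hb F hF, add_zero]
  smul_mem' := by
    intro c a ha F hF
    simp only [Pi.smul_apply, smul_eq_mul, mul_assoc, ← Finset.mul_sum, ha F hF, mul_zero]

/-- `P` is a smooth point of the variety `X` (closed and irreducible): the embedded tangent space
at `P` has the dimension of `X`. -/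
def IsSmoothPoint {ι : Type} [Fintype ι] (X : Set (ℙ ℂ (ι → ℂ))) (P : ℙ ℂ (ι → ℂ)) : Prop :=
  P ∈ X ∧ (Module.finrank ℂ (tangentSpace X P) : WithBot ℕ∞) = ringKrullDim (coordRing X)

/-- The index set of the Plücker coordinates of `d`-dimensional subspaces of `ℂ^(N+1)`. -/
abbrev PluckerIndex (d N : ℕ) : Type := Fin d ↪o Fin (N + 1)

/-- The vector of Plücker coordinates of a `d`-dimensional subspace `W` of `ℂ^(N+1)`, i.e. the
maximal minors of a matrix whose rows are a basis of `W`. Another basis changes it by a nonzero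
factor. -/
def pluckerVec (d : ℕ) {N : ℕ} (W : Submodule ℂ (Fin (N + 1) → ℂ)) : PluckerIndex d N → ℂ :=
  fun s =>
    if h : Module.finrank ℂ W = d then
      Matrix.det (Matrix.of fun i j : Fin d =>
        (Module.finBasisOfFinrankEq ℂ W h i : Fin (N + 1) → ℂ) (s j))
    else 0

/-- `b` is the image of the smooth point `P` under the Gauss map of the `n`-dimensional variety
`X`, where the Grassmannian of `n`-planes is embedded by Plücker coordinates. -/
def IsGaussValue {N : ℕ} (X : Set (ℙ ℂ (Fin (N + 1) → ℂ))) (n : ℕ)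
    (P : ℙ ℂ (Fin (N + 1) → ℂ)) (b : ℙ ℂ (PluckerIndex (n + 1) N → ℂ)) : Prop :=
  IsSmoothPoint X P ∧ b.submodule = ℂ ∙ pluckerVec (n + 1) (tangentSpace X P)

/-- The image `B` of the Gauss map on the smooth locus. -/
def gaussImage {N : ℕ} (X : Set (ℙ ℂ (Fin (N + 1) → ℂ))) (n : ℕ) :
    Set (ℙ ℂ (PluckerIndex (n + 1) N → ℂ)) :=
  {b | ∃ P, IsGaussValue X n P b}

/-- The fibre of the Gauss map over `b`. -/
def gaussFibre {N : ℕ} (X : Set (ℙ ℂ (Fin (N + 1) → ℂ))) (n : ℕ)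
    (b : ℙ ℂ (PluckerIndex (n + 1) N → ℂ)) : Set (ℙ ℂ (Fin (N + 1) → ℂ)) :=
  {P | IsGaussValue X n P b}

/-- `X` is a cone: some point `O` of `X` is a vertex, i.e. `X` contains the line joining `O` to
any point of `X`. -/
def IsCone {ι : Type} (X : Set (ℙ ℂ (ι → ℂ))) : Prop :=
  ∃ O ∈ X, ∀ P ∈ X, linearSubspace (O.submodule ⊔ P.submodule) ⊆ X

/-- A tuple of forms of one degree, viewed as a rational map between projective spaces, is
defined at `b` with value `Q`. -/
def IsRatValue {κ ι : Type} (s : ι → MvPolynomial κ ℂ) (b : ℙ ℂ (κ → ℂ)) (Q : ℙ ℂ (ι → ℂ)) :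
    Prop :=
  Q.submodule = ℂ ∙ (fun i => MvPolynomial.eval b.rep (s i))

/-- The Zariski closure of the image of `B` under the rational map given by `s`. -/
def ratImage {κ ι : Type} (s : ι → MvPolynomial κ ℂ) (B : Set (ℙ ℂ (κ → ℂ))) :
    Set (ℙ ℂ (ι → ℂ)) :=
  closure {Q | ∃ b ∈ B, IsRatValue s b Q}

/-- The `n`-dimensional variety `X` is an inflated tangent scroll: the general fibre of its Gauss
map is (dense in) a linear space `ℙ(L)`, and there is a rational section `p : B ⇢ ℙ^N`, `p(b) ∈
ℙ(L_b)`, of the family of these linear spaces over the Gauss image `B`, whose image has a closure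
`S` that is not a point, such that for general `b` in `B` the embedded tangent space of `S` at
the smooth point `p(b)` of `S` is contained in `ℙ(L_b)`. -/
def IsInflatedTangentScroll {N : ℕ} (X : Set (ℙ ℂ (Fin (N + 1) → ℂ))) (n : ℕ) : Prop :=
  ∃ (e : ℕ) (s : Fin (N + 1) → MvPolynomial (PluckerIndex (n + 1) N) ℂ),
    (∀ i, (s i).IsHomogeneous e) ∧
    (ratImage s (gaussImage X n)).Nontrivial ∧
    ∃ U : Set (ℙ ℂ (PluckerIndex (n + 1) N → ℂ)), IsOpen U ∧ (U ∩ gaussImage X n).Nonempty ∧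
      ∀ b ∈ U ∩ gaussImage X n,
        ∃ (L : Submodule ℂ (Fin (N + 1) → ℂ)) (p : ℙ ℂ (Fin (N + 1) → ℂ)),
          closure (gaussFibre X n b) = linearSubspace L ∧
          IsRatValue s b p ∧
          p ∈ linearSubspace L ∧
          IsSmoothPoint (ratImage s (gaussImage X n)) p ∧
          linearSubspace (tangentSpace (ratImage s (gaussImage X n)) p) ⊆ linearSubspace L

end GaussScroll

end

/-! ### Krull dimension, transcendence degree and derivations. -/

namespace GaussScroll

/-! The argument is differential algebra at the generic point, followed by specialization. Let `K`
be the function field of the affine cone over `X`, of transcendence degree `n + 1` over ℂ, and `x`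
its generic point. The tangent space `T` at `x` is a graph over some coordinates `J`, with matrix
`a`. The entries of `a` generate a subfield `k`, the function field of the Gauss image. Put `s =
trdeg ℂ k`, `m = trdeg k K`; then `s + m = n + 1`, and `s ≤ g` (`le_of_hasDim`).

Inside `T` let `L` be cut out over `k` by the derivatives of the equations of `T` in all directions
of the base. By the symmetry of the second fundamental form, `L ⊗ K` is the space of values at `x`
of the `k`-derivations of `K` (`mem_solSpace_iff`), so `dim L = m`. Moreover `x` lies in `L ⊗ K`.
Its `m` coordinates in a basis of `L` must be algebraically independent over `k`, so `x` is a
generic point of `L`, and every equation over `k` satisfied by `x` holds on all of `L`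
(`aeval_eq_zero_of_mem_solSpace`). This is the linearity of the general Gauss fibre.

If `y ∈ L` and `δ` is a derivation of `k`, then `δ y ∈ T`. Modulo `L` this is linear in `y`, and `s`
derivations span all of them, so there is a linear map from `L` to `(T / L)^s`, whose target has
dimension at most `s²`. The hypothesis gives `m = n + 1 - s ≥ g² + g + 1 - s > s²`. Hence some
nonzero `p ∈ L` has all its derivatives in `L` (`exists_focal_vector`).

If `p` is proportional to a constant vector, that vector lies in every general fibre and is a vertex
of `X` (`GaussChart.isCone`). Otherwise `p` is a nonconstant section of the family of fibres. The
tangent space of the cone over its image `S` is spanned by `p` and its derivatives, hence lies in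
`L` (`genTangent_le_solSpace`).

The definitions speak of actual points of `B`, so these generic facts must be transferred. Linear
spaces over `k` are spread out as ranges and kernels of polynomial matrices (`SubspaceFamily`),
whose ranks do not drop at a general specialization. Dimensions of varieties are compared with
transcendence degrees and with spaces of derivations. -/

/-- An integral extension has the Krull dimension of the base ring. -/
theorem ringKrullDim_eq_of_isIntegral {R S : Type*} [CommRing R] [CommRing S] [Algebra R S]
    [Algebra.IsIntegral R S] (hinj : Function.Injective (algebraMap R S)) :
    ringKrullDim S = ringKrullDim R := by
  apply le_antisymm
  · refine Order.krullDim_le_of_strictMono (PrimeSpectrum.comap (algebraMap R S)) ?_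
    intro p q hpq
    exact Ideal.IsIntegral.comap_lt_comap (I := p.asIdeal) (J := q.asIdeal) hpq
  -- A chain is lifted by going up, one prime at a time; the induction has to remember which prime
  -- the last lifted one lies over.
  · have key : ∀ l : LTSeries (PrimeSpectrum R), ∃ l' : LTSeries (PrimeSpectrum S),
        l'.length = l.length ∧ l'.last.asIdeal.comap (algebraMap R S) = l.last.asIdeal := by
      intro l
      induction l using RelSeries.inductionOn' with
      | singleton p =>
        obtain ⟨Q, -, hQ, hQp⟩ := Ideal.exists_ideal_over_prime_of_isIntegral (S := S) p.asIdeal ⊥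
          (by rw [← RingHom.ker_eq_comap_bot, (RingHom.injective_iff_ker_eq_bot _).1 hinj]
              exact bot_le)
        exact ⟨RelSeries.singleton _ ⟨Q, hQ⟩, rfl, hQp⟩
      | snoc l p hp ih =>
        obtain ⟨l', hlen, hlast⟩ := ih
        have hp' : l.last < p := hp
        obtain ⟨Q, hle, hQ, hQp⟩ := Ideal.exists_ideal_over_prime_of_isIntegral (S := S) p.asIdeal
          l'.last.asIdeal (by rw [hlast]; exact hp'.le)
        have hlt : l'.last < ⟨Q, hQ⟩ := by
          refine lt_of_le_of_ne hle fun h => ?_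
          have : l'.last.asIdeal = Q := by rw [h]
          rw [this, hQp] at hlast
          exact hp'.ne (PrimeSpectrum.ext hlast.symm)
        exact ⟨l'.snoc ⟨Q, hQ⟩ hlt, by simp [hlen], by simpa using hQp⟩
    refine iSup_le fun l => ?_
    obtain ⟨l', hl', -⟩ := key l
    rw [← hl']
    exact le_iSup (fun l : LTSeries (PrimeSpectrum S) => (l.length : WithBot ℕ∞)) l'

/-- The Krull dimension of a finitely generated domain over a field is its transcendence degree. -/
theorem exists_ringKrullDim_eq_and_trdeg_eq (F A : Type*) [Field F] [CommRing A] [IsDomain A]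
    [Algebra F A] [Algebra.FiniteType F A] :
    ∃ s : ℕ, ringKrullDim A = (s : WithBot ℕ∞) ∧ Algebra.trdeg F A = s := by
  obtain ⟨s, g, hinj, hint⟩ := exists_integral_inj_algHom_of_fg F A
  algebraize [g.toRingHom]
  refine ⟨s, ?_, ?_⟩
  · rw [ringKrullDim_eq_of_isIntegral (R := MvPolynomial (Fin s) F) (S := A) hinj,
      MvPolynomial.ringKrullDim_of_isNoetherianRing]
    simp
  · have : FaithfulSMul (MvPolynomial (Fin s) F) A :=
      (faithfulSMul_iff_algebraMap_injective _ _).2 hinj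
    have h := ((IsTranscendenceBasis.mvPolynomial (Fin s) F).algebraMap_comp
      (A := A)).lift_cardinalMk_eq_trdeg
    simpa using h.symm

section Derivations

variable {F k M ι : Type*} [Field F] [CharZero F] [Field k] [Algebra F k] [AddCommGroup M]
  [Module k M] [Module F M] [IsScalarTower F k M]

open KaehlerDifferential TensorProduct in
/-- The differentials of a transcendence basis are a basis of the Kähler differentials. -/
theorem exists_kaehler_basis {u : ι → k} (hu : IsTranscendenceBasis F u) :
    ∃ b : Module.Basis ι k Ω[k⁄F], ∀ i, b i = D F k (u i) := by
  let P := MvPolynomial ι F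
  let _ : Algebra P k := (MvPolynomial.aeval u).toAlgebra
  have hmap : ∀ i, algebraMap P k (MvPolynomial.X i) = u i := fun i => MvPolynomial.aeval_X u i
  have : IsScalarTower F P k := IsScalarTower.of_algebraMap_eq
    fun r => (MvPolynomial.aeval u).commutes r |>.symm
  have hinj : Function.Injective (algebraMap P k) := hu.1
  have : FaithfulSMul P k := (faithfulSMul_iff_algebraMap_injective _ _).2 hinj
  let Q := FractionRing P
  let _ : Algebra Q k := FractionRing.liftAlgebra P k
  have : IsScalarTower P Q k := FractionRing.isScalarTower_liftAlgebra P k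
  have : Algebra.IsAlgebraic P k := by
    have := hu.isAlgebraic
    refine ⟨fun z => ?_⟩
    have hz := this.isAlgebraic z
    obtain ⟨f, hf, hfz⟩ := hz
    have hsurj : ∀ y : Algebra.adjoin F (Set.range u), ∃ q : P, algebraMap P k q = y := by
      rintro ⟨y, hy⟩
      rw [Algebra.adjoin_range_eq_range_aeval] at hy
      obtain ⟨q, hq⟩ := hy
      exact ⟨q, hq⟩
    let e : P →ₐ[F] Algebra.adjoin F (Set.range u) :=
      (MvPolynomial.aeval u).codRestrict _ (fun q => by
        rw [Algebra.adjoin_range_eq_range_aeval]; exact ⟨q, rfl⟩)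
    have he : Function.Surjective e := fun y => by
      obtain ⟨q, hq⟩ := hsurj y
      exact ⟨q, Subtype.ext hq⟩
    obtain ⟨f', hf'⟩ := Polynomial.map_surjective e.toRingHom he f
    refine ⟨f', fun h0 => hf (by rw [← hf', h0, Polynomial.map_zero]), ?_⟩
    rw [← hf'] at hfz
    rw [← hfz, Polynomial.aeval_def, Polynomial.aeval_def, Polynomial.eval₂_map]
    rfl
  have : Algebra.IsAlgebraic Q k := by
    refine ⟨fun z => ?_⟩
    exact (Algebra.IsAlgebraic.isAlgebraic (R := P) z).extendScalars
      (IsFractionRing.injective P Q)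
  have : CharZero Q := by
    have : CharZero P := inferInstance
    exact charZero_of_injective_algebraMap (IsFractionRing.injective P Q)
  -- Characteristic zero makes the algebraic extension `k / Q` separable, hence formally étale. With
  -- the localization `P → Q` this makes `P → k` formally étale, so the differentials of `k` are the
  -- base change of those of the polynomial ring.
  have : Algebra.FormallyEtale Q k := Algebra.FormallyEtale.of_isSeparable Q k
  have : Algebra.FormallyEtale P Q := Algebra.FormallyEtale.of_isLocalization (nonZeroDivisors P)
  have : Algebra.FormallyEtale P k := Algebra.FormallyEtale.comp P Q k
  let e := KaehlerDifferential.tensorKaehlerEquivOfFormallyEtale F P k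
  refine ⟨((mvPolynomialBasis F ι).baseChange k).map e, fun i => ?_⟩
  simp only [Module.Basis.map_apply, Module.Basis.baseChange_apply, mvPolynomialBasis_apply]
  rw [← LinearEquiv.eq_symm_apply, ← hmap i,
    KaehlerDifferential.tensorKaehlerEquivOfFormallyEtale_symm_D_algebraMap]

theorem derivation_ext_of_isTranscendenceBasis {u : ι → k} (hu : IsTranscendenceBasis F u)
    {D₁ D₂ : Derivation F k M} (h : ∀ i, D₁ (u i) = D₂ (u i)) : D₁ = D₂ := by
  obtain ⟨b, hb⟩ := exists_kaehler_basis hu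
  have : D₁.liftKaehlerDifferential = D₂.liftKaehlerDifferential := by
    refine b.ext fun i => ?_
    rw [hb, Derivation.liftKaehlerDifferential_comp_D, Derivation.liftKaehlerDifferential_comp_D, h]
  rw [← Derivation.liftKaehlerDifferential_comp D₁, this, Derivation.liftKaehlerDifferential_comp]

theorem exists_derivation_of_isTranscendenceBasis {u : ι → k} (hu : IsTranscendenceBasis F u)
    (m : ι → M) : ∃ D : Derivation F k M, ∀ i, D (u i) = m i := by
  obtain ⟨b, hb⟩ := exists_kaehler_basis hu
  refine ⟨(b.constr ℕ m).compDer (KaehlerDifferential.D F k), fun i => ?_⟩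
  change b.constr ℕ m (KaehlerDifferential.D F k (u i)) = m i
  rw [← hb, b.constr_basis]

/-- The space of derivations has the transcendence degree as its dimension. -/
theorem exists_derivation_equiv {u : ι → k} (hu : IsTranscendenceBasis F u) :
    ∃ e : Derivation F k k ≃ₗ[k] (ι → k), ∀ D i, e D i = D (u i) := by
  let f : Derivation F k k →ₗ[k] (ι → k) :=
    { toFun := fun D i => D (u i)
      map_add' := fun _ _ => rfl
      map_smul' := fun _ _ => rfl }
  refine ⟨LinearEquiv.ofBijective f ⟨fun D₁ D₂ h => ?_, fun m => ?_⟩, fun D i => rfl⟩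
  · exact derivation_ext_of_isTranscendenceBasis hu fun i => congrFun h i
  · obtain ⟨D, hD⟩ := exists_derivation_of_isTranscendenceBasis hu m
    exact ⟨D, funext hD⟩

end Derivations

end GaussScroll

/-! ### Generic points, their tangent spaces, and linear equations under field extension. -/

namespace GaussScroll

section FieldTheory

open MvPolynomial

variable {F k K M σ ι : Type*} [Field F] [Field k] [Field K] [Algebra F k]
  [Algebra k K] [Algebra F K] [IsScalarTower F k K]

theorem exists_fin_isTranscendenceBasis {s : ℕ} (h : Algebra.trdeg F k = s) :
    ∃ u : Fin s → k, IsTranscendenceBasis F u := by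
  obtain ⟨B, hB⟩ := exists_isTranscendenceBasis F k
  have hc := hB.cardinalMk_eq_trdeg
  rw [h] at hc
  have : Finite B := Cardinal.lt_aleph0_iff_finite.1 (hc ▸ Cardinal.natCast_lt_aleph0)
  have : Nat.card B = s := by rw [Nat.card, hc, Cardinal.toNat_natCast]
  exact ⟨_, hB.comp_equiv (Finite.equivFinOfCardEq this).symm⟩

/-- A transcendence basis of `k / F` followed by one of `K / k` is one of `K / F`. Take the given
values on the former and `0` on the latter. -/
theorem exists_derivation_extension [CharZero F] (d : Derivation F k K) :
    ∃ D : Derivation F K K, ∀ z : k, D (algebraMap k K z) = d z := by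
  obtain ⟨B, hB⟩ := exists_isTranscendenceBasis F k
  obtain ⟨C, hC⟩ := exists_isTranscendenceBasis k K
  obtain ⟨D, hD⟩ := exists_derivation_of_isTranscendenceBasis (hB.sumElim_comp hC)
    (Sum.elim (fun _ => 0) fun i : B => d i)
  have : D.compAlgebraMap k = d := by
    refine derivation_ext_of_isTranscendenceBasis hB fun i => ?_
    simpa using hD (Sum.inr i)
  exact ⟨D, fun z => by rw [← this]; rfl⟩

/-- The `δ s` are the partial derivatives dual to `u`. They do not depend on `d`, which may take
values in the larger field `K`; conditions on all derivations thus reduce to conditions on these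
finitely many. -/
theorem exists_derivation_eq_sum [CharZero F] [Fintype ι] {u : ι → k}
    (hu : IsTranscendenceBasis F u) :
    ∃ δ : ι → Derivation F k k, ∀ (d : Derivation F k K) (z : k),
      d z = ∑ s, d (u s) * algebraMap k K (δ s z) := by
  classical
  choose δ hδ using fun s : ι =>
    exists_derivation_of_isTranscendenceBasis hu (Pi.single s (1 : k))
  refine ⟨δ, fun d z => ?_⟩
  have : d = ∑ s, d (u s) • (Algebra.linearMap k K).compDer (δ s) := by
    refine derivation_ext_of_isTranscendenceBasis hu fun i => ?_
    have h : ∀ s, (d (u s) • (Algebra.linearMap k K).compDer (δ s)) (u i) =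
        d (u s) * algebraMap k K (δ s (u i)) := fun s => rfl
    rw [← Derivation.coeFnAddMonoidHom_apply, ← Derivation.coeFnAddMonoidHom_apply, map_sum,
      Finset.sum_apply]
    simp only [Derivation.coeFnAddMonoidHom_apply, h, hδ]
    rw [Finset.sum_eq_single i]
    · simp
    · intro s _ hs
      simp [hs.symm]
    · simp
  conv_lhs => rw [this]
  rw [← Derivation.coeFnAddMonoidHom_apply, map_sum, Finset.sum_apply]
  rfl

/-- Every element of `K` is a rational expression in the coordinates of `x`. -/
def GeneratesField (F : Type*) {K σ : Type*} [Field F] [Field K] [Algebra F K] (x : σ → K) :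
    Prop :=
  ∀ z : K, ∃ f g : MvPolynomial σ F, aeval x g ≠ 0 ∧ z * aeval x g = aeval x f

theorem derivation_aeval [Fintype σ] [AddCommGroup M] [Module K M] [Module F M]
    (D : Derivation F K M) (x : σ → K) (f : MvPolynomial σ F) :
    D (aeval x f) = ∑ i, aeval x (pderiv i f) • D (x i) := by
  classical
  induction f using MvPolynomial.induction_on with
  | C a => simp
  | add p q hp hq => simp [hp, hq, add_smul, Finset.sum_add_distrib]
  | mul_X p j hp =>
    simp only [map_mul, aeval_X, Derivation.leibniz, hp, pderiv_X, map_add, add_smul,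
      Finset.sum_add_distrib, smul_eq_mul, Finset.smul_sum, mul_smul]
    congr 1
    rw [Finset.sum_eq_single j]
    · simp
    · intro i _ hi
      simp [hi.symm]
    · simp

/-- Extension of scalars for vectors. -/
abbrev mapVec (K : Type*) {k σ : Type*} [Field k] [Field K] [Algebra k K] (y : σ → k) : σ → K :=
  fun i => algebraMap k K (y i)

/-- Expand the coefficients of a relation in a `k`-basis of `K`; each coordinate is a relation over
`k`. -/
theorem linearIndependent_mapVec {v : ι → σ → k} (hv : LinearIndependent k v) :
    LinearIndependent K fun i => mapVec K (v i) := by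
  classical
  rw [linearIndependent_iff'] at hv ⊢
  intro s c hc i hi
  let B := Module.Basis.ofVectorSpace k K
  rw [← B.forall_coord_eq_zero_iff]
  intro β
  refine hv s (fun i => B.coord β (c i)) ?_ i hi
  funext j
  have := congrArg (B.coord β) (congrFun hc j)
  rw [Finset.sum_apply, map_sum] at this
  rw [Finset.sum_apply, Pi.zero_apply, ← (B.coord β).map_zero]
  refine Eq.trans (Finset.sum_congr rfl fun l _ => ?_) this
  rw [Pi.smul_apply, Pi.smul_apply, smul_eq_mul, smul_eq_mul, mul_comm (c l), ← Algebra.smul_def,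
    map_smul, smul_eq_mul, mul_comm]

variable [Fintype σ]

/-- The tangent space at the point `x` of its locus over `F`. -/
def genTangent (F : Type*) {K σ : Type*} [Field F] [Field K] [Algebra F K] [Fintype σ]
    (x : σ → K) : Submodule K (σ → K) where
  carrier := {w | ∀ f : MvPolynomial σ F, aeval x f = 0 → ∑ i, w i * aeval x (pderiv i f) = 0}
  zero_mem' := by
    intro f _
    simp
  add_mem' := by
    intro a b ha hb f hf
    simp only [Pi.add_apply, add_mul, Finset.sum_add_distrib, ha f hf, hb f hf, add_zero]
  smul_mem' := by
    intro c a ha f hf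
    simp only [Pi.smul_apply, smul_eq_mul, mul_assoc, ← Finset.mul_sum, ha f hf, mul_zero]

theorem mem_genTangent {x w : σ → K} : w ∈ genTangent F x ↔
    ∀ f : MvPolynomial σ F, aeval x f = 0 → ∑ i, w i * aeval x (pderiv i f) = 0 := Iff.rfl

theorem derivation_mem_genTangent (x : σ → K) (D : Derivation F K K) :
    (fun i => D (x i)) ∈ genTangent F x := by
  intro f hf
  have := derivation_aeval D x f
  rw [hf, map_zero] at this
  rw [this]
  exact Finset.sum_congr rfl fun i _ => mul_comm _ _

theorem GeneratesField.derivation_ext [AddCommGroup M] [Module K M] [Module F M] {x : σ → K}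
    (hx : GeneratesField F x) {D₁ D₂ : Derivation F K M} (h : ∀ i, D₁ (x i) = D₂ (x i)) :
    D₁ = D₂ := by
  ext z
  obtain ⟨f, g, hg, hz⟩ := hx z
  have hf : ∀ f : MvPolynomial σ F, D₁ (aeval x f) = D₂ (aeval x f) := fun f => by
    simp only [derivation_aeval, h]
  have h1 := congrArg D₁ hz
  have h2 := congrArg D₂ hz
  rw [Derivation.leibniz, hf, hf] at h1
  rw [Derivation.leibniz, ← h1] at h2
  exact (smul_right_injective M hg (add_left_cancel h2)).symm

/-- The tangent vectors at a generic point are the values of the derivations. -/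
theorem GeneratesField.exists_derivation {x : σ → K} (hx : GeneratesField F x) {w : σ → K}
    (hw : w ∈ genTangent F x) : ∃ D : Derivation F K K, ∀ i, D (x i) = w i := by
  classical
  let δ : MvPolynomial σ F →ₗ[F] K :=
    { toFun := fun f => ∑ i, w i * aeval x (pderiv i f)
      map_add' := fun f g => by simp [mul_add, Finset.sum_add_distrib]
      map_smul' := fun c f => by
        simp only [Derivation.map_smul, map_smul, RingHom.id_apply, Finset.smul_sum,
          mul_smul_comm] }
  have hmul : ∀ f g, δ (f * g) = aeval x f * δ g + aeval x g * δ f := by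
    intro f g
    change ∑ i, _ = _ * (∑ i, _) + _ * (∑ i, _)
    rw [Finset.mul_sum, Finset.mul_sum, ← Finset.sum_add_distrib]
    refine Finset.sum_congr rfl fun i _ => ?_
    simp only [Derivation.leibniz, smul_eq_mul, map_add, map_mul]
    ring
  have hX : ∀ i, δ (X i) = w i := by
    intro i
    change ∑ j, _ = _
    rw [Finset.sum_eq_single i]
    · simp
    · intro j _ hj
      simp [pderiv_X, hj.symm]
    · simp
  have hker : ∀ f, aeval x f = 0 → δ f = 0 := hw
  choose num den hden hz using hx
  let D : K → K := fun z => (δ (num z) - z * δ (den z)) / aeval x (den z)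
  -- The quotient rule does not depend on the fraction chosen for `z`: the difference of cross
  -- products vanishes at `x`, so `δ` kills it because `w` is tangent.
  have key : ∀ (z : K) (f g : MvPolynomial σ F), aeval x g ≠ 0 → z * aeval x g = aeval x f →
      D z * aeval x g = δ f - z * δ g := by
    intro z f g hg hfg
    have h0 : δ (f * den z - num z * g) = 0 := by
      refine hker _ ?_
      rw [map_sub, map_mul, map_mul, ← hfg, ← hz z]
      ring
    rw [map_sub, hmul, hmul, ← hfg, ← hz z] at h0
    have h1 := hden z
    simp only [D]
    field_simp
    linear_combination -h0
  have hdual : ∀ f, D (aeval x f) = δ f := by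
    intro f
    have := key (aeval x f) f 1 (by simp) (by simp)
    have h1 : δ 1 = 0 := by
      have := hmul 1 1
      simpa using this
    simpa [h1] using this
  have hadd : ∀ y z, D (y + z) = D y + D z := by
    intro y z
    have hy := hz y
    have hz' := hz z
    have h := key (y + z) (num y * den z + num z * den y) (den y * den z)
      (by rw [map_mul]; exact mul_ne_zero (hden y) (hden z))
      (by simp only [map_mul, map_add, ← hy, ← hz']; ring)
    have ky := key y _ _ (hden y) hy
    have kz := key z _ _ (hden z) hz'
    rw [map_add, hmul, hmul, hmul, ← hy, ← hz', map_mul] at h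
    refine mul_right_cancel₀ (mul_ne_zero (hden y) (hden z)) ?_
    rw [h]
    linear_combination -aeval x (den z) * ky - aeval x (den y) * kz
  have hleib : ∀ y z, D (y * z) = y • D z + z • D y := by
    intro y z
    have hy := hz y
    have hz' := hz z
    have h := key (y * z) (num y * num z) (den y * den z)
      (by rw [map_mul]; exact mul_ne_zero (hden y) (hden z))
      (by simp only [map_mul, ← hy, ← hz']; ring)
    have ky := key y _ _ (hden y) hy
    have kz := key z _ _ (hden z) hz'
    rw [hmul, hmul, ← hy, ← hz', map_mul] at h
    refine mul_right_cancel₀ (mul_ne_zero (hden y) (hden z)) ?_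
    rw [h, smul_eq_mul, smul_eq_mul]
    linear_combination - z * aeval x (den z) * ky - y * aeval x (den y) * kz
  have hsmul : ∀ (c : F) z, D (c • z) = c • D z := by
    intro c z
    have h0 : D (algebraMap F K c) = 0 := by
      have := hdual (C c)
      rw [algHom_C] at this
      rw [this]
      change ∑ i, _ = _
      simp
    rw [Algebra.smul_def, hleib, h0, smul_zero, add_zero, algebraMap_smul]
  refine ⟨Derivation.mk' { toFun := D, map_add' := hadd, map_smul' := hsmul } hleib, fun i => ?_⟩
  change D (x i) = w i
  rw [← aeval_X (R := F) x i, hdual, hX]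

/-- Evaluation at `x` identifies the derivations of `K` with the tangent vectors, and derivations
are counted by a transcendence basis. -/
theorem GeneratesField.finrank_genTangent [CharZero F] {x : σ → K} (hx : GeneratesField F x)
    {s : ℕ} (hs : Algebra.trdeg F K = s) : Module.finrank K (genTangent F x) = s := by
  obtain ⟨u, hu⟩ := exists_fin_isTranscendenceBasis hs
  obtain ⟨e, -⟩ := exists_derivation_equiv hu
  let f : Derivation F K K →ₗ[K] genTangent F x :=
    { toFun := fun D => ⟨fun i => D (x i), derivation_mem_genTangent x D⟩
      map_add' := fun _ _ => rfl
      map_smul' := fun _ _ => rfl }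
  have hf : Function.Bijective f := by
    refine ⟨fun D₁ D₂ h => hx.derivation_ext fun i => congrFun (congrArg Subtype.val h) i, ?_⟩
    rintro ⟨w, hw⟩
    obtain ⟨D, hD⟩ := hx.exists_derivation hw
    exact ⟨D, Subtype.ext (funext hD)⟩
  rw [← (LinearEquiv.ofBijective f hf).finrank_eq, e.finrank_eq, Module.finrank_fin_fun]

/-- The solutions in an extension field of a system of linear equations. -/
def solSpace {k σ : Type*} [Field k] [Fintype σ] (E : Set (σ → k)) (K : Type*) [Field K]
    [Algebra k K] : Submodule K (σ → K) where
  carrier := {w | ∀ e ∈ E, ∑ i, algebraMap k K (e i) * w i = 0}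
  zero_mem' := by
    intro e _
    simp
  add_mem' := by
    intro a b ha hb e he
    simp only [Pi.add_apply, mul_add, Finset.sum_add_distrib, ha e he, hb e he, add_zero]
  smul_mem' := by
    intro c a ha e he
    simp only [Pi.smul_apply, smul_eq_mul, mul_left_comm, ← Finset.mul_sum, ha e he, mul_zero]

theorem mapVec_mem_solSpace {E : Set (σ → k)} {y : σ → k} :
    mapVec K y ∈ solSpace E K ↔ y ∈ solSpace E k := by
  refine forall₂_congr fun e _ => ?_
  simp only [mapVec, ← map_mul, ← map_sum, Algebra.algebraMap_self, RingHom.id_apply]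
  exact map_eq_zero_iff _ (algebraMap k K).injective

/-- The coordinates of a solution with respect to a `k`-basis of `K` are solutions over `k`. -/
theorem solSpace_eq_span (E : Set (σ → k)) :
    solSpace E K = Submodule.span K (mapVec K '' (solSpace E k : Set (σ → k))) := by
  classical
  apply le_antisymm
  · intro w hw
    let B := Module.Basis.ofVectorSpace k K
    have hc : ∀ β, (fun i => B.coord β (w i)) ∈ solSpace E k := by
      intro β e he
      have := congrArg (B.coord β) (hw e he)
      rw [map_sum, map_zero] at this
      rw [← this]
      refine Finset.sum_congr rfl fun i _ => ?_
      change e i * B.coord β (w i) = _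
      rw [← Algebra.smul_def (e i) (w i), LinearMap.map_smul, smul_eq_mul]
    let S := Finset.univ.biUnion fun i => (B.repr (w i)).support
    have hsum : w = ∑ β ∈ S, B β • mapVec K (fun i => B.coord β (w i)) := by
      funext i
      rw [Finset.sum_apply]
      conv_lhs => rw [← B.linearCombination_repr (w i), Finsupp.linearCombination_apply,
        Finsupp.sum_of_support_subset _ (Finset.subset_biUnion_of_mem (fun i => (B.repr (w i)).support) (Finset.mem_univ i)) _
          (by simp)]
      refine Finset.sum_congr rfl fun β _ => ?_
      rw [Algebra.smul_def, mul_comm]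
      rfl
    rw [hsum]
    exact Submodule.sum_mem _ fun β _ => Submodule.smul_mem _ _
      (Submodule.subset_span ⟨_, hc β, rfl⟩)
  · rw [Submodule.span_le]
    rintro _ ⟨y, hy, rfl⟩
    exact mapVec_mem_solSpace.2 hy

theorem finrank_solSpace (E : Set (σ → k)) :
    Module.finrank K (solSpace E K) = Module.finrank k (solSpace E k) := by
  let b := Module.finBasis k (solSpace E k)
  have hb : LinearIndependent k fun i => (b i : σ → k) :=
    b.linearIndependent.map' (solSpace E k).subtype (Submodule.ker_subtype _)
  have hspan : solSpace E K = Submodule.span K (Set.range fun i => mapVec K (b i : σ → k)) := by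
    rw [solSpace_eq_span]
    apply le_antisymm
    · rw [Submodule.span_le]
      rintro _ ⟨y, hy, rfl⟩
      have : mapVec K y = ∑ i, algebraMap k K (b.repr ⟨y, hy⟩ i) • mapVec K (b i : σ → k) := by
        have h := congrArg Subtype.val (b.sum_repr ⟨y, hy⟩)
        funext j
        have hj := congrArg (algebraMap k K) (congrFun h j)
        simp only [Submodule.coe_sum, Finset.sum_apply, map_sum, Submodule.coe_smul,
          Pi.smul_apply, smul_eq_mul, map_mul] at hj
        rw [Finset.sum_apply]
        exact hj.symm
      rw [this]
      exact Submodule.sum_mem _ fun i _ => Submodule.smul_mem _ _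
        (Submodule.subset_span ⟨i, rfl⟩)
    · refine Submodule.span_mono ?_
      rintro _ ⟨i, rfl⟩
      exact ⟨_, (b i).2, rfl⟩
  rw [hspan, finrank_span_eq_card (linearIndependent_mapVec hb), Fintype.card_fin]

end FieldTheory

end GaussScroll

/-! ### The generic Gauss fibre is linear and contains a focal vector. -/

namespace GaussScroll

section Developable

open MvPolynomial

variable {F k K σ ι : Type*} [Field F] [Field k] [Field K] [Algebra F k]
  [Algebra k K] [Algebra F K] [IsScalarTower F k K] [DecidableEq σ] [Fintype σ] {d : ℕ}

/-- The linear form with the coefficients `c` in the coordinates `J`. -/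
def rowVec (J : Fin d → σ) (c : Fin d → k) : σ → k := ∑ j, c j • Pi.single (J j) 1

theorem sum_rowVec_mul (J : Fin d → σ) (c : Fin d → k) (w : σ → K) :
    ∑ i, algebraMap k K (rowVec J c i) * w i = ∑ j, algebraMap k K (c j) * w (J j) := by
  simp only [rowVec, Finset.sum_apply, Pi.smul_apply, smul_eq_mul, map_sum, map_mul,
    Finset.sum_mul]
  rw [Finset.sum_comm]
  refine Finset.sum_congr rfl fun j _ => ?_
  rw [Finset.sum_eq_single (J j)]
  · simp
  · intro i _ hi
    simp [hi]
  · simp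

/-- The equations `w i = ∑ j, a i j * w (J j)` of a graph, together with their derivatives. -/
def developableEqs (F : Type*) {k σ : Type*} [Field F] [Field k] [Algebra F k] [DecidableEq σ]
    {d : ℕ} (J : Fin d → σ) (a : σ → Fin d → k) : Set (σ → k) :=
  {e | ∃ i, e = Pi.single i 1 - rowVec J (a i)} ∪
    {e | ∃ (δ : Derivation F k k) (i : σ), e = rowVec J fun j => δ (a i j)}

/-- The classical picture: `w` lies in the tangent space and, to first order, in all tangent spaces
infinitely near to it along the Gauss image. -/
theorem mem_solSpace_developableEqs {J : Fin d → σ} {a : σ → Fin d → k} {w : σ → K} :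
    w ∈ solSpace (developableEqs F J a) K ↔
      (∀ i, w i = ∑ j, algebraMap k K (a i j) * w (J j)) ∧
        ∀ (δ : Derivation F k k) (i : σ), ∑ j, algebraMap k K (δ (a i j)) * w (J j) = 0 := by
  have h1 : ∀ i, ∑ l, algebraMap k K (((Pi.single i 1 : σ → k) - rowVec J (a i)) l) * w l =
      w i - ∑ j, algebraMap k K (a i j) * w (J j) := by
    intro i
    simp only [Pi.sub_apply, map_sub, sub_mul, Finset.sum_sub_distrib, sum_rowVec_mul]
    congr 1
    rw [Finset.sum_eq_single i]
    · simp
    · intro l _ hl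
      simp [hl]
    · simp
  constructor
  · intro h
    refine ⟨fun i => ?_, fun δ i => ?_⟩
    · have := h _ (Or.inl ⟨i, rfl⟩)
      rw [h1] at this
      exact sub_eq_zero.1 this
    · have := h _ (Or.inr ⟨δ, i, rfl⟩)
      rwa [sum_rowVec_mul] at this
  · rintro ⟨ha, hδ⟩ e (⟨i, rfl⟩ | ⟨δ, i, rfl⟩)
    · rw [h1, ← ha i, sub_self]
    · rw [sum_rowVec_mul, hδ]

/-- The tangent space at the generic point `x`, as a graph over the coordinates `J` with matrix
entries in a subfield `k` which they generate. -/
structure TangentChart (F : Type*) {k K σ : Type*} [Field F] [Field k] [Field K] [Algebra F k]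
    [Algebra k K] [Algebra F K] [Fintype σ] {d : ℕ}
    (x : σ → K) (J : Fin d → σ) (a : σ → Fin d → k) : Prop where
  generates : GeneratesField F x
  self_mem : x ∈ genTangent F x
  mem_iff : ∀ w, w ∈ genTangent F x ↔ ∀ i, w i = ∑ j, algebraMap k K (a i j) * w (J j)
  normalized : ∀ j' j, a (J j') j = if j' = j then 1 else 0
  generates_chart : GeneratesField F fun ij : σ × Fin d => a ij.1 ij.2

namespace TangentChart

variable {x : σ → K} {J : Fin d → σ} {a : σ → Fin d → k}

theorem derivation_apply (h : TangentChart F x J a) (D : Derivation F K K) (i : σ) :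
    D (x i) = ∑ j, algebraMap k K (a i j) * D (x (J j)) :=
  (h.mem_iff _).1 (derivation_mem_genTangent x D) i

/-- Differentiate the graph equations of `x` itself; the terms without a derivative of `a` cancel
because the vector of derivatives `D x` is tangent. -/
theorem sum_derivation_mul_self (h : TangentChart F x J a) (D : Derivation F K K) (i : σ) :
    ∑ j, D (algebraMap k K (a i j)) * x (J j) = 0 := by
  have h1 := congrArg D ((h.mem_iff x).1 h.self_mem i)
  rw [h.derivation_apply D i, map_sum] at h1
  simp only [Derivation.leibniz, smul_eq_mul, Finset.sum_add_distrib] at h1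
  have h2 := add_eq_left.1 h1.symm
  rw [← h2]
  exact Finset.sum_congr rfl fun j _ => mul_comm _ _

/-- The symmetry of the second fundamental form. -/
theorem second_fundamental_form_symm (h : TangentChart F x J a) (D D' : Derivation F K K)
    (i : σ) : ∑ j, D (algebraMap k K (a i j)) * D' (x (J j)) =
      ∑ j, D' (algebraMap k K (a i j)) * D (x (J j)) := by
  have h1 := congrArg D' (h.derivation_apply D i)
  have h2 := congrArg D (h.derivation_apply D' i)
  -- The commutator is again a derivation, so its value at `x` is tangent. In the difference of the
  -- two orders of differentiation the second derivatives of `x` cancel, which leaves the symmetry.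
  have h3 := h.derivation_apply ⁅D, D'⁆ i
  simp only [Derivation.commutator_apply, mul_sub, Finset.sum_sub_distrib] at h3
  rw [map_sum] at h1 h2
  simp only [Derivation.leibniz, smul_eq_mul, Finset.sum_add_distrib] at h1 h2
  have e1 : ∑ j, D' (x (J j)) * D (algebraMap k K (a i j)) =
      ∑ j, D (algebraMap k K (a i j)) * D' (x (J j)) :=
    Finset.sum_congr rfl fun j _ => mul_comm _ _
  have e2 : ∑ j, D (x (J j)) * D' (algebraMap k K (a i j)) =
      ∑ j, D' (algebraMap k K (a i j)) * D (x (J j)) :=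
    Finset.sum_congr rfl fun j _ => mul_comm _ _
  rw [e2] at h1
  rw [e1] at h2
  linear_combination h3 + h1 - h2

/-- The solution space is the space of derivatives of the generic point along the Gauss fibre. -/
theorem mem_solSpace_iff [CharZero F] (h : TangentChart F x J a) {s : ℕ}
    (hs : Algebra.trdeg F k = s) {w : σ → K} :
    w ∈ solSpace (developableEqs F J a) K ↔ ∃ D : Derivation k K K, ∀ i, D (x i) = w i := by
  obtain ⟨u, hu⟩ := exists_fin_isTranscendenceBasis hs
  obtain ⟨δ, hδ⟩ := exists_derivation_eq_sum (K := K) hu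
  rw [mem_solSpace_developableEqs]
  constructor
  · rintro ⟨hw, hwδ⟩
    obtain ⟨D, hD⟩ := h.generates.exists_derivation ((h.mem_iff w).2 hw)
    -- By symmetry `D'` may differentiate `a` instead of `D`. Then `D'` restricted to `k` is a
    -- combination of the `δ r`, and the equations on `w` apply.
    have hDw : ∀ (D' : Derivation F K K) i,
        ∑ j, D (algebraMap k K (a i j)) * D' (x (J j)) = 0 := by
      intro D' i
      rw [h.second_fundamental_form_symm]
      have := hδ (D'.compAlgebraMap k)
      simp only [hD]
      have h1 : ∀ j, D' (algebraMap k K (a i j)) * w (J j) =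
          ∑ r, D' (algebraMap k K (u r)) * (algebraMap k K (δ r (a i j)) * w (J j)) := by
        intro j
        have h2 : D' (algebraMap k K (a i j)) =
          ∑ r, D' (algebraMap k K (u r)) * algebraMap k K (δ r (a i j)) := this (a i j)
        rw [h2, Finset.sum_mul]
        exact Finset.sum_congr rfl fun r _ => mul_assoc _ _ _
      simp only [h1]
      rw [Finset.sum_comm]
      refine Finset.sum_eq_zero fun r _ => ?_
      rw [← Finset.mul_sum, hwδ, mul_zero]
    have hDa : ∀ i j, D (algebraMap k K (a i j)) = 0 := by
      intro i j
      -- A direction `D'` along column `j` of the tangent matrix: its coordinates in `J` form a unit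
      -- vector, so `hDw` isolates the single entry `(i, j)`. Hence `D` kills `a`, which generates
      -- `k`.
      obtain ⟨D', hD'⟩ := h.generates.exists_derivation
        (w := fun i => algebraMap k K (a i j)) ((h.mem_iff _).2 fun i => by
          simp only [h.normalized]
          simp)
      have := hDw D' i
      simp only [hD', h.normalized] at this
      simpa using this
    have hDk : ∀ z : k, D (algebraMap k K z) = 0 := by
      have : D.compAlgebraMap k = 0 :=
        h.generates_chart.derivation_ext fun ij => hDa ij.1 ij.2
      exact fun z => congrArg (fun D : Derivation F k K => D z) this
    refine ⟨Derivation.mk' { toFun := D, map_add' := D.map_add, map_smul' := fun c z => ?_ }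
      D.leibniz, hD⟩
    rw [Algebra.smul_def, Derivation.leibniz, hDk, smul_zero, add_zero, algebraMap_smul]
    rfl
  · rintro ⟨D, hD⟩
    have hDk : ∀ z : k, D.restrictScalars F (algebraMap k K z) = 0 := fun z => D.map_algebraMap z
    refine ⟨fun i => ?_, fun δ i => ?_⟩
    · simp only [← hD]
      exact h.derivation_apply (D.restrictScalars F) i
    -- Extend `δ` to `K` and use the symmetry again: the side on which `D` differentiates `a` is
    -- zero.
    · obtain ⟨D', hD'⟩ := exists_derivation_extension ((Algebra.linearMap k K).compDer δ)
      have := h.second_fundamental_form_symm (D.restrictScalars F) D' i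
      simp only [hDk, zero_mul, Finset.sum_const_zero, hD'] at this
      simp only [← hD]
      exact this.symm

theorem self_mem_solSpace [CharZero F] (h : TangentChart F x J a) :
    x ∈ solSpace (developableEqs F J a) K := by
  rw [mem_solSpace_developableEqs]
  refine ⟨(h.mem_iff x).1 h.self_mem, fun δ i => ?_⟩
  obtain ⟨D', hD'⟩ := exists_derivation_extension ((Algebra.linearMap k K).compDer δ)
  have := h.sum_derivation_mul_self D' i
  simp only [hD'] at this
  exact this

theorem derivation_ext (h : TangentChart F x J a) {D₁ D₂ : Derivation k K K}
    (hD : ∀ i, D₁ (x i) = D₂ (x i)) : D₁ = D₂ := by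
  have : D₁.restrictScalars F = D₂.restrictScalars F := h.generates.derivation_ext hD
  ext z
  exact congrArg (fun D : Derivation F K K => D z) this

/-- Over `K` the solutions are the values at `x` of the `k`-derivations of `K`, a space of dimension
`trdeg k K`; extension of scalars keeps the dimension. -/
theorem finrank_solSpace [CharZero F] (h : TangentChart F x J a) {s m : ℕ}
    (hs : Algebra.trdeg F k = s) (hm : Algebra.trdeg k K = m) :
    Module.finrank k (solSpace (developableEqs F J a) k) = m := by
  have : CharZero k := charZero_of_injective_algebraMap (algebraMap F k).injective
  rw [← GaussScroll.finrank_solSpace (K := K)]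
  obtain ⟨v, hv⟩ := exists_fin_isTranscendenceBasis hm
  obtain ⟨e, -⟩ := exists_derivation_equiv hv
  let f : Derivation k K K →ₗ[K] solSpace (developableEqs F J a) K :=
    { toFun := fun D => ⟨fun i => D (x i), (h.mem_solSpace_iff hs).2 ⟨D, fun _ => rfl⟩⟩
      map_add' := fun _ _ => rfl
      map_smul' := fun _ _ => rfl }
  have hf : Function.Bijective f := by
    refine ⟨fun D₁ D₂ hD => h.derivation_ext fun i => congrFun (congrArg Subtype.val hD) i, ?_⟩
    rintro ⟨w, hw⟩
    obtain ⟨D, hD⟩ := (h.mem_solSpace_iff hs).1 hw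
    exact ⟨D, Subtype.ext (funext hD)⟩
  rw [← (LinearEquiv.ofBijective f hf).finrank_eq, e.finrank_eq, Module.finrank_fin_fun]

/-- The point `x` is generic in its linear space over `k`: its `m` coordinates `t` in a `k`-basis
are algebraically independent, so a polynomial over `k` vanishing at `x` vanishes identically on the
space. -/
theorem aeval_eq_zero_of_mem_solSpace [CharZero F] (h : TangentChart F x J a) {s m : ℕ}
    (hs : Algebra.trdeg F k = s) (hm : Algebra.trdeg k K = m) {G : MvPolynomial σ k}
    (hG : aeval x G = 0) {y : σ → K} (hy : y ∈ solSpace (developableEqs F J a) K) :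
    aeval y G = 0 := by
  let L := solSpace (developableEqs F J a) k
  let l := Module.finBasisOfFinrankEq k L (h.finrank_solSpace hs hm)
  have hspan : ∀ w ∈ solSpace (developableEqs F J a) K,
      ∃ t : Fin m → K, ∀ i, w i = ∑ r, t r * algebraMap k K ((l r : σ → k) i) := by
    intro w hw
    rw [solSpace_eq_span] at hw
    induction hw using Submodule.span_induction with
    | mem w hw =>
      obtain ⟨y, hy, rfl⟩ := hw
      refine ⟨fun r => algebraMap k K (l.repr ⟨y, hy⟩ r), fun i => ?_⟩
      have h := congrFun (congrArg Subtype.val (l.sum_repr ⟨y, hy⟩)) i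
      have hj := congrArg (algebraMap k K) h
      simp only [Submodule.coe_sum, Finset.sum_apply, map_sum, Submodule.coe_smul,
        Pi.smul_apply, smul_eq_mul, map_mul] at hj
      exact hj.symm
    | zero => exact ⟨0, fun i => by simp⟩
    | add v w _ _ hv hw =>
      obtain ⟨t, ht⟩ := hv
      obtain ⟨t', ht'⟩ := hw
      exact ⟨t + t', fun i => by simp [ht, ht', add_mul, Finset.sum_add_distrib]⟩
    | smul c w _ hw =>
      obtain ⟨t, ht⟩ := hw
      exact ⟨c • t, fun i => by simp [ht, Finset.mul_sum, mul_assoc]⟩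
  obtain ⟨t, ht⟩ := hspan x h.self_mem_solSpace
  obtain ⟨t', ht'⟩ := hspan y hy
  let φ : σ → MvPolynomial (Fin m) k := fun i => ∑ r, X r * C ((l r : σ → k) i)
  have hφ : ∀ (w : σ → K) (t : Fin m → K),
      (∀ i, w i = ∑ r, t r * algebraMap k K ((l r : σ → k) i)) →
      ∀ G : MvPolynomial σ k, aeval w G = aeval t (bind₁ φ G) := by
    intro w t hw G
    rw [aeval_bind₁]
    congr 2
    funext i
    simp [hw i, φ]
  -- Each `x i` is a linear form over `k` in `t`, and `x` generates `K`; so `K` is algebraic over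
  -- `k[t]`, and `m = trdeg k K` parameters leave no room for a relation.
  have halg : Algebra.IsAlgebraic (Algebra.adjoin k (Set.range t)) K := by
    have hmem : ∀ f : MvPolynomial σ F, aeval x f ∈ Algebra.adjoin k (Set.range t) := by
      intro f
      rw [Algebra.adjoin_range_eq_range_aeval]
      refine ⟨bind₁ φ (map (algebraMap F k) f), ?_⟩
      rw [AlgHom.toRingHom_eq_coe, RingHom.coe_coe, ← hφ x t ht, aeval_map_algebraMap]
    refine ⟨fun z => ?_⟩
    obtain ⟨f, g, hg, hz⟩ := h.generates z
    let g' : Algebra.adjoin k (Set.range t) := ⟨_, hmem g⟩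
    let f' : Algebra.adjoin k (Set.range t) := ⟨_, hmem f⟩
    refine ⟨Polynomial.C g' * Polynomial.X - Polynomial.C f', fun h0 => hg ?_, ?_⟩
    · have := congrArg (fun p => Polynomial.coeff p 1) h0
      simp only [Polynomial.coeff_sub, Polynomial.coeff_C_mul, Polynomial.coeff_X_one, mul_one,
        Polynomial.coeff_C_succ, sub_zero, Polynomial.coeff_zero] at this
      exact congrArg Subtype.val this
    · simp only [map_sub, map_mul, Polynomial.aeval_C, Polynomial.aeval_X, sub_eq_zero]
      change aeval x g * z = aeval x f
      rw [mul_comm, hz]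
  have htr : IsTranscendenceBasis k t := by
    have : FaithfulSMul k K := inferInstance
    refine Algebra.IsAlgebraic.isTranscendenceBasis_of_lift_le_trdeg_of_finite k t ?_
    simp [hm]
  rw [hφ y t' ht', (injective_iff_map_eq_zero _).1 htr.1 _ ((hφ x t ht G).symm.trans hG), map_zero]

/-- The generator space is so large that it contains a vector all of whose derivatives it
contains. -/
theorem exists_focal_vector [CharZero F] (h : TangentChart F x J a) {s m : ℕ}
    (hs : Algebra.trdeg F k = s) (hm : Algebra.trdeg k K = m) (hsm : s + m = d)
    (hlt : s * s < m) :
    ∃ p ∈ solSpace (developableEqs F J a) k, p ≠ 0 ∧ ∀ δ : Derivation F k k,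
      (fun i => δ (p i)) ∈ solSpace (developableEqs F J a) k := by
  obtain ⟨u, hu⟩ := exists_fin_isTranscendenceBasis hs
  obtain ⟨δ, hδ⟩ := exists_derivation_eq_sum (K := k) hu
  let L := solSpace (developableEqs F J a) k
  have hL : Module.finrank k L = m := h.finrank_solSpace hs hm
  let T : Submodule k (σ → k) :=
    { carrier := {y | ∀ i, y i = ∑ j, a i j * y (J j)}
      zero_mem' := by
        intro i
        simp
      add_mem' := by
        intro y z hy hz i
        simp only [Pi.add_apply, mul_add, Finset.sum_add_distrib, ← hy i, ← hz i]
      smul_mem' := by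
        intro c y hy i
        simp only [Pi.smul_apply, smul_eq_mul, mul_left_comm _ c, ← Finset.mul_sum, ← hy i] }
  have hLT : L ≤ T := fun y hy => (mem_solSpace_developableEqs.1 hy).1
  have hT : Module.finrank k T ≤ d := by
    let f : T →ₗ[k] (Fin d → k) := (LinearMap.funLeft k k J).comp T.subtype
    have hf : Function.Injective f := by
      intro y z hyz
      ext i
      rw [y.2 i, z.2 i]
      exact Finset.sum_congr rfl fun j _ => by rw [show y.1 (J j) = z.1 (J j) from congrFun hyz j]
    simpa using LinearMap.finrank_le_finrank_of_injective hf
  -- Differentiating `y i = ∑ j, a i j * y (J j)` leaves the tangency of `δ y`, since the terms with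
  -- `δ (a i j)` sum to zero for `y ∈ L`.
  have hδT : ∀ (δ : Derivation F k k) (y : L), (fun i => δ (y.1 i)) ∈ T := by
    intro δ y i
    obtain ⟨h1, h2⟩ := mem_solSpace_developableEqs.1 y.2
    have := congrArg δ (h1 i)
    have h3 := h2 δ i
    simp only [Algebra.algebraMap_self, RingHom.id_apply] at this h3
    rw [map_sum] at this
    simp only [Derivation.leibniz, smul_eq_mul, Finset.sum_add_distrib] at this
    refine this.trans (add_eq_left.2 ?_)
    rw [← h3]
    exact Finset.sum_congr rfl fun j _ => mul_comm _ _
  let L' : Submodule k T := L.comap T.subtype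
  have hL' : Module.finrank k L' = m := by
    rw [← hL]
    exact (Submodule.comapSubtypeEquivOfLe hLT).finrank_eq
  have hquot : Module.finrank k (T ⧸ L') ≤ s := by
    have := L'.finrank_quotient_add_finrank
    omega
  -- Derivations are not `k`-linear, but the defect `δ r c • y` lies in `L`; modulo `L` the map is
  -- linear. Its target has dimension at most `s * s < m`.
  let Φ : L →ₗ[k] (Fin s → T ⧸ L') :=
    { toFun := fun y r => L'.mkQ ⟨_, hδT (δ r) y⟩
      map_add' := by
        intro y z
        funext r
        rw [Pi.add_apply, ← map_add]
        congr 1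
        ext i
        exact map_add (δ r) _ _
      map_smul' := by
        intro c y
        funext r
        rw [RingHom.id_apply, Pi.smul_apply, ← map_smul, ← sub_eq_zero, ← map_sub,
          Submodule.mkQ_apply, Submodule.Quotient.mk_eq_zero]
        have : (δ r c • y.1) ∈ L := L.smul_mem _ y.2
        suffices hsub : (fun i => δ r ((c • y).1 i)) - c • (fun i => δ r (y.1 i)) = δ r c • y.1 by
          change (fun i => δ r ((c • y).1 i)) - c • (fun i => δ r (y.1 i)) ∈ L
          rwa [hsub]
        ext i
        change δ r (c * y.1 i) - c * δ r (y.1 i) = δ r c * y.1 i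
        rw [Derivation.leibniz, smul_eq_mul, smul_eq_mul]
        ring }
  have hker : LinearMap.ker Φ ≠ ⊥ := by
    refine LinearMap.ker_ne_bot_of_finrank_lt ?_
    rw [Module.finrank_pi_fintype, hL]
    refine lt_of_le_of_lt (Finset.sum_le_sum fun _ _ => hquot) ?_
    simpa using hlt
  obtain ⟨p, hp, hp0⟩ := Submodule.exists_mem_ne_zero_of_ne_bot hker
  refine ⟨p, p.2, fun h0 => hp0 (Subtype.ext h0), fun D => ?_⟩
  have hr : ∀ r, (fun i => δ r (p.1 i)) ∈ L := by
    intro r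
    have := congrFun (LinearMap.mem_ker.1 hp) r
    exact (Submodule.Quotient.mk_eq_zero L').1 this
  have : (fun i => D (p.1 i)) = ∑ r, D (u r) • fun i => δ r (p.1 i) := by
    funext i
    rw [hδ D, Finset.sum_apply]
    rfl
  rw [this]
  exact Submodule.sum_mem _ fun r _ => Submodule.smul_mem _ _ (hr r)

end TangentChart

end Developable

end GaussScroll

/-! ### Affine cones: scaling a point by a transcendental parameter. -/

namespace GaussScroll

section ConeTangent

open MvPolynomial

theorem aeval_mul_of_isHomogeneous {F K σ : Type*} [Field F] [Field K] [Algebra F K] [Fintype σ]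
    {f : MvPolynomial σ F} {n : ℕ} (hf : f.IsHomogeneous n) (c : K) (y : σ → K) :
    aeval (fun i => c * y i) f = c ^ n * aeval y f := by
  rw [aeval_def, aeval_def, eval₂_eq', eval₂_eq', Finset.mul_sum]
  refine Finset.sum_congr rfl fun e he => ?_
  have hn := hf.degree_eq_sum_deg_support he
  rw [Finset.sum_subset (Finset.subset_univ _) fun i _ hi => Finsupp.notMem_support_iff.1 hi] at hn
  simp only [mul_pow, Finset.prod_mul_distrib, Finset.prod_pow_eq_pow_sum]
  rw [← hn]
  ring

variable {F k K σ ι : Type*} [Field F] [Field k] [Field K] [Algebra F k]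
  [Algebra k K] [Algebra F K] [IsScalarTower F k K]

theorem aeval_algebraMap_comp (p : σ → k) (f : MvPolynomial σ F) :
    aeval (fun i => algebraMap k K (p i)) f = algebraMap k K (aeval p f) :=
  aeval_algebraMap_apply K p f

theorem generatesField_adjoin (q : σ → K) :
    GeneratesField F fun i => (⟨q i, IntermediateField.subset_adjoin F _ ⟨i, rfl⟩⟩ :
      IntermediateField.adjoin F (Set.range q)) := by
  rintro ⟨z, hz⟩
  rw [IntermediateField.mem_adjoin_range_iff] at hz
  obtain ⟨r, s, rfl⟩ := hz
  have hcoe : ∀ f : MvPolynomial σ F,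
      ((aeval (fun i => (⟨q i, IntermediateField.subset_adjoin F _ ⟨i, rfl⟩⟩ :
        IntermediateField.adjoin F (Set.range q))) f : IntermediateField.adjoin F (Set.range q)) :
          K) = aeval q f := by
    intro f
    exact (aeval_algebraMap_comp (k := IntermediateField.adjoin F (Set.range q)) _ f).symm
  by_cases hs : aeval q s = 0
  · refine ⟨0, 1, by simp, Subtype.ext ?_⟩
    simp [hs]
  · refine ⟨r, s, fun h0 => hs ?_, Subtype.ext ?_⟩
    · rw [← hcoe, h0]
      rfl
    · change aeval q r / aeval q s * _ = _
      rw [hcoe, hcoe, div_mul_cancel₀ _ hs]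

variable [Fintype σ]

/-- Here `q` need not generate `K`. Over the subfield it generates, tangent vectors are values of
derivations; the tangent equations have coefficients there, and its derivations extend to `K`. -/
theorem genTangent_eq_span_derivation [CharZero F] (q : σ → K) {d : ℕ}
    (hd : Algebra.trdeg F (IntermediateField.adjoin F (Set.range q)) = d) :
    Module.finrank K (genTangent F q) = d ∧
      genTangent F q = Submodule.span K {w | ∃ D : Derivation F K K, w = fun i => D (q i)} := by
  let k' := IntermediateField.adjoin F (Set.range q)
  let q' : σ → k' := fun i => ⟨q i, IntermediateField.subset_adjoin F _ ⟨i, rfl⟩⟩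
  have hq' : GeneratesField F q' := generatesField_adjoin q
  have hcoe : ∀ f : MvPolynomial σ F, algebraMap k' K (aeval q' f) = aeval q f := fun f =>
    (aeval_algebraMap_comp _ f).symm
  let E : Set (σ → k') := {e | ∃ f : MvPolynomial σ F, aeval q' f = 0 ∧
    e = fun i => aeval q' (pderiv i f)}
  have hE : genTangent F q = solSpace E K := by
    ext w
    constructor
    · rintro hw _ ⟨f, hf, rfl⟩
      rw [← hw f (by rw [← hcoe, hf, map_zero])]
      exact Finset.sum_congr rfl fun i _ => by rw [hcoe, mul_comm]
    · intro hw f hf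
      have hf' : aeval q' f = 0 := (algebraMap k' K).injective (by rw [hcoe, hf, map_zero])
      rw [← hw _ ⟨f, hf', rfl⟩]
      exact Finset.sum_congr rfl fun i _ => by rw [hcoe, mul_comm]
  have hE' : solSpace E k' = genTangent F q' := by
    ext w
    constructor
    · intro hw f hf
      rw [← hw _ ⟨f, hf, rfl⟩]
      exact Finset.sum_congr rfl fun i _ => mul_comm _ _
    · rintro hw _ ⟨f, hf, rfl⟩
      rw [← hw f hf]
      exact Finset.sum_congr rfl fun i _ => mul_comm _ _
  refine ⟨?_, le_antisymm ?_ ?_⟩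
  · rw [hE, finrank_solSpace, hE']
    exact hq'.finrank_genTangent hd
  · rw [hE, solSpace_eq_span, hE']
    refine Submodule.span_mono ?_
    rintro _ ⟨y, hy, rfl⟩
    obtain ⟨D, hD⟩ := hq'.exists_derivation hy
    obtain ⟨D', hD'⟩ := exists_derivation_extension ((Algebra.linearMap k' K).compDer D)
    refine ⟨D', funext fun i => ?_⟩
    change algebraMap k' K (y i) = _
    rw [← hD]
    exact (hD' (q' i)).symm
  · rw [Submodule.span_le]
    rintro _ ⟨D, rfl⟩
    exact derivation_mem_genTangent q D

theorem trdeg_eq_of_isFractionRing (F : Type*) {A K : Type*} [Field F] [CommRing A] [IsDomain A]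
    [Field K] [Algebra F A] [Algebra A K] [Algebra F K] [IsScalarTower F A K]
    [IsFractionRing A K] {d : ℕ} : Algebra.trdeg F K = d ↔ Algebra.trdeg F A = d := by
  have : FaithfulSMul A K := (faithfulSMul_iff_algebraMap_injective _ _).2
    (IsFractionRing.injective A K)
  have : FaithfulSMul F A := inferInstance
  have : Algebra.IsAlgebraic A K := IsLocalization.isAlgebraic K (nonZeroDivisors A)
  have h := lift_trdeg_add_eq F A K
  rw [trdeg_eq_zero (R := A) (A := K), Cardinal.lift_zero, add_zero] at h
  rw [← Cardinal.lift_eq_nat_iff, ← h, Cardinal.lift_eq_nat_iff]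

/-- The Krull dimension of the affine coordinate ring of the locus of a point is the dimension of
the tangent space there. -/
theorem exists_ringKrullDim_eq_and_finrank_eq [CharZero F] (q : σ → K)
    {I : Ideal (MvPolynomial σ F)} (hI : ∀ f, f ∈ I ↔ aeval q f = 0) :
    ∃ d : ℕ, ringKrullDim (MvPolynomial σ F ⧸ I) = (d : WithBot ℕ∞) ∧
      Algebra.trdeg F (IntermediateField.adjoin F (Set.range q)) = d := by
  have hker : I = RingHom.ker (aeval q : MvPolynomial σ F →ₐ[F] K) := by
    ext f
    exact hI f
  subst hker
  let e := Ideal.quotientKerEquivRange (aeval q : MvPolynomial σ F →ₐ[F] K)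
  let A := Algebra.adjoin F (Set.range q)
  have hA : A = (aeval q : MvPolynomial σ F →ₐ[F] K).range :=
    Algebra.adjoin_range_eq_range_aeval F q
  let e' := e.trans (Subalgebra.equivOfEq _ _ hA.symm)
  have : Algebra.FiniteType F A := Algebra.FiniteType.equiv inferInstance e'
  obtain ⟨d, h1, h2⟩ := exists_ringKrullDim_eq_and_trdeg_eq F A
  refine ⟨d, ?_, ?_⟩
  · rw [ringKrullDim_eq_of_ringEquiv e'.toRingEquiv, h1]
  · open scoped IntermediateField.algebraAdjoinAdjoin in
    exact (trdeg_eq_of_isFractionRing F (A := A)).2 h2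

/-- The value at the scaled point is a polynomial in `lam` whose coefficients are the values at `p`
of the homogeneous components. Thus `lam • p` is a generic point of the affine cone over the locus
of `p`. -/
theorem aeval_mul_eq_zero_iff_homogeneousComponent {lam : K} (hlam : Transcendental k lam)
    (p : σ → k) (f : MvPolynomial σ F) :
    aeval (fun i => lam * algebraMap k K (p i)) f = 0 ↔
      ∀ n, aeval p (homogeneousComponent n f) = 0 := by
  have hcomp : aeval (fun i => lam * algebraMap k K (p i)) f =
      ∑ n ∈ Finset.range (f.totalDegree + 1),
        algebraMap k K (aeval p (homogeneousComponent n f)) * lam ^ n := by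
    conv_lhs => rw [← sum_homogeneousComponent f, map_sum]
    refine Finset.sum_congr rfl fun n _ => ?_
    rw [aeval_mul_of_isHomogeneous (homogeneousComponent_isHomogeneous n f) lam, mul_comm,
      aeval_algebraMap_comp]
  rw [hcomp]
  constructor
  · intro h n
    let P : Polynomial k := ∑ n ∈ Finset.range (f.totalDegree + 1),
      Polynomial.monomial n (aeval p (homogeneousComponent n f))
    have hP : P = 0 := by
      by_contra hne
      refine hlam ⟨P, hne, ?_⟩
      rw [← h, map_sum]
      exact Finset.sum_congr rfl fun n _ => Polynomial.aeval_monomial _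
    by_cases hn : n < f.totalDegree + 1
    · have := congrArg (fun P => Polynomial.coeff P n) hP
      simp only [P, Polynomial.finsetSum_coeff, Polynomial.coeff_monomial,
        Polynomial.coeff_zero] at this
      rwa [Finset.sum_ite_eq' , if_pos (Finset.mem_range.2 hn)] at this
    · rw [homogeneousComponent_eq_zero n f (by omega), map_zero]
  · intro h
    exact Finset.sum_eq_zero fun n _ => by rw [h, map_zero, zero_mul]

/-- Tangent spaces of cones are constant along the generators. -/
theorem mem_genTangent_mul_iff {lam : K} (hlam : Transcendental k lam) (p : σ → k) (w : σ → K) :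
    w ∈ genTangent F (fun i => lam * algebraMap k K (p i)) ↔
      ∀ f : MvPolynomial σ F, aeval (fun i => lam * algebraMap k K (p i)) f = 0 →
        ∑ i, algebraMap k K (aeval p (pderiv i f)) * w i = 0 := by
  have hlam0 : lam ≠ 0 := fun h0 => hlam (h0 ▸ isAlgebraic_zero)
  have hscale : ∀ (f : MvPolynomial σ F) (n : ℕ), f.IsHomogeneous n →
      ∑ i, w i * aeval (fun i => lam * algebraMap k K (p i)) (pderiv i f) =
        lam ^ (n - 1) * ∑ i, algebraMap k K (aeval p (pderiv i f)) * w i := by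
    intro f n hf
    rw [Finset.mul_sum]
    refine Finset.sum_congr rfl fun i _ => ?_
    rw [aeval_mul_of_isHomogeneous hf.pderiv, aeval_algebraMap_comp]
    ring
  have hcomp : ∀ f : MvPolynomial σ F, aeval (fun i => lam * algebraMap k K (p i)) f = 0 → ∀ n,
      aeval (fun i => lam * algebraMap k K (p i)) (homogeneousComponent n f) = 0 := by
    intro f hf n
    rw [aeval_mul_of_isHomogeneous (homogeneousComponent_isHomogeneous n f),
      aeval_algebraMap_comp, (aeval_mul_eq_zero_iff_homogeneousComponent hlam p f).1 hf n,
      map_zero, mul_zero]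
  constructor
  · intro hw f hf
    have h0 : ∀ n, ∑ i, algebraMap k K (aeval p (pderiv i (homogeneousComponent n f))) * w i =
        0 := by
      intro n
      have := hw _ (hcomp f hf n)
      rw [hscale _ n (homogeneousComponent_isHomogeneous n f)] at this
      exact (mul_eq_zero.1 this).resolve_left (pow_ne_zero _ hlam0)
    conv_lhs => rw [← sum_homogeneousComponent f]
    simp only [map_sum, Finset.sum_mul]
    rw [Finset.sum_comm]
    exact Finset.sum_eq_zero fun n _ => h0 n
  · intro hw f hf
    conv_lhs => rw [← sum_homogeneousComponent f]
    simp only [map_sum, Finset.mul_sum]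
    rw [Finset.sum_comm]
    refine Finset.sum_eq_zero fun n _ => ?_
    rw [hscale _ n (homogeneousComponent_isHomogeneous n f), hw _ (hcomp f hf n), mul_zero]

theorem derivation_eq_zero_of_isAlgebraic [CharZero k] (D : Derivation k K K) {z : K}
    (hz : IsAlgebraic k z) : D z = 0 := by
  have h := D.map_aeval (minpoly k z) z
  rw [minpoly.aeval, map_zero] at h
  have hsep : (minpoly k z).Separable := (minpoly.irreducible hz.isIntegral).separable
  exact (smul_eq_zero.1 h.symm).resolve_left
    (hsep.aeval_derivative_ne_zero (minpoly.aeval k z))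

variable [DecidableEq σ] {d : ℕ} {x : σ → K} {J : Fin d → σ} {a : σ → Fin d → k}

/-- Since `x` lies in the solution space, some `k`-derivation has `D (x i) = x i` for all `i`,
whereas it kills everything algebraic over `k`. -/
theorem TangentChart.transcendental [CharZero F] (h : TangentChart F x J a) {s : ℕ}
    (hs : Algebra.trdeg F k = s) {i : σ} (hi : x i ≠ 0) : Transcendental k (x i) := by
  have : CharZero k := charZero_of_injective_algebraMap (algebraMap F k).injective
  obtain ⟨D, hD⟩ := (h.mem_solSpace_iff hs).1 h.self_mem_solSpace
  intro halg
  exact hi (by rw [← hD, derivation_eq_zero_of_isAlgebraic D halg])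

/-- Every derivative of `lam • p` is a combination of `p` and of the `δ r p`, all of which lie in
the solution space by the focal condition. -/
theorem genTangent_le_solSpace [CharZero F] {s : ℕ}
    (hs : Algebra.trdeg F k = s) {p : σ → k} (hp : p ∈ solSpace (developableEqs F J a) k)
    (hpδ : ∀ δ : Derivation F k k, (fun i => δ (p i)) ∈ solSpace (developableEqs F J a) k)
    (lam : K) {r : ℕ} (hr : Algebra.trdeg F (IntermediateField.adjoin F
      (Set.range fun i => lam * algebraMap k K (p i))) = r) :
    genTangent F (fun i => lam * algebraMap k K (p i)) ≤ solSpace (developableEqs F J a) K := by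
  obtain ⟨u, hu⟩ := exists_fin_isTranscendenceBasis hs
  obtain ⟨δ, hδ⟩ := exists_derivation_eq_sum (K := K) hu
  rw [(genTangent_eq_span_derivation _ hr).2, Submodule.span_le]
  rintro _ ⟨D, rfl⟩
  have : (fun i => D (lam * algebraMap k K (p i))) = D lam • mapVec K p +
      ∑ r, (lam * D (algebraMap k K (u r))) • mapVec K fun i => δ r (p i) := by
    funext i
    rw [Derivation.leibniz, Pi.add_apply, Finset.sum_apply, add_comm]
    congr 1
    · rw [smul_eq_mul, mul_comm]
      rfl
    · have := hδ (D.compAlgebraMap k) (p i)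
      change D (algebraMap k K (p i)) = ∑ r, D (algebraMap k K (u r)) * _ at this
      rw [this, smul_eq_mul, Finset.mul_sum]
      exact Finset.sum_congr rfl fun r _ => (mul_assoc _ _ _).symm
  rw [this]
  exact Submodule.add_mem _ (Submodule.smul_mem _ _ (mapVec_mem_solSpace.2 hp))
    (Submodule.sum_mem _ fun r _ => Submodule.smul_mem _ _ (mapVec_mem_solSpace.2 (hpδ _)))

end ConeTangent

end GaussScroll

/-! ### Specialization of ranks and of linear spaces from the generic to a general point. -/

namespace GaussScroll

section Specialization

open MvPolynomial

variable {F k K ι α β σ : Type*} [Field F] [Field k] [Field K] [Algebra F k]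
  [Algebra k K] [Algebra F K] [IsScalarTower F k K]

/-- `c` satisfies all algebraic relations over `F` between the coordinates of `z`. -/
def IsSpecialization (F : Type*) {k ι : Type*} [Field F] [Field k] [Algebra F k] (z : ι → k)
    (c : ι → F) : Prop :=
  ∀ G : MvPolynomial ι F, aeval z G = 0 → eval c G = 0

theorem IsSpecialization.eval_eq {z : ι → k} {c : ι → F} (hc : IsSpecialization F z c)
    {G H : MvPolynomial ι F} (h : aeval z G = aeval z H) : eval c G = eval c H := by
  have := hc (G - H) (by rw [map_sub, h, sub_self])
  rwa [map_sub, sub_eq_zero] at this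

theorem GeneratesField.exists_common_denominator [Finite α] {z : ι → k}
    (hz : GeneratesField F z) (y : α → k) :
    ∃ (g : MvPolynomial ι F) (f : α → MvPolynomial ι F), aeval z g ≠ 0 ∧
      ∀ i, aeval z g * y i = aeval z (f i) := by
  classical
  have := Fintype.ofFinite α
  choose f g hg hf using fun i => hz (y i)
  refine ⟨∏ i, g i, fun i => f i * ∏ j ∈ Finset.univ.erase i, g j, ?_, fun i => ?_⟩
  · rw [map_prod]
    exact Finset.prod_ne_zero_iff.2 fun i _ => hg i
  · rw [← Finset.mul_prod_erase _ _ (Finset.mem_univ i), map_mul, map_mul, ← hf]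
    ring

/-- A certificate of the rank by an equation. Cleared of denominators it is a polynomial identity at
`z`, and so survives specialization. -/
theorem exists_mul_mul_eq_one [Fintype α] [Fintype β] [DecidableEq α] [DecidableEq β]
    (M : Matrix α β k) :
    ∃ (P : Matrix (Fin M.rank) α k) (Q : Matrix β (Fin M.rank) k), P * M * Q = 1 := by
  let f := Matrix.toLin' M
  let b := Module.finBasisOfFinrankEq k (LinearMap.range M.mulVecLin) (n := M.rank) rfl
  choose v hv using fun j => (b j).2
  let q : (Fin M.rank → k) →ₗ[k] (β → k) := (Pi.basisFun k _).constr k v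
  have hfq : LinearMap.ker (f ∘ₗ q) = ⊥ := by
    have : f ∘ₗ q = (LinearMap.range M.mulVecLin).subtype ∘ₗ b.equivFun.symm.toLinearMap := by
      refine (Pi.basisFun k (Fin M.rank)).ext fun j => ?_
      simp only [LinearMap.comp_apply, q, Module.Basis.constr_basis, Submodule.subtype_apply]
      refine (hv j).trans ?_
      simp [Module.Basis.equivFun_symm_apply, Pi.single_apply]
    rw [this, LinearMap.ker_comp_of_ker_eq_bot _ (Submodule.ker_subtype _)]
    exact LinearEquiv.ker _
  obtain ⟨p, hp⟩ := (f ∘ₗ q).exists_leftInverse_of_injective hfq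
  refine ⟨LinearMap.toMatrix' p, LinearMap.toMatrix' q, ?_⟩
  have e : LinearMap.toMatrix' p * LinearMap.toMatrix' (Matrix.toLin' M) * LinearMap.toMatrix' q =
      1 := by
    rw [Matrix.mul_assoc, ← LinearMap.toMatrix'_comp, ← LinearMap.toMatrix'_comp,
      ← LinearMap.toMatrix'_id]
    exact congrArg LinearMap.toMatrix' hp
  rwa [LinearMap.toMatrix'_toLin'] at e

/-- The rank of a matrix does not drop under a general specialization. -/
theorem GeneratesField.exists_rank_le [Fintype α] [Fintype β] {z : ι → k}
    (hz : GeneratesField F z) (M : Matrix α β (MvPolynomial ι F)) :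
    ∃ r : MvPolynomial ι F, aeval z r ≠ 0 ∧ ∀ c, IsSpecialization F z c → eval c r ≠ 0 →
      (M.map (aeval z)).rank ≤ (M.map (eval c)).rank := by
  classical
  obtain ⟨P, Q, hPQ⟩ := exists_mul_mul_eq_one (M.map (aeval z : MvPolynomial ι F →ₐ[F] k))
  obtain ⟨g, P', hg, hP'⟩ := hz.exists_common_denominator fun ij : _ × _ => P ij.1 ij.2
  obtain ⟨h, Q', hh, hQ'⟩ := hz.exists_common_denominator fun ij : _ × _ => Q ij.1 ij.2
  refine ⟨g * h, by rw [map_mul]; exact mul_ne_zero hg hh, fun c hc hr => ?_⟩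
  let P₁ : Matrix _ _ (MvPolynomial ι F) := Matrix.of fun i j => P' (i, j)
  let Q₁ : Matrix _ _ (MvPolynomial ι F) := Matrix.of fun i j => Q' (i, j)
  have hz1 : (P₁ * M * Q₁).map (aeval z) = ((g * h) •
      (1 : Matrix (Fin (M.map (aeval z)).rank) _ (MvPolynomial ι F))).map (aeval z) := by
    have e1 : P₁.map (aeval z) = aeval z g • P := by
      ext i j
      exact (hP' (i, j)).symm
    have e2 : Q₁.map (aeval z) = aeval z h • Q := by
      ext i j
      exact (hQ' (i, j)).symm
    rw [Matrix.map_mul, Matrix.map_mul, e1, e2, Matrix.smul_mul, Matrix.smul_mul, Matrix.mul_smul,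
      hPQ, smul_smul]
    ext i j
    by_cases hij : i = j <;> simp [hij]
  have hc1 : (P₁ * M * Q₁).map (eval c) = ((g * h) •
      (1 : Matrix (Fin (M.map (aeval z)).rank) _ (MvPolynomial ι F))).map (eval c) := by
    ext i j
    exact hc.eval_eq (congrFun (congrFun hz1 i) j)
  have hc2 : ((g * h) • (1 : Matrix (Fin (M.map (aeval z)).rank)
      (Fin (M.map (aeval z)).rank) (MvPolynomial ι F))).map (eval c) =
      eval c (g * h) • 1 := by
    ext i j
    by_cases hij : i = j <;> simp [hij]
  rw [Matrix.map_mul, Matrix.map_mul, hc2] at hc1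
  have hrank : (eval c (g * h) • (1 : Matrix (Fin (M.map (aeval z)).rank)
      (Fin (M.map (aeval z)).rank) F)).rank =
      (M.map (aeval z)).rank := by
    rw [Matrix.rank_of_isUnit, Fintype.card_fin]
    exact (Matrix.isUnit_iff_isUnit_det _).2 (by
      rw [Matrix.det_smul, Matrix.det_one, mul_one]
      exact (IsUnit.mk0 _ hr).pow _)
  rw [← hrank, ← hc1]
  exact (Matrix.rank_mul_le_left _ _).trans (Matrix.rank_mul_le_right _ _)

/-- A family of linear spaces `range A = ker B` depending on parameters, with the generic
member `V`. -/
structure SubspaceFamily {F k ι σ : Type*} [Field F] [Field k] [Algebra F k] [Fintype σ]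
    (z : ι → k) (V : Submodule k (σ → k)) (A B : Matrix σ σ (MvPolynomial ι F))
    (r : MvPolynomial ι F) : Prop where
  ne_zero : aeval z r ≠ 0
  range_eq : LinearMap.range (A.map (aeval z)).mulVecLin = V
  ker_eq : LinearMap.ker (B.map (aeval z)).mulVecLin = V
  range_eq_ker : ∀ c, IsSpecialization F z c → eval c r ≠ 0 →
    LinearMap.range (A.map (eval c)).mulVecLin = LinearMap.ker (B.map (eval c)).mulVecLin
  finrank_ker : ∀ c, IsSpecialization F z c → eval c r ≠ 0 →
    Module.finrank F (LinearMap.ker (B.map (eval c)).mulVecLin) = Module.finrank k V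

theorem GeneratesField.exists_matrix [Fintype α] [Fintype β] [DecidableEq β] {z : ι → k}
    (hz : GeneratesField F z) (f : (β → k) →ₗ[k] (α → k)) :
    ∃ (g : MvPolynomial ι F) (A : Matrix α β (MvPolynomial ι F)), aeval z g ≠ 0 ∧
      (A.map (aeval z)).mulVecLin = aeval z g • f := by
  obtain ⟨g, A, hg, hA⟩ := hz.exists_common_denominator
    fun ij : α × β => LinearMap.toMatrix' f ij.1 ij.2
  refine ⟨g, Matrix.of fun i j => A (i, j), hg, ?_⟩
  have : (Matrix.of fun i j => A (i, j)).map (aeval z) = aeval z g • LinearMap.toMatrix' f := by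
    ext i j
    exact (hA (i, j)).symm
  rw [this, ← Matrix.toLin'_apply', map_smul, Matrix.toLin'_toMatrix']

/-- `A` and `B` are a projection onto `V` and its complementary projection, cleared of denominators.
The relation `B * A = 0` persists at a specialization and neither rank drops, so the dimension count
forces range and kernel to stay equal. -/
theorem GeneratesField.exists_subspaceFamily [Fintype σ] {z : ι → k} (hz : GeneratesField F z)
    (V : Submodule k (σ → k)) : ∃ A B r, SubspaceFamily (F := F) z V A B r := by
  classical
  obtain ⟨W, hW⟩ := V.exists_isCompl
  let π : (σ → k) →ₗ[k] (σ → k) := V.subtype ∘ₗ Submodule.projectionOnto V W hW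
  have hπ : LinearMap.range π = V := by
    rw [LinearMap.range_comp, Submodule.range_projectionOnto, Submodule.map_top,
      Submodule.range_subtype]
  have hπV : ∀ v ∈ V, π v = v := fun v hv => by
    change ((Submodule.projectionOnto V W hW v : V) : σ → k) = v
    rw [Submodule.projectionOnto_apply_left hW ⟨v, hv⟩]
  have hker : LinearMap.ker (LinearMap.id - π) = V := by
    ext v
    rw [LinearMap.mem_ker, LinearMap.sub_apply, LinearMap.id_apply, sub_eq_zero]
    constructor
    · intro h
      rw [h, ← hπ]
      exact ⟨v, rfl⟩
    · exact fun h => (hπV v h).symm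
  obtain ⟨g, A, hg, hA⟩ := hz.exists_matrix π
  obtain ⟨h, B, hh, hB⟩ := hz.exists_matrix (LinearMap.id - π)
  obtain ⟨r₁, hr₁, hr₁'⟩ := hz.exists_rank_le A
  obtain ⟨r₂, hr₂, hr₂'⟩ := hz.exists_rank_le B
  have hrA : LinearMap.range (A.map (aeval z)).mulVecLin = V := by
    rw [hA, LinearMap.range_smul _ _ hg, hπ]
  have hkB : LinearMap.ker (B.map (aeval z)).mulVecLin = V := by
    rw [hB, LinearMap.ker_smul _ _ hh, hker]
  have hBA : (B * A).map (aeval z) = 0 := by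
    rw [Matrix.map_mul]
    refine Matrix.toLin'.injective ?_
    rw [Matrix.toLin'_apply', Matrix.mulVecLin_mul, map_zero]
    ext v : 1
    refine LinearMap.ext fun y => ?_
    have : (A.map (aeval z)).mulVecLin ((LinearMap.single k (fun _ => k) v) y) ∈ V := by
      rw [← hrA]
      exact ⟨_, rfl⟩
    rw [← hkB] at this
    exact this
  have key : ∀ c, IsSpecialization F z c → eval c (r₁ * r₂) ≠ 0 →
      LinearMap.range (A.map (eval c)).mulVecLin = LinearMap.ker (B.map (eval c)).mulVecLin ∧
      Module.finrank F (LinearMap.ker (B.map (eval c)).mulVecLin) = Module.finrank k V := by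
    intro c hc hr
    rw [map_mul] at hr
    have h1 := hr₁' c hc (left_ne_zero_of_mul hr)
    have h2 := hr₂' c hc (right_ne_zero_of_mul hr)
    have hle : LinearMap.range (A.map (eval c)).mulVecLin ≤
        LinearMap.ker (B.map (eval c)).mulVecLin := by
      rintro _ ⟨y, rfl⟩
      have hBA' : (B * A).map (eval c) = 0 := by
        ext i j
        have : aeval z ((B * A) i j) = 0 := congrFun (congrFun hBA i) j
        exact hc _ this
      rw [LinearMap.mem_ker, Matrix.mulVecLin_apply, Matrix.mulVecLin_apply,
        Matrix.mulVec_mulVec, ← Matrix.map_mul, hBA', Matrix.zero_mulVec]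
    have d1 := (B.map (eval c)).mulVecLin.finrank_range_add_finrank_ker
    have d2 := (B.map (aeval z)).mulVecLin.finrank_range_add_finrank_ker
    rw [hkB] at d2
    have d3 := Submodule.finrank_mono hle
    rw [Matrix.rank, hrA] at h1
    rw [Matrix.rank, Matrix.rank] at h2
    simp only [Module.finrank_fintype_fun_eq_card] at d1 d2
    rw [Matrix.rank] at h1
    exact ⟨Submodule.eq_of_le_of_finrank_le hle (by omega), by omega⟩
  exact ⟨A, B, r₁ * r₂, by rw [map_mul]; exact mul_ne_zero hr₁ hr₂, hrA, hkB,
    fun c hc hr => (key c hc hr).1, fun c hc hr => (key c hc hr).2⟩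

namespace SubspaceFamily

variable [Fintype σ] {z : ι → k} {V V' : Submodule k (σ → k)}
  {A B A' B' : Matrix σ σ (MvPolynomial ι F)} {r r' : MvPolynomial ι F} {c : ι → F}

theorem eval_mem (h : SubspaceFamily z V A B r) (hc : IsSpecialization F z c)
    {p : σ → MvPolynomial ι F} (hp : (fun i => aeval z (p i)) ∈ V) :
    (fun i => eval c (p i)) ∈ LinearMap.ker (B.map (eval c)).mulVecLin := by
  rw [← h.ker_eq] at hp
  rw [LinearMap.mem_ker] at hp ⊢
  funext i
  have := congrFun hp i
  have h2 := hc (∑ j, B i j * p j) (by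
    rw [map_sum]
    exact (Finset.sum_congr rfl fun j _ => map_mul _ _ _).trans this)
  rw [map_sum] at h2
  exact (Finset.sum_congr rfl fun j _ => (map_mul (eval c) (B i j) (p j)).symm).trans h2

theorem ker_le_ker (h : SubspaceFamily z V A B r) (h' : SubspaceFamily z V' A' B' r')
    (hle : V ≤ V') (hc : IsSpecialization F z c) (hr : eval c r ≠ 0) :
    LinearMap.ker (B.map (eval c)).mulVecLin ≤ LinearMap.ker (B'.map (eval c)).mulVecLin := by
  classical
  rw [← h.range_eq_ker c hc hr]
  rintro _ ⟨y, rfl⟩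
  have hcol : ∀ j, (fun i => eval c (A i j)) ∈ LinearMap.ker (B'.map (eval c)).mulVecLin := by
    intro j
    refine h'.eval_mem hc (hle ?_)
    rw [← h.range_eq]
    exact ⟨Pi.single j 1, by rw [Matrix.mulVecLin_apply, Matrix.mulVec_single_one]; rfl⟩
  have : (A.map (eval c)).mulVecLin y = ∑ j, y j • fun i => eval c (A i j) := by
    funext i
    rw [Finset.sum_apply]
    exact Finset.sum_congr rfl fun j _ => mul_comm _ _
  rw [this]
  exact Submodule.sum_mem _ fun j _ => Submodule.smul_mem _ _ (hcol j)

end SubspaceFamily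

theorem exists_mulVec_eq_of_mem_solSpace [Fintype σ] {E : Set (σ → k)} {A : Matrix σ σ k}
    (hA : LinearMap.range A.mulVecLin = solSpace E k) {x : σ → K} (hx : x ∈ solSpace E K) :
    ∃ t : σ → K, ∀ i, x i = ∑ j, algebraMap k K (A i j) * t j := by
  rw [solSpace_eq_span] at hx
  induction hx using Submodule.span_induction with
  | mem w hw =>
    obtain ⟨y, hy, rfl⟩ := hw
    rw [← hA] at hy
    obtain ⟨t, rfl⟩ := hy
    refine ⟨mapVec K t, fun i => ?_⟩
    simp only [mapVec, ← map_mul, ← map_sum]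
    rfl
  | zero => exact ⟨0, fun i => by simp⟩
  | add v w _ _ hv hw =>
    obtain ⟨t, ht⟩ := hv
    obtain ⟨t', ht'⟩ := hw
    exact ⟨t + t', fun i => by simp [ht, ht', mul_add, Finset.sum_add_distrib]⟩
  | smul c w _ hw =>
    obtain ⟨t, ht⟩ := hw
    exact ⟨c • t, fun i => by simp [ht, Finset.mul_sum, mul_left_comm]⟩

/-- A polynomial that does not vanish at a point of a linear space over an extension field does
not vanish at some point with parameters in the infinite ground field. -/
theorem exists_aeval_mulVec_ne_zero [Infinite F] [Fintype σ] {A : Matrix σ σ k} {x : σ → K}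
    {t : σ → K} (hx : ∀ i, x i = ∑ j, algebraMap k K (A i j) * t j) {g : MvPolynomial σ F}
    (hg : aeval x g ≠ 0) :
    ∃ τ : σ → F, aeval (fun i => ∑ j, A i j * algebraMap F k (τ j)) g ≠ 0 := by
  by_contra! hcon
  let φ : σ → MvPolynomial σ k := fun i => ∑ j, C (A i j) * X j
  let g' : MvPolynomial σ k := bind₁ φ (map (algebraMap F k) g)
  have hg' : g' = 0 := by
    refine funext_set (fun _ => Set.range (algebraMap F k))
      (fun _ => Set.infinite_range_of_injective (algebraMap F k).injective) fun y hy => ?_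
    choose τ hτ using fun i => hy i trivial
    have hy' : y = fun i => algebraMap F k (τ i) := funext fun i => (hτ i).symm
    rw [map_zero, ← hcon τ, ← coe_aeval_eq_eval, RingHom.coe_coe, aeval_bind₁,
      aeval_map_algebraMap]
    congr 2
    funext i
    simp [φ, hy']
  refine hg ?_
  have : aeval x g = aeval t g' := by
    rw [aeval_bind₁, aeval_map_algebraMap]
    congr 2
    funext i
    simp [φ, hx i]
  rw [this, hg', map_zero]

end Specialization

end GaussScroll

/-! ### Homogeneous ideals, tangent spaces and the Zariski topology. -/

namespace GaussScroll

open MvPolynomial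

section HomogeneousIdeals

variable {F K σ : Type*} [Field F] [Field K] [Algebra F K] {I : Ideal (MvPolynomial σ F)}

variable [Fintype σ]

theorem euler_of_mem (hI : ∀ f ∈ I, ∀ n, homogeneousComponent n f ∈ I) {y : σ → K}
    (hy : ∀ f ∈ I, aeval y f = 0) {f : MvPolynomial σ F} (hf : f ∈ I) :
    ∑ i, y i * aeval y (pderiv i f) = 0 := by
  have h : ∀ n, ∑ i, y i * aeval y (pderiv i (homogeneousComponent n f)) = 0 := by
    intro n
    have := congrArg (aeval y) (homogeneousComponent_isHomogeneous n f).sum_X_mul_pderiv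
    simp only [map_sum, map_mul, aeval_X, map_nsmul, hy _ (hI f hf n), smul_zero] at this
    exact this
  conv_lhs => rw [← sum_homogeneousComponent f]
  simp only [map_sum, Finset.mul_sum]
  rw [Finset.sum_comm]
  exact Finset.sum_eq_zero fun n _ => h n

theorem tangent_eqs_of_smul (hI : ∀ f ∈ I, ∀ n, homogeneousComponent n f ∈ I) {c : K} (hc : c ≠ 0)
    {y w : σ → K} (hw : ∀ f ∈ I, ∑ i, w i * aeval (fun i => c * y i) (pderiv i f) = 0)
    {f : MvPolynomial σ F} (hf : f ∈ I) : ∑ i, w i * aeval y (pderiv i f) = 0 := by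
  have h : ∀ n, ∑ i, w i * aeval y (pderiv i (homogeneousComponent n f)) = 0 := by
    intro n
    have := hw _ (hI f hf n)
    simp only [aeval_mul_of_isHomogeneous ((homogeneousComponent_isHomogeneous n f).pderiv),
      mul_left_comm _ (c ^ (n - 1)), ← Finset.mul_sum] at this
    exact (mul_eq_zero.1 this).resolve_left (pow_ne_zero _ hc)
  conv_lhs => rw [← sum_homogeneousComponent f]
  simp only [map_sum, Finset.mul_sum]
  rw [Finset.sum_comm]
  exact Finset.sum_eq_zero fun n _ => h n

/-- The Jacobian matrix of a tuple of polynomials. -/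
noncomputable def jacobian {m : ℕ} (f : Fin m → MvPolynomial σ F) :
    Matrix (Fin m) σ (MvPolynomial σ F) :=
  Matrix.of fun l i => pderiv i (f l)

/-- Presents tangent spaces as kernels of a single polynomial matrix, to which semicontinuity of the
rank applies. -/
theorem mem_ker_jacobian_iff {m : ℕ} {f : Fin m → MvPolynomial σ F}
    (hf : Ideal.span (Set.range f) = I) {y : σ → K} (hy : ∀ f ∈ I, aeval y f = 0) (w : σ → K) :
    w ∈ LinearMap.ker ((jacobian f).map (aeval y)).mulVecLin ↔
      ∀ g ∈ I, ∑ i, w i * aeval y (pderiv i g) = 0 := by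
  have hker : w ∈ LinearMap.ker ((jacobian f).map (aeval y)).mulVecLin ↔
      ∀ l, ∑ i, w i * aeval y (pderiv i (f l)) = 0 := by
    rw [LinearMap.mem_ker, funext_iff]
    refine forall_congr' fun l => ?_
    have : ((jacobian f).map (aeval y)).mulVecLin w l = ∑ i, w i * aeval y (pderiv i (f l)) :=
      Finset.sum_congr rfl fun i _ => mul_comm _ _
    rw [this]
    rfl
  rw [hker]
  constructor
  · intro h g hg
    rw [← hf] at hg
    induction hg using Submodule.span_induction with
    | mem g hg =>
      obtain ⟨l, rfl⟩ := hg
      exact h l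
    | zero => simp
    | add p q _ _ hp hq => simp [mul_add, Finset.sum_add_distrib, hp, hq]
    | smul c g hg' hg =>
      have hg0 : aeval y g = 0 := hy g (hf ▸ hg')
      simp only [smul_eq_mul, Derivation.leibniz, map_add, map_mul, hg0, zero_mul, add_zero,
        mul_left_comm _ (aeval y c), ← Finset.mul_sum, hg, mul_zero]
  · exact fun h l => h _ (hf ▸ Ideal.subset_span ⟨l, rfl⟩)

theorem exists_fin_generators (I : Ideal (MvPolynomial σ F)) :
    ∃ (m : ℕ) (f : Fin m → MvPolynomial σ F), Ideal.span (Set.range f) = I := by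
  obtain ⟨S, hS⟩ := (isNoetherianRing_iff_ideal_fg (MvPolynomial σ F)).1 inferInstance I
  exact ⟨_, fun l => (S.equivFin.symm l : MvPolynomial σ F), by
    rw [← hS]
    congr 1
    ext g
    constructor
    · rintro ⟨l, rfl⟩
      exact (S.equivFin.symm l).2
    · exact fun hg => ⟨S.equivFin ⟨g, hg⟩, by simp⟩⟩

end HomogeneousIdeals

section Zariski

variable {ι : Type}

theorem isOpen_basicOpen {d : ℕ} {F : MvPolynomial ι ℂ} (hF : F.IsHomogeneous d) :
    IsOpen {P : ℙ ℂ (ι → ℂ) | eval P.rep F ≠ 0} :=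
  TopologicalSpace.isOpen_generateFrom_of_mem ⟨d, F, hF, rfl⟩

/-- The generating sets already form a basis, because the product of two forms is a form. -/
theorem exists_basicOpen_of_isOpen {U : Set (ℙ ℂ (ι → ℂ))} (hU : IsOpen U) {P : ℙ ℂ (ι → ℂ)}
    (hP : P ∈ U) : ∃ (d : ℕ) (F : MvPolynomial ι ℂ), F.IsHomogeneous d ∧ eval P.rep F ≠ 0 ∧
      ∀ Q : ℙ ℂ (ι → ℂ), eval Q.rep F ≠ 0 → Q ∈ U := by
  induction hU with
  | basic U hU =>
    obtain ⟨d, F, hF, rfl⟩ := hU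
    exact ⟨d, F, hF, hP, fun Q hQ => hQ⟩
  | univ => exact ⟨0, 1, isHomogeneous_one _ _, by simp, fun Q _ => trivial⟩
  | inter U V _ _ hU hV =>
    obtain ⟨d, F, hF, hPF, hFU⟩ := hU hP.1
    obtain ⟨e, G, hG, hPG, hGV⟩ := hV hP.2
    refine ⟨d + e, F * G, hF.mul hG, by rw [map_mul]; exact mul_ne_zero hPF hPG, fun Q hQ => ?_⟩
    rw [map_mul] at hQ
    exact ⟨hFU Q (left_ne_zero_of_mul hQ), hGV Q (right_ne_zero_of_mul hQ)⟩
  | sUnion S _ ih =>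
    obtain ⟨U, hUS, hPU⟩ := hP
    obtain ⟨d, F, hF, hPF, hFU⟩ := ih U hUS hPU
    exact ⟨d, F, hF, hPF, fun Q hQ => ⟨U, hUS, hFU Q hQ⟩⟩

theorem mem_closure_iff_forall_homogeneous {S : Set (ℙ ℂ (ι → ℂ))} {P : ℙ ℂ (ι → ℂ)} :
    P ∈ closure S ↔ ∀ (d : ℕ) (F : MvPolynomial ι ℂ), F.IsHomogeneous d →
      (∀ Q ∈ S, eval Q.rep F = 0) → eval P.rep F = 0 := by
  rw [mem_closure_iff]
  constructor
  · intro h d F hF hFS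
    by_contra hne
    obtain ⟨Q, hQ, hQS⟩ := h _ (isOpen_basicOpen hF) hne
    exact hQ (hFS Q hQS)
  · intro h U hU hP
    obtain ⟨d, F, hF, hPF, hFU⟩ := exists_basicOpen_of_isOpen hU hP
    by_contra hemp
    exact hPF (h d F hF fun Q hQ => by_contra fun hne => hemp ⟨Q, hFU Q hne, hQ⟩)

theorem mem_homIdeal {X : Set (ℙ ℂ (ι → ℂ))} {F : MvPolynomial ι ℂ} :
    F ∈ homIdeal X ↔ ∀ (v : ι → ℂ) (hv : v ≠ 0), Projectivization.mk ℂ v hv ∈ X → eval v F = 0 := by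
  rw [homIdeal, mem_vanishingIdeal_iff]
  constructor
  · exact fun h v hv hX => h v ⟨hv, hX⟩
  · rintro h v ⟨hv, hX⟩
    exact h v hv hX

theorem mk_smul_eq {v : ι → ℂ} (hv : v ≠ 0) {c : ℂ} (hcv : (fun i => c * v i) ≠ 0) :
    Projectivization.mk ℂ (fun i => c * v i) hcv = Projectivization.mk ℂ v hv :=
  (Projectivization.mk_eq_mk_iff' _ _ _ _ _).2 ⟨c, rfl⟩

theorem mul_ne_zero_fun {v : ι → ℂ} (hv : v ≠ 0) {c : ℂ} (hc : c ≠ 0) : (fun i => c * v i) ≠ 0 :=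
  smul_ne_zero hc hv

theorem exists_rep_eq {v : ι → ℂ} (hv : v ≠ 0) :
    ∃ c : ℂ, c ≠ 0 ∧ (Projectivization.mk ℂ v hv).rep = fun i => c * v i := by
  obtain ⟨a, ha⟩ := Projectivization.exists_smul_eq_mk_rep ℂ v hv
  exact ⟨a, a.ne_zero, ha.symm⟩

theorem eval_rep_eq_zero {X : Set (ℙ ℂ (ι → ℂ))} {F : MvPolynomial ι ℂ} (hF : F ∈ homIdeal X)
    {P : ℙ ℂ (ι → ℂ)} (hP : P ∈ X) : eval P.rep F = 0 :=
  mem_homIdeal.1 hF _ P.rep_nonzero (by rwa [Projectivization.mk_rep])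

theorem mem_linearSubspace {W : Submodule ℂ (ι → ℂ)} {P : ℙ ℂ (ι → ℂ)} :
    P ∈ linearSubspace W ↔ P.rep ∈ W := by
  change P.submodule ≤ W ↔ _
  rw [Projectivization.submodule_eq, Submodule.span_singleton_le_iff_mem]

theorem mk_mem_linearSubspace {W : Submodule ℂ (ι → ℂ)} {v : ι → ℂ} (hv : v ≠ 0) :
    Projectivization.mk ℂ v hv ∈ linearSubspace W ↔ v ∈ W := by
  change (Projectivization.mk ℂ v hv).submodule ≤ W ↔ _
  rw [Projectivization.submodule_mk, Submodule.span_singleton_le_iff_mem]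

variable [Fintype ι]

theorem eval_mul_of_isHomogeneous {F : MvPolynomial ι ℂ} {n : ℕ} (hF : F.IsHomogeneous n) (c : ℂ)
    (v : ι → ℂ) : eval (fun i => c * v i) F = c ^ n * eval v F :=
  aeval_mul_of_isHomogeneous hF c v

theorem eval_mk_rep_eq_zero_iff {F : MvPolynomial ι ℂ} {n : ℕ} (hF : F.IsHomogeneous n)
    {v : ι → ℂ} (hv : v ≠ 0) : eval (Projectivization.mk ℂ v hv).rep F = 0 ↔ eval v F = 0 := by
  obtain ⟨c, hc, h⟩ := exists_rep_eq hv
  rw [h, eval_mul_of_isHomogeneous hF, mul_eq_zero, or_iff_right (pow_ne_zero _ hc)]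

theorem exists_eval_mul_ne_zero {F : MvPolynomial ι ℂ} {v : ι → ℂ} {n : ℕ}
    (h : eval v (homogeneousComponent n F) ≠ 0) :
    ∃ P : Polynomial ℂ, P ≠ 0 ∧ ∀ c, P.eval c = eval (fun i => c * v i) F := by
  let P : Polynomial ℂ := ∑ n ∈ Finset.range (F.totalDegree + 1),
    Polynomial.monomial n (eval v (homogeneousComponent n F))
  refine ⟨P, fun hP => h ?_, fun c => ?_⟩
  · by_cases hn : n < F.totalDegree + 1
    · have := congrArg (fun P => Polynomial.coeff P n) hP
      simp only [P, Polynomial.finsetSum_coeff, Polynomial.coeff_monomial,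
        Polynomial.coeff_zero] at this
      rwa [Finset.sum_ite_eq', if_pos (Finset.mem_range.2 hn)] at this
    · rw [homogeneousComponent_eq_zero n F (by omega), map_zero]
  · conv_rhs => rw [← sum_homogeneousComponent F, map_sum]
    rw [Polynomial.eval_finsetSum]
    refine Finset.sum_congr rfl fun n _ => ?_
    rw [Polynomial.eval_monomial,
      eval_mul_of_isHomogeneous (homogeneousComponent_isHomogeneous n F), mul_comm]

theorem exists_ne_zero_eval_ne_zero {P : Polynomial ℂ} (hP : P ≠ 0) :
    ∃ c : ℂ, c ≠ 0 ∧ P.eval c ≠ 0 := by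
  by_contra! h
  have : P * Polynomial.X = 0 := Polynomial.funext fun c => by
    by_cases hc : c = 0
    · simp [hc]
    · simp [h c hc]
  exact (mul_ne_zero hP Polynomial.X_ne_zero) this

/-- Restricted to the line through `v`, `F` is a polynomial in the scalar that vanishes at all
nonzero scalars, so its coefficients vanish. -/
theorem homogeneousComponent_mem_homIdeal {X : Set (ℙ ℂ (ι → ℂ))} {F : MvPolynomial ι ℂ}
    (hF : F ∈ homIdeal X) (n : ℕ) : homogeneousComponent n F ∈ homIdeal X := by
  rw [mem_homIdeal] at hF ⊢
  intro v hv hX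
  by_contra hne
  obtain ⟨P, hP, hPF⟩ := exists_eval_mul_ne_zero hne
  obtain ⟨c, hc, hPc⟩ := exists_ne_zero_eval_ne_zero hP
  rw [hPF] at hPc
  exact hPc (hF _ (mul_ne_zero_fun hv hc) (by rwa [mk_smul_eq hv]))

theorem mem_homIdeal_iff_homogeneousComponent {X : Set (ℙ ℂ (ι → ℂ))} {F : MvPolynomial ι ℂ} :
    F ∈ homIdeal X ↔ ∀ n, ∀ P ∈ X, eval P.rep (homogeneousComponent n F) = 0 := by
  constructor
  · exact fun hF n P hP => eval_rep_eq_zero (homogeneousComponent_mem_homIdeal hF n) hP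
  · intro h
    rw [mem_homIdeal]
    intro v hv hX
    rw [← sum_homogeneousComponent F, map_sum]
    exact Finset.sum_eq_zero fun n _ =>
      (eval_mk_rep_eq_zero_iff (homogeneousComponent_isHomogeneous n F) hv).1 (h n _ hX)

theorem homIdeal_closure (S : Set (ℙ ℂ (ι → ℂ))) : homIdeal (closure S) = homIdeal S := by
  ext F
  rw [mem_homIdeal_iff_homogeneousComponent, mem_homIdeal_iff_homogeneousComponent]
  refine forall_congr' fun n => ⟨fun h P hP => h P (subset_closure hP), fun h P hP => ?_⟩
  exact mem_closure_iff_forall_homogeneous.1 hP n _ (homogeneousComponent_isHomogeneous n F) h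

theorem mk_mem_of_isClosed {X : Set (ℙ ℂ (ι → ℂ))} (hX : IsClosed X) {v : ι → ℂ} (hv : v ≠ 0)
    (h : ∀ F ∈ homIdeal X, eval v F = 0) : Projectivization.mk ℂ v hv ∈ X := by
  rw [← hX.closure_eq, mem_closure_iff_forall_homogeneous]
  intro d F hF hFX
  rw [eval_mk_rep_eq_zero_iff hF]
  refine h F (mem_homIdeal.2 fun w hw hwX => ?_)
  exact (eval_mk_rep_eq_zero_iff hF hw).1 (hFX _ hwX)

theorem exists_homogeneousComponent_ne_zero {X : Set (ℙ ℂ (ι → ℂ))} {F : MvPolynomial ι ℂ}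
    (hF : F ∉ homIdeal X) : ∃ n, ∃ P ∈ X, eval P.rep (homogeneousComponent n F) ≠ 0 := by
  rw [mem_homIdeal_iff_homogeneousComponent] at hF
  push Not at hF
  exact hF

/-- Irreducibility gives one point `R` where a component of `F` and a component of `G` are both
nonzero; on the line through `R` some nonzero multiple then avoids the zeros of `F` and of `G`. -/
theorem isPrime_homIdeal {X : Set (ℙ ℂ (ι → ℂ))} (hX : IsIrreducible X) :
    (homIdeal X).IsPrime := by
  refine ⟨fun htop => ?_, fun {F G} hFG => ?_⟩
  · obtain ⟨P, hP⟩ := hX.1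
    have := eval_rep_eq_zero (X := X) (F := 1) (htop ▸ Submodule.mem_top) hP
    simp at this
  · by_contra! hcon
    obtain ⟨n, P, hP, hPF⟩ := exists_homogeneousComponent_ne_zero hcon.1
    obtain ⟨m, Q, hQ, hQG⟩ := exists_homogeneousComponent_ne_zero hcon.2
    obtain ⟨R, hR, hRF, hRG⟩ := hX.2 _ _
      (isOpen_basicOpen (homogeneousComponent_isHomogeneous n F))
      (isOpen_basicOpen (homogeneousComponent_isHomogeneous m G)) ⟨P, hP, hPF⟩ ⟨Q, hQ, hQG⟩
    obtain ⟨p, hp, hpF⟩ := exists_eval_mul_ne_zero hRF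
    obtain ⟨q, hq, hqG⟩ := exists_eval_mul_ne_zero hRG
    obtain ⟨c, hc, hpq⟩ := exists_ne_zero_eval_ne_zero (mul_ne_zero hp hq)
    rw [Polynomial.eval_mul, hpF, hqG, ← map_mul] at hpq
    exact hpq (mem_homIdeal.1 hFG _ (mul_ne_zero_fun R.rep_nonzero hc)
      (by rwa [mk_smul_eq R.rep_nonzero, Projectivization.mk_rep]))

theorem mem_tangentSpace {X : Set (ℙ ℂ (ι → ℂ))} {P : ℙ ℂ (ι → ℂ)} {w : ι → ℂ} :
    w ∈ tangentSpace X P ↔ ∀ F ∈ homIdeal X, ∑ i, w i * eval P.rep (pderiv i F) = 0 := Iff.rfl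

theorem mem_tangentSpace_mk {X : Set (ℙ ℂ (ι → ℂ))} {v : ι → ℂ} (hv : v ≠ 0) {w : ι → ℂ} :
    w ∈ tangentSpace X (Projectivization.mk ℂ v hv) ↔
      ∀ F ∈ homIdeal X, ∑ i, w i * eval v (pderiv i F) = 0 := by
  rw [mem_tangentSpace]
  obtain ⟨c, hc, hrep⟩ := exists_rep_eq hv
  rw [hrep]
  constructor
  · intro h F hF
    exact tangent_eqs_of_smul (K := ℂ) (fun f hf n => homogeneousComponent_mem_homIdeal hf n) hc
      h hF
  · intro h F hF
    refine tangent_eqs_of_smul (K := ℂ) (y := fun i => c * v i)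
      (fun f hf n => homogeneousComponent_mem_homIdeal hf n) (inv_ne_zero hc) (fun G hG => ?_) hF
    simp only [inv_mul_cancel_left₀ hc]
    exact h G hG

theorem closure_subset_linearSubspace {α : Type*} {S : Set (ℙ ℂ (ι → ℂ))} {B : Matrix α ι ℂ}
    (h : S ⊆ linearSubspace (LinearMap.ker B.mulVecLin)) :
    closure S ⊆ linearSubspace (LinearMap.ker B.mulVecLin) := by
  have key : ∀ P : ℙ ℂ (ι → ℂ), P ∈ linearSubspace (LinearMap.ker B.mulVecLin) ↔
      ∀ i, eval P.rep (∑ j, C (B i j) * X j) = 0 := by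
    intro P
    rw [mem_linearSubspace, LinearMap.mem_ker, funext_iff]
    refine forall_congr' fun i => ?_
    simp only [map_sum, map_mul, eval_C, eval_X]
    rfl
  intro P hP
  rw [key]
  intro i
  refine mem_closure_iff_forall_homogeneous.1 hP 1 _ ?_ fun Q hQ => (key Q).1 (h hQ) i
  exact IsHomogeneous.sum _ _ _ fun j _ => isHomogeneous_C_mul_X _ _

/-- A nonempty open subset of a linear space is dense in it. -/
theorem linearSubspace_subset_closure {S : Set (ℙ ℂ (ι → ℂ))} {W : Submodule ℂ (ι → ℂ)}
    {G : MvPolynomial ι ℂ} {w : ι → ℂ} (hw : w ∈ W) (hwG : eval w G ≠ 0)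
    (hS : ∀ (v : ι → ℂ) (hv : v ≠ 0), v ∈ W → eval v G ≠ 0 → Projectivization.mk ℂ v hv ∈ S) :
    linearSubspace W ⊆ closure S := by
  intro P hP
  rw [mem_linearSubspace] at hP
  rw [mem_closure_iff_forall_homogeneous]
  intro d F hF hFS
  by_contra hne
  obtain ⟨i, hi⟩ := Function.ne_iff.1 P.rep_nonzero
  -- The line in `W` through `P.rep` (parameter `0`) and `w` (parameter `1`): `F` and coordinate `i`
  -- are nonzero at the first, `G` at the second, so all three are nonzero at some parameter.
  let line : ι → Polynomial ℂ := fun j =>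
    Polynomial.C (P.rep j) + Polynomial.X * Polynomial.C (w j - P.rep j)
  have hline : ∀ (H : MvPolynomial ι ℂ) (s : ℂ), (aeval line H).eval s =
      eval (fun j => P.rep j + s * (w j - P.rep j)) H := by
    intro H s
    rw [← Polynomial.coe_aeval_eq_eval, comp_aeval_apply, ← coe_aeval_eq_eval, RingHom.coe_coe]
    congr 2
    funext j
    simp [line]
  have h1 : aeval line F ≠ 0 := fun h0 => hne (by
    have := hline F 0
    simpa [h0] using this.symm)
  have h2 : aeval line G ≠ 0 := fun h0 => hwG (by
    have := hline G 1
    simpa [h0] using this.symm)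
  have h3 : line i ≠ 0 := fun h0 => hi (by
    have := congrArg (Polynomial.eval 0) h0
    simpa [line] using this)
  obtain ⟨s, -, hs⟩ := exists_ne_zero_eval_ne_zero (mul_ne_zero (mul_ne_zero h1 h2) h3)
  rw [Polynomial.eval_mul, Polynomial.eval_mul, hline, hline] at hs
  have hv : (fun j => P.rep j + s * (w j - P.rep j)) ≠ 0 := fun h0 =>
    right_ne_zero_of_mul hs (by
      have := congrFun h0 i
      simpa [line] using this)
  refine left_ne_zero_of_mul (left_ne_zero_of_mul hs) ?_
  rw [← eval_mk_rep_eq_zero_iff hF hv]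
  refine hFS _ (hS _ hv ?_ (right_ne_zero_of_mul (left_ne_zero_of_mul hs)))
  exact W.add_mem hP (W.smul_mem s (W.sub_mem hw hP))

end Zariski

end GaussScroll

/-! ### Plücker coordinates and charts of the Grassmannian. -/

namespace GaussScroll

open MvPolynomial

section Plucker

variable {R : Type*} {d N : ℕ}

/-- The subspace `W` is the graph over the coordinates `J` of the matrix `a`. -/
structure IsGraph {R : Type*} [Field R] {σ : Type*} {d : ℕ} (W : Submodule R (σ → R))
    (J : Fin d → σ) (a : σ → Fin d → R) : Prop where
  mem_iff : ∀ w, w ∈ W ↔ ∀ i, w i = ∑ j, a i j * w (J j)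
  normalized : ∀ j' j, a (J j') j = if j' = j then 1 else 0

theorem IsGraph.column_mem [Field R] {σ : Type*} {W : Submodule R (σ → R)} {J : Fin d → σ}
    {a : σ → Fin d → R} (h : IsGraph W J a) (j : Fin d) : (fun i => a i j) ∈ W := by
  rw [h.mem_iff]
  intro i
  simp [h.normalized]

theorem IsGraph.eq_sum [Field R] {σ : Type*} {W : Submodule R (σ → R)} {J : Fin d → σ}
    {a : σ → Fin d → R} (h : IsGraph W J a) {w : σ → R} (hw : w ∈ W) :
    w = ∑ j, w (J j) • fun i => a i j := by
  funext i
  rw [Finset.sum_apply, (h.mem_iff w).1 hw i]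
  exact Finset.sum_congr rfl fun j _ => mul_comm _ _

theorem IsGraph.finrank_eq [Field R] {σ : Type*} [Finite σ] {W : Submodule R (σ → R)}
    {J : Fin d → σ} {a : σ → Fin d → R} (h : IsGraph W J a) : Module.finrank R W = d := by
  have hli : LinearIndependent R fun j : Fin d => fun i => a i j := by
    rw [Fintype.linearIndependent_iff]
    intro c hc j
    have := congrFun hc (J j)
    simpa [h.normalized] using this
  have hspan : W = Submodule.span R (Set.range fun j : Fin d => fun i => a i j) := by
    apply le_antisymm
    · intro w hw
      rw [h.eq_sum hw]
      exact Submodule.sum_mem _ fun j _ => Submodule.smul_mem _ _ (Submodule.subset_span ⟨j, rfl⟩)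
    · rw [Submodule.span_le]
      rintro _ ⟨j, rfl⟩
      exact h.column_mem j
  rw [hspan, finrank_span_eq_card hli, Fintype.card_fin]

/-- The coordinate functionals span the dual of `W`. Choose a basis among them and list its indices
in increasing order. -/
theorem exists_isGraph [Field R] (W : Submodule R (Fin (N + 1) → R))
    (hW : Module.finrank R W = d) : ∃ (J : PluckerIndex d N) (a : _), IsGraph W J a := by
  let v : Fin (N + 1) → Module.Dual R W := fun i => (LinearMap.proj i).comp W.subtype
  obtain ⟨κ, f, hf, hspan, hli⟩ := exists_linearIndependent' R v
  have htop : Submodule.span R (Set.range v) = ⊤ := by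
    refine Submodule.eq_top_of_finrank_eq ?_
    refine le_antisymm (Submodule.finrank_le _) ?_
    rw [Subspace.dual_finrank_eq, ← Subspace.finrank_add_finrank_dualCoannihilator_eq
      (Submodule.span R (Set.range v))]
    have : (Submodule.span R (Set.range v)).dualCoannihilator = ⊥ := by
      rw [eq_bot_iff]
      intro w hw
      rw [Submodule.mem_dualCoannihilator] at hw
      ext i
      exact hw (v i) (Submodule.subset_span ⟨i, rfl⟩)
    rw [this, finrank_bot, add_zero]
  have : Finite κ := Finite.of_injective f hf
  have := Fintype.ofFinite κ
  have hcard : Fintype.card κ = d := by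
    rw [← finrank_span_eq_card hli, hspan, htop, finrank_top, Subspace.dual_finrank_eq, hW]
  let S : Finset (Fin (N + 1)) := Finset.univ.map ⟨f, hf⟩
  have hS : S.card = d := by rw [Finset.card_map, Finset.card_univ, hcard]
  let J : PluckerIndex d N := S.orderEmbOfFin hS
  have hJ : ∀ c, ∃ j, J j = f c := by
    intro c
    have : f c ∈ Set.range (S.orderEmbOfFin hS) := by
      rw [Finset.range_orderEmbOfFin]
      simp [S]
    exact this
  let ρ : W →ₗ[R] (Fin d → R) := (LinearMap.funLeft R R J).comp W.subtype
  have hρ : Function.Injective ρ := by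
    rw [← LinearMap.ker_eq_bot, eq_bot_iff]
    intro w hw
    have hw0 : ∀ c, v (f c) w = 0 := fun c => by
      obtain ⟨j, hj⟩ := hJ c
      rw [← hj]
      exact congrFun hw j
    have hall : ∀ φ ∈ Submodule.span R (Set.range (v ∘ f)), φ w = 0 := by
      intro φ hφ
      induction hφ using Submodule.span_induction with
      | mem φ hφ =>
        obtain ⟨c, rfl⟩ := hφ
        exact hw0 c
      | zero => rfl
      | add φ ψ _ _ h1 h2 => rw [LinearMap.add_apply, h1, h2, add_zero]
      | smul c φ _ h1 => rw [LinearMap.smul_apply, h1, smul_zero]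
    ext i
    exact hall (v i) (by rw [hspan, htop]; trivial)
  let e : W ≃ₗ[R] (Fin d → R) := LinearEquiv.ofInjectiveOfFinrankEq ρ hρ
    (by rw [hW, Module.finrank_fin_fun])
  have he : ∀ w j, e w j = w.1 (J j) := fun w j => rfl
  refine ⟨J, fun i j => (e.symm (Pi.single j 1)).1 i, fun w => ⟨fun hw i => ?_, fun hw => ?_⟩,
    fun j' j => ?_⟩
  · have h1 : (⟨w, hw⟩ : W) = ∑ j, w (J j) • e.symm (Pi.single j 1) := by
      rw [← e.injective.eq_iff, map_sum]
      funext l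
      simp only [he, map_smul, LinearEquiv.apply_symm_apply, Finset.sum_apply, Pi.smul_apply,
        smul_eq_mul, Pi.single_apply]
      simp
    have h2 := congrFun (congrArg Subtype.val h1) i
    simp only [Submodule.coe_sum, Finset.sum_apply, Submodule.coe_smul, Pi.smul_apply,
      smul_eq_mul] at h2
    rw [h2]
    exact Finset.sum_congr rfl fun j _ => mul_comm _ _
  · have : w = ((∑ j, w (J j) • e.symm (Pi.single j 1) : W) : Fin (N + 1) → R) := by
      funext i
      simp only [Submodule.coe_sum, Finset.sum_apply, Submodule.coe_smul, Pi.smul_apply,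
        smul_eq_mul]
      rw [hw i]
      exact Finset.sum_congr rfl fun j _ => mul_comm _ _
    rw [this]
    exact Submodule.coe_mem _
  · rw [← he, LinearEquiv.apply_symm_apply, Pi.single_apply]

/-- The maximal minor of `a` with the rows `I`. -/
noncomputable def maxMinor [CommRing R] (a : Fin (N + 1) → Fin d → R) (I : Fin d → Fin (N + 1)) :
    R := Matrix.det (Matrix.of fun i j => a (I i) j)

/-- Sorting the rows costs a sign, and repeated rows give `0`, in which case `J` is only a
placeholder. Sign and index depend neither on the ring nor on the matrix, so the same formula serves
the generic point and its specializations. -/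
theorem exists_maxMinor_eq (J : PluckerIndex d N) (f : Fin d → Fin (N + 1)) :
    ∃ (ε : ℤ) (I : PluckerIndex d N), ∀ (R : Type) [CommRing R] (a : Fin (N + 1) → Fin d → R),
      maxMinor a f = ε * maxMinor a I := by
  by_cases hf : Function.Injective f
  · have hmono : StrictMono (f ∘ Tuple.sort f) :=
      (Tuple.monotone_sort f).strictMono_of_injective (hf.comp (Tuple.sort f).injective)
    refine ⟨Equiv.Perm.sign (Tuple.sort f), OrderEmbedding.ofStrictMono _ hmono, ?_⟩
    intro R _ a
    have := Matrix.det_permute (Tuple.sort f) (Matrix.of fun i j => a (f i) j)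
    have h2 : maxMinor a (OrderEmbedding.ofStrictMono _ hmono) =
        ((Equiv.Perm.sign (Tuple.sort f) : ℤ) : R) * maxMinor a f := this
    rw [h2, ← mul_assoc, ← Int.cast_mul, Int.units_coe_mul_self, Int.cast_one, one_mul]
  · refine ⟨0, J, fun R _ a => ?_⟩
    obtain ⟨i, j, hij, hne⟩ : ∃ i j, f i = f j ∧ i ≠ j := by
      simpa [Function.Injective] using hf
    rw [Int.cast_zero, zero_mul]
    exact Matrix.det_zero_of_row_eq hne (by funext l; simp [hij])

/-- The sign in the expression of the coordinate `(l, j)` of the chart `J` of the Grassmannian in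
terms of Plücker coordinates. -/
noncomputable def exchangeSign (J : PluckerIndex d N) (lj : Fin (N + 1) × Fin d) : ℤ :=
  (exists_maxMinor_eq J (Function.update J lj.2 lj.1)).choose

/-- The Plücker index corresponding to the coordinate `(l, j)` of the chart `J` of the
Grassmannian. -/
noncomputable def exchangeIndex (J : PluckerIndex d N) (lj : Fin (N + 1) × Fin d) :
    PluckerIndex d N :=
  (exists_maxMinor_eq J (Function.update J lj.2 lj.1)).choose_spec.choose

/-- Replace one row of the identity block at `J` by row `l` of `a`: the determinant is the entry
`(l, j)`. -/
theorem exchange_maxMinor {R : Type} [Field R] {J : PluckerIndex d N}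
    {a : Fin (N + 1) → Fin d → R} (ha : ∀ j' j, a (J j') j = if j' = j then 1 else 0)
    (lj : Fin (N + 1) × Fin d) :
    a lj.1 lj.2 = exchangeSign J lj * maxMinor a (exchangeIndex J lj) := by
  have h := (exists_maxMinor_eq J (Function.update J lj.2 lj.1)).choose_spec.choose_spec R a
  refine Eq.trans ?_ h
  have : (Matrix.of fun i j => a ((Function.update J lj.2 lj.1 : Fin d → Fin (N + 1)) i) j) =
      ((1 : Matrix (Fin d) (Fin d) R).updateRow lj.2 (a lj.1)) := by
    ext i j
    by_cases hi : i = lj.2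
    · subst hi
      simp
    · simp [hi, ha, Matrix.one_apply]
  rw [maxMinor, this, ← Matrix.det_transpose, ← Matrix.updateCol_transpose, Matrix.transpose_one,
    ← Matrix.cramer_apply, Matrix.cramer_one]
  rfl

theorem maxMinor_self [CommRing R] {J : PluckerIndex d N} {a : Fin (N + 1) → Fin d → R}
    (ha : ∀ j' j, a (J j') j = if j' = j then 1 else 0) : maxMinor a J = 1 := by
  have : (Matrix.of fun i j => a (J i) j) = 1 := by
    ext i j
    simp [ha, Matrix.one_apply]
  rw [maxMinor, this, Matrix.det_one]

/-- The coordinates of the chart `J` of the Grassmannian, computed from Plücker coordinates. -/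
noncomputable def chartCoord (J : PluckerIndex d N) (v : PluckerIndex d N → ℂ)
    (lj : Fin (N + 1) × Fin d) : ℂ :=
  exchangeSign J lj * v (exchangeIndex J lj) / v J

theorem IsGraph.pluckerVec_eq {W : Submodule ℂ (Fin (N + 1) → ℂ)} {J : PluckerIndex d N}
    {a : Fin (N + 1) → Fin d → ℂ} (h : IsGraph W J a) :
    ∃ c : ℂ, c ≠ 0 ∧ pluckerVec d W = fun I : PluckerIndex d N => c * maxMinor a I := by
  let b := Module.finBasisOfFinrankEq ℂ W h.finrank_eq
  let β : Matrix (Fin d) (Fin d) ℂ := Matrix.of fun i j => (b i : Fin (N + 1) → ℂ) (J j)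
  refine ⟨β.det, ?_, funext fun I => ?_⟩
  · intro h0
    obtain ⟨c, hc, hc0⟩ := Matrix.exists_vecMul_eq_zero_iff.2 h0
    refine hc ?_
    have hw : ∑ i, c i • b i = 0 := by
      refine Subtype.ext ?_
      have hmem := (∑ i, c i • b i).2
      rw [h.eq_sum hmem]
      refine Finset.sum_eq_zero fun j _ => ?_
      have : ((∑ i, c i • b i : W) : Fin (N + 1) → ℂ) (J j) = 0 := by
        rw [Submodule.coe_sum, Finset.sum_apply]
        exact congrFun hc0 j
      rw [this, zero_smul]
    funext i
    exact Fintype.linearIndependent_iff.1 b.linearIndependent c hw i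
  · rw [pluckerVec, dif_pos h.finrank_eq,
      show maxMinor a I = (Matrix.of fun i j => a (I i) j).transpose.det from
        (Matrix.det_transpose _).symm, ← Matrix.det_mul]
    congr 1
    ext i j
    rw [Matrix.mul_apply]
    change (b i : Fin (N + 1) → ℂ) (I j) = ∑ l, (b i : Fin (N + 1) → ℂ) (J l) * a (I j) l
    rw [(h.mem_iff _).1 (b i).2 (I j)]
    exact Finset.sum_congr rfl fun l _ => mul_comm _ _

theorem exists_isGraph_of_pluckerVec_ne_zero {W : Submodule ℂ (Fin (N + 1) → ℂ)}
    (hW : Module.finrank ℂ W = d) {J : PluckerIndex d N} (hJ : pluckerVec d W J ≠ 0) :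
    ∃ a, IsGraph W J a := by
  rw [pluckerVec, dif_pos hW] at hJ
  let b := Module.finBasisOfFinrankEq ℂ W hW
  let β : Matrix (Fin d) (Fin (N + 1)) ℂ := Matrix.of fun i l => (b i : Fin (N + 1) → ℂ) l
  let βJ : Matrix (Fin d) (Fin d) ℂ := β.submatrix id J
  have hdet : IsUnit βJ.det := IsUnit.mk0 _ hJ
  have hcomb : ∀ c : Fin d → ℂ, ((∑ i, c i • b i : W) : Fin (N + 1) → ℂ) = Matrix.vecMul c β := by
    intro c
    funext l
    rw [Submodule.coe_sum, Finset.sum_apply]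
    rfl
  have hvm : ∀ (c : Fin d → ℂ) (M : Matrix (Fin d) (Fin (N + 1)) ℂ) (i : Fin (N + 1)),
      Matrix.vecMul c M i = ∑ j, M j i * c j := fun c M i => by
    simp [Matrix.vecMul, dotProduct, mul_comm]
  refine ⟨fun l j => (βJ⁻¹ * β) j l, fun w => ⟨fun hw i => ?_, fun hw => ?_⟩, fun j' j => ?_⟩
  · obtain ⟨c, hc⟩ : ∃ c : Fin d → ℂ, w = Matrix.vecMul c β :=
      ⟨b.repr ⟨w, hw⟩, by rw [← hcomb, b.sum_repr]⟩
    have hcJ : (fun j => w (J j)) = Matrix.vecMul c βJ := by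
      rw [hc]
      rfl
    have : w = Matrix.vecMul (fun j => w (J j)) (βJ⁻¹ * β) := by
      rw [hcJ, Matrix.vecMul_vecMul, ← Matrix.mul_assoc, Matrix.mul_nonsing_inv _ hdet,
        Matrix.one_mul, ← hc]
    exact (congrFun this i).trans (hvm _ _ i)
  · have : w = Matrix.vecMul (Matrix.vecMul (fun j => w (J j)) βJ⁻¹) β := by
      rw [Matrix.vecMul_vecMul]
      funext i
      rw [hw i]
      exact (hvm _ _ i).symm
    rw [this, ← hcomb]
    exact Submodule.coe_mem _
  · have : (βJ⁻¹ * β).submatrix id J = 1 := by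
      rw [Matrix.submatrix_mul_equiv _ _ id (Equiv.refl _) J |>.symm]
      exact Matrix.nonsing_inv_mul _ hdet
    have := congrFun (congrFun this j) j'
    rw [Matrix.one_apply] at this
    simp only [eq_comm (a := j') (b := j)]
    exact this

theorem chartCoord_eq_of_isGraph {W : Submodule ℂ (Fin (N + 1) → ℂ)} {J : PluckerIndex d N}
    {a : Fin (N + 1) → Fin d → ℂ} (h : IsGraph W J a) {v : PluckerIndex d N → ℂ} (hv : v ≠ 0)
    (hvW : ℂ ∙ v = ℂ ∙ pluckerVec d W) :
    v J ≠ 0 ∧ (∀ lj, chartCoord J v lj = a lj.1 lj.2) ∧ ∀ I, v I = v J * maxMinor a I := by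
  obtain ⟨c, hc, hpl⟩ := h.pluckerVec_eq
  obtain ⟨s, hs⟩ := Submodule.mem_span_singleton.1 (hvW ▸ Submodule.mem_span_singleton_self v)
  have hvI : ∀ I, v I = s * c * maxMinor a I := fun I => by
    rw [← hs, hpl, Pi.smul_apply, smul_eq_mul, mul_assoc]
  have hJ : v J = s * c := by rw [hvI, maxMinor_self h.normalized, mul_one]
  have hJ0 : v J ≠ 0 := by
    intro h0
    refine hv (funext fun I => ?_)
    rw [hvI, ← hJ, h0, zero_mul]
    rfl
  refine ⟨hJ0, fun lj => ?_, fun I => by rw [hvI, hJ]⟩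
  rw [chartCoord, exchange_maxMinor h.normalized, hvI (exchangeIndex J lj), ← hJ]
  field_simp

/-- A polynomial in the coordinates of a chart of the Grassmannian is the quotient of a form in
Plücker coordinates by a power of the distinguished one. -/
theorem exists_homogenization (J : PluckerIndex d N) (G : MvPolynomial (Fin (N + 1) × Fin d) ℂ)
    {e : ℕ} (he : G.totalDegree ≤ e) :
    ∃ H : MvPolynomial (PluckerIndex d N) ℂ, H.IsHomogeneous e ∧ ∀ v, v J ≠ 0 →
      eval v H = v J ^ e * eval (chartCoord J v) G := by
  let ψ : Fin (N + 1) × Fin d → MvPolynomial (PluckerIndex d N) ℂ := fun lj =>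
    C (exchangeSign J lj : ℂ) * X (exchangeIndex J lj)
  refine ⟨∑ n ∈ Finset.range (G.totalDegree + 1),
    X J ^ (e - n) * aeval ψ (homogeneousComponent n G), ?_, fun v hv => ?_⟩
  · refine IsHomogeneous.sum _ _ _ fun n hn => ?_
    have h1 : (aeval ψ (homogeneousComponent n G)).IsHomogeneous (1 * n) :=
      (homogeneousComponent_isHomogeneous n G).aeval ψ fun lj => isHomogeneous_C_mul_X _ _
    have h2 := (isHomogeneous_X_pow (R := ℂ) J (e - n)).mul h1
    have : e - n + 1 * n = e := by
      have := Finset.mem_range.1 hn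
      omega
    rwa [this] at h2
  · conv_rhs => rw [← sum_homogeneousComponent G, map_sum, Finset.mul_sum]
    rw [map_sum]
    refine Finset.sum_congr rfl fun n hn => ?_
    have hev : eval v (aeval ψ (homogeneousComponent n G)) =
        eval (fun lj => v J * chartCoord J v lj) (homogeneousComponent n G) := by
      rw [← coe_aeval_eq_eval, ← coe_aeval_eq_eval, RingHom.coe_coe, RingHom.coe_coe,
        comp_aeval_apply]
      congr 2
      funext lj
      simp only [ψ, map_mul, aeval_X, chartCoord, algHom_C, Algebra.algebraMap_self,
        RingHom.id_apply]
      field_simp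
    rw [map_mul, map_pow, eval_X, hev,
      eval_mul_of_isHomogeneous (homogeneousComponent_isHomogeneous n G), ← mul_assoc, ← pow_add]
    have : e - n + n = e := by
      have := Finset.mem_range.1 hn
      omega
    rw [this]

end Plucker

end GaussScroll

/-! ### Values of rational functions and generic points of projective varieties. -/

namespace GaussScroll

open MvPolynomial

section Values

variable {K σ α : Type*} [Field K] [Algebra ℂ K] {x : σ → K} {v : σ → ℂ}

/-- The rational function `z` of the generic point `x` is defined at `v` with value `c`. -/
def HasValue (x : σ → K) (v : σ → ℂ) (z : K) (c : ℂ) : Prop :=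
  ∃ f g : MvPolynomial σ ℂ, eval v g ≠ 0 ∧ aeval x g * z = aeval x f ∧ eval v f = eval v g * c

theorem hasValue_algebraMap (x : σ → K) (v : σ → ℂ) (c : ℂ) :
    HasValue x v (algebraMap ℂ K c) c :=
  ⟨C c, 1, by simp, by simp, by simp⟩

theorem hasValue_self (x : σ → K) (v : σ → ℂ) (i : σ) : HasValue x v (x i) (v i) :=
  ⟨X i, 1, by simp, by simp, by simp⟩

theorem HasValue.add {y z : K} {b c : ℂ} (hy : HasValue x v y b) (hz : HasValue x v z c) :
    HasValue x v (y + z) (b + c) := by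
  obtain ⟨f, g, hg, hfg, hv⟩ := hy
  obtain ⟨f', g', hg', hfg', hv'⟩ := hz
  refine ⟨f * g' + f' * g, g * g', by rw [map_mul]; exact mul_ne_zero hg hg', ?_, ?_⟩
  · simp only [map_mul, map_add, ← hfg, ← hfg']
    ring
  · simp only [map_mul, map_add, hv, hv']
    ring

theorem HasValue.mul {y z : K} {b c : ℂ} (hy : HasValue x v y b) (hz : HasValue x v z c) :
    HasValue x v (y * z) (b * c) := by
  obtain ⟨f, g, hg, hfg, hv⟩ := hy
  obtain ⟨f', g', hg', hfg', hv'⟩ := hz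
  refine ⟨f * f', g * g', by rw [map_mul]; exact mul_ne_zero hg hg', ?_, ?_⟩
  · simp only [map_mul, ← hfg, ← hfg']
    ring
  · simp only [map_mul, hv, hv']
    ring

theorem HasValue.aeval {z : α → K} {c : α → ℂ} (h : ∀ i, HasValue x v (z i) (c i))
    (G : MvPolynomial α ℂ) : HasValue x v (aeval z G) (eval c G) := by
  induction G using MvPolynomial.induction_on with
  | C a =>
    rw [algHom_C, eval_C]
    exact hasValue_algebraMap x v a
  | add p q hp hq =>
    rw [map_add, map_add]
    exact hp.add hq
  | mul_X p j hp =>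
    rw [map_mul, map_mul, aeval_X, eval_X]
    exact hp.mul (h j)

theorem HasValue.sum {s : Finset α} {z : α → K} {c : α → ℂ} (h : ∀ i, HasValue x v (z i) (c i)) :
    HasValue x v (∑ i ∈ s, z i) (∑ i ∈ s, c i) := by
  have := HasValue.aeval h (∑ i ∈ s, X i)
  simpa using this

theorem HasValue.eq_zero (hv : IsSpecialization ℂ x v) {c : ℂ} (h : HasValue x v 0 c) : c = 0 := by
  obtain ⟨f, g, hg, hfg, hc⟩ := h
  rw [hv f (by rw [← hfg, mul_zero])] at hc
  exact (mul_eq_zero.1 hc.symm).resolve_left hg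

theorem HasValue.unique (hv : IsSpecialization ℂ x v) {z : K} {b c : ℂ} (hb : HasValue x v z b)
    (hc : HasValue x v z c) : b = c := by
  have := hb.add ((hasValue_algebraMap x v (-1)).mul hc)
  have h0 : z + algebraMap ℂ K (-1) * z = 0 := by simp
  rw [h0] at this
  linear_combination this.eq_zero hv

end Values

section GenericPoints

variable {N n d : ℕ} {X : Set (ℙ ℂ (Fin (N + 1) → ℂ))}

/-- `x` is a generic point of the cone over `X`, with values in the function field `K`. -/
structure IsGenericPoint {ι K : Type} [Field K] [Algebra ℂ K] (X : Set (ℙ ℂ (ι → ℂ)))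
    (x : ι → K) : Prop where
  aeval_eq_zero_iff : ∀ F, aeval x F = 0 ↔ F ∈ homIdeal X
  generates : GeneratesField ℂ x

/-- The fraction field of the homogeneous coordinate ring: the function field of the affine cone, of
transcendence degree one more than the dimension of `X`. -/
theorem exists_isGenericPoint {ι : Type} [Fintype ι] {X : Set (ℙ ℂ (ι → ℂ))}
    (hX : IsIrreducible X) : ∃ (K : Type) (_ : Field K) (_ : Algebra ℂ K) (x : ι → K),
      IsGenericPoint X x := by
  have : (homIdeal X).IsPrime := isPrime_homIdeal hX
  let A := coordRing X
  let x : ι → FractionRing A := fun i => algebraMap A _ (Ideal.Quotient.mk _ (MvPolynomial.X i))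
  have hx : ∀ F, aeval x F = algebraMap A (FractionRing A) (Ideal.Quotient.mk _ F) := by
    intro F
    have : (aeval x : MvPolynomial ι ℂ →ₐ[ℂ] FractionRing A) =
        (IsScalarTower.toAlgHom ℂ A (FractionRing A)).comp (Ideal.Quotient.mkₐ ℂ (homIdeal X)) :=
      algHom_ext fun i => by simp [x]; rfl
    rw [this]
    rfl
  refine ⟨FractionRing A, inferInstance, inferInstance, x, fun F => ?_, fun z => ?_⟩
  · rw [hx, map_eq_zero_iff _ (IsFractionRing.injective A (FractionRing A)),
      Ideal.Quotient.eq_zero_iff_mem]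
  · obtain ⟨⟨f, g⟩, hz⟩ := IsLocalization.surj (nonZeroDivisors A) z
    obtain ⟨f', rfl⟩ := Ideal.Quotient.mk_surjective f
    obtain ⟨g', hg'⟩ := Ideal.Quotient.mk_surjective g.1
    refine ⟨f', g', ?_, ?_⟩
    · rw [hx, hg']
      exact IsFractionRing.to_map_ne_zero_of_mem_nonZeroDivisors g.2
    · rw [hx, hx, hg']
      exact hz

variable {K : Type} [Field K] [Algebra ℂ K] {x : Fin (N + 1) → K}

theorem IsGenericPoint.isSpecialization_iff (h : IsGenericPoint X x) {v : Fin (N + 1) → ℂ} :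
    IsSpecialization ℂ x v ↔ ∀ F ∈ homIdeal X, eval v F = 0 :=
  forall_congr' fun F => by rw [h.aeval_eq_zero_iff]

theorem IsGenericPoint.isSpecialization_rep (h : IsGenericPoint X x)
    {P : ℙ ℂ (Fin (N + 1) → ℂ)} (hP : P ∈ X) : IsSpecialization ℂ x P.rep :=
  h.isSpecialization_iff.2 fun _ hF => eval_rep_eq_zero hF hP

theorem IsGenericPoint.trdeg_and_finrank (h : IsGenericPoint X x) (hdim : HasDim X n) :
    Algebra.trdeg ℂ K = (n + 1 : ℕ) ∧ Module.finrank K (genTangent ℂ x) = n + 1 := by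
  obtain ⟨d, hd, htr⟩ := exists_ringKrullDim_eq_and_finrank_eq x
    (fun F => (h.aeval_eq_zero_iff F).symm)
  have hdn : d = n + 1 := by
    have : ringKrullDim (coordRing X) = ((n + 1 : ℕ) : WithBot ℕ∞) := hdim
    rw [hd] at this
    exact_mod_cast this
  subst hdn
  refine ⟨?_, (genTangent_eq_span_derivation x htr).1⟩
  have htop : IntermediateField.adjoin ℂ (Set.range x) = ⊤ := by
    rw [eq_top_iff]
    intro z _
    rw [IntermediateField.mem_adjoin_range_iff]
    obtain ⟨f, g, hg, hz⟩ := h.generates z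
    exact ⟨f, g, by rw [← hz, mul_div_cancel_right₀ _ hg]⟩
  rw [htop] at htr
  rw [← htr]
  exact (IntermediateField.topEquiv (F := ℂ) (E := K)).trdeg_eq.symm

theorem exists_vec_mul_ne_zero {ι : Type*} [Finite ι] {M : Submodule ℂ (ι → ℂ)} {e : ι → ℂ}
    (he : e ∉ M) [Fintype ι] :
    ∃ w : ι → ℂ, (∀ f ∈ M, ∑ i, w i * f i = 0) ∧ ∑ i, w i * e i ≠ 0 := by
  classical
  obtain ⟨φ, hφ, hM⟩ := Submodule.exists_dual_map_eq_bot_of_notMem he inferInstance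
  have hsum : ∀ f : ι → ℂ, φ f = ∑ i, φ (Pi.single i 1) * f i := by
    intro f
    conv_lhs => rw [← LinearMap.sum_single_apply (fun _ => ℂ) f, map_sum]
    refine Finset.sum_congr rfl fun i _ => ?_
    rw [mul_comm, ← smul_eq_mul, ← map_smul]
    congr 1
    ext j
    simp [Pi.single_apply]
  refine ⟨fun i => φ (Pi.single i 1), fun f hf => ?_, ?_⟩
  · rw [← hsum]
    have : φ f ∈ M.map φ := ⟨f, hf, rfl⟩
    rwa [hM] at this
  · rwa [← hsum]

/-- Where the tangent space is a graph over the coordinates `J`, the entries of the matrix of the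
generic tangent space are defined, and their values form the matrix of the tangent space. -/
theorem IsGenericPoint.hasValue_of_isGraph (h : IsGenericPoint X x) {v : Fin (N + 1) → ℂ}
    (hv : v ≠ 0) {J : PluckerIndex d N} {a : Fin (N + 1) → Fin d → K}
    (ha : IsGraph (genTangent ℂ x) J a) {c : Fin (N + 1) → Fin d → ℂ}
    (hc : IsGraph (tangentSpace X (Projectivization.mk ℂ v hv)) J c) (l : Fin (N + 1))
    (j : Fin d) : HasValue x v (a l j) (c l j) := by
  classical
  let M : Submodule ℂ (Fin (N + 1) → ℂ) := ((homIdeal X).restrictScalars ℂ).map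
    (LinearMap.pi fun i => (aeval v).toLinearMap ∘ₗ (pderiv i : Derivation ℂ _ _).toLinearMap)
  -- By duality the graph equations of the tangent space at `v`, which vanish on it, are
  -- differentials at `v` of elements of the ideal.
  have hM : ∀ i, (Pi.single i 1 - rowVec J (c i) : Fin (N + 1) → ℂ) ∈ M := by
    intro i
    by_contra hne
    obtain ⟨w, hw, hwi⟩ := exists_vec_mul_ne_zero hne
    refine hwi ?_
    have hwT : w ∈ tangentSpace X (Projectivization.mk ℂ v hv) := by
      rw [mem_tangentSpace_mk]
      exact fun F hF => hw _ ⟨F, hF, rfl⟩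
    have h1 := (hc.mem_iff w).1 hwT i
    have h2 := sum_rowVec_mul (K := ℂ) J (c i) w
    simp only [Algebra.algebraMap_self, RingHom.id_apply] at h2
    simp only [Pi.sub_apply, mul_sub, Finset.sum_sub_distrib]
    rw [Finset.sum_congr rfl fun l _ => mul_comm (w l) (rowVec J (c i) l), h2, ← h1,
      Finset.sum_eq_single i]
    · simp
    · intro b _ hb
      simp [hb]
    · simp
  choose F hF hFv using hM
  have hFv' : ∀ i l, eval v (pderiv l (F i)) =
      (Pi.single i 1 - rowVec J (c i) : Fin (N + 1) → ℂ) l := fun i l => congrFun (hFv i) l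
  -- A square system solved by column `j`, both generically and at `v`: rows in `J` prescribe the
  -- coordinates, the others are differentials of the `F i`. It is invertible at `v`, so Cramer's
  -- rule gives `a l j` a denominator nonzero there. This works at every `v` whose tangent space is
  -- a graph over `J`, not merely at general ones.
  let Mx : Matrix (Fin (N + 1)) (Fin (N + 1)) (MvPolynomial (Fin (N + 1)) ℂ) :=
    Matrix.of fun i l => if i ∈ Set.range J then (if i = l then 1 else 0) else pderiv l (F i)
  let y : Fin (N + 1) → ℂ := fun i => if i ∈ Set.range J then c i j else 0
  have hgen : ∀ i, ∑ l, aeval x (Mx i l) * a l j = aeval x (C (y i) : MvPolynomial _ ℂ) := by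
    intro i
    by_cases hi : i ∈ Set.range J
    · simp only [Mx, y, Matrix.of_apply, if_pos hi]
      obtain ⟨j', rfl⟩ := hi
      rw [Finset.sum_eq_single (J j')]
      · rw [if_pos rfl, map_one, one_mul, ha.normalized, hc.normalized]
        split_ifs <;> simp
      · intro l _ hl
        rw [if_neg hl.symm, map_zero, zero_mul]
      · simp
    · simp only [Mx, y, Matrix.of_apply, if_neg hi]
      rw [map_zero, map_zero, ← ha.column_mem j (F i) ((h.aeval_eq_zero_iff _).2 (hF i))]
      exact Finset.sum_congr rfl fun l _ => mul_comm _ _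
  have hval : ∀ i, ∑ l, eval v (Mx i l) * c l j = eval v (C (y i) : MvPolynomial _ ℂ) := by
    intro i
    by_cases hi : i ∈ Set.range J
    · simp only [Mx, y, Matrix.of_apply, if_pos hi]
      rw [Finset.sum_eq_single i]
      · rw [if_pos rfl, map_one, one_mul, eval_C]
      · intro l _ hl
        rw [if_neg hl.symm, map_zero, zero_mul]
      · simp
    · simp only [Mx, y, Matrix.of_apply, if_neg hi]
      rw [map_zero, map_zero, ← (mem_tangentSpace_mk hv).1 (hc.column_mem j) (F i) (hF i)]
      exact Finset.sum_congr rfl fun l _ => mul_comm _ _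
  have hcram : ∀ {R : Type} [CommRing R] (φ : MvPolynomial (Fin (N + 1)) ℂ →+* R)
      (z : Fin (N + 1) → R), (∀ i, ∑ l, φ (Mx i l) * z l = φ (C (y i))) →
      φ Mx.det * z l = φ (∑ i, Mx.adjugate l i * C (y i)) := by
    intro R _ φ z hz
    have h1 : (φ.mapMatrix Mx).mulVec z = fun i => φ (C (y i)) := funext hz
    have h2 := congrArg ((φ.mapMatrix Mx.adjugate).mulVec) h1
    rw [Matrix.mulVec_mulVec, ← map_mul, Matrix.adjugate_mul] at h2
    have h3 := congrFun h2 l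
    rw [map_sum]
    have h4 : (φ.mapMatrix (Mx.det • (1 : Matrix (Fin (N + 1)) (Fin (N + 1))
        (MvPolynomial (Fin (N + 1)) ℂ)))) = φ Mx.det • 1 := by
      ext i l
      by_cases hil : i = l <;> simp [hil]
    rw [h4, Matrix.smul_mulVec, Matrix.one_mulVec] at h3
    simp only [map_mul]
    simpa [Matrix.mulVec, dotProduct] using h3
  refine ⟨_, Mx.det, ?_, hcram (aeval x).toRingHom (fun l => a l j) hgen,
    (hcram (eval v) (fun l => c l j) hval).symm⟩
  rw [RingHom.map_det]
  intro hdet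
  obtain ⟨w, hw0, hw⟩ := Matrix.exists_mulVec_eq_zero_iff.2 hdet
  have hwi : ∀ i, ∑ l, eval v (Mx i l) * w l = 0 := fun i => congrFun hw i
  have hwJ : ∀ j', w (J j') = 0 := by
    intro j'
    have := hwi (J j')
    simp only [Mx, Matrix.of_apply, if_pos (Set.mem_range_self j')] at this
    rwa [Finset.sum_eq_single (J j') (fun l _ hl => by rw [if_neg hl.symm, map_zero, zero_mul])
      (by simp), if_pos rfl, map_one, one_mul] at this
  refine hw0 (funext fun i => ?_)
  by_cases hi : i ∈ Set.range J
  · obtain ⟨j', rfl⟩ := hi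
    exact hwJ j'
  · have h1 := hwi i
    simp only [Mx, Matrix.of_apply, if_neg hi, hFv'] at h1
    have h2 := sum_rowVec_mul (K := ℂ) J (c i) w
    simp only [Algebra.algebraMap_self, RingHom.id_apply, hwJ, mul_zero,
      Finset.sum_const_zero] at h2
    simp only [Pi.sub_apply, sub_mul, Finset.sum_sub_distrib, h2, sub_zero] at h1
    rw [Finset.sum_eq_single i (fun l _ hl => by simp [hl]) (by simp)] at h1
    simpa using h1

/-- At a general point the tangent space is a graph over the same coordinates as the generic
tangent space. -/
theorem IsGenericPoint.exists_isGraph_of_eval_ne_zero (h : IsGenericPoint X x)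
    {J : PluckerIndex d N} {a : Fin (N + 1) → Fin d → K} (ha : IsGraph (genTangent ℂ x) J a) :
    ∃ δ : MvPolynomial (Fin (N + 1)) ℂ, aeval x δ ≠ 0 ∧
      ∀ (v : Fin (N + 1) → ℂ) (hv : v ≠ 0), IsSpecialization ℂ x v → eval v δ ≠ 0 →
        ∃ c, IsGraph (tangentSpace X (Projectivization.mk ℂ v hv)) J c := by
  obtain ⟨m, f, hf⟩ := exists_fin_generators (homIdeal X)
  obtain ⟨r, hr, hr'⟩ := h.generates.exists_rank_le (jacobian f)
  obtain ⟨g, p, hg, hp⟩ := h.generates.exists_common_denominator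
    fun ij : Fin (N + 1) × Fin d => a ij.1 ij.2
  refine ⟨r * g, by rw [map_mul]; exact mul_ne_zero hr hg, fun v hv hspec hδ => ?_⟩
  rw [map_mul] at hδ
  have hrv := left_ne_zero_of_mul hδ
  have hgv := right_ne_zero_of_mul hδ
  let c : Fin (N + 1) → Fin d → ℂ := fun i j => eval v (p (i, j)) / eval v g
  have hval : ∀ i j, HasValue x v (a i j) (c i j) := fun i j =>
    ⟨p (i, j), g, hgv, hp (i, j), by simp only [c]; field_simp⟩
  have hcJ : ∀ j' j, c (J j') j = if j' = j then 1 else 0 := by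
    intro j' j
    refine (hval (J j') j).unique hspec ?_
    rw [ha.normalized]
    split_ifs
    · simpa using hasValue_algebraMap x v 1
    · simpa using hasValue_algebraMap x v 0
  let T := tangentSpace X (Projectivization.mk ℂ v hv)
  have hcT : ∀ j, (fun i => c i j) ∈ T := by
    intro j
    rw [mem_tangentSpace_mk]
    intro F hF
    refine HasValue.eq_zero hspec ?_
    rw [← ha.column_mem j F ((h.aeval_eq_zero_iff F).2 hF)]
    exact HasValue.sum fun i => (hval i j).mul (HasValue.aeval (hasValue_self x v) _)
  have hker : LinearMap.ker ((jacobian f).map (aeval x)).mulVecLin = genTangent ℂ x := by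
    ext w
    rw [mem_ker_jacobian_iff hf fun F hF => (h.aeval_eq_zero_iff F).2 hF, mem_genTangent]
    exact forall_congr' fun F => by rw [h.aeval_eq_zero_iff]
  have hkerv : LinearMap.ker ((jacobian f).map (eval v)).mulVecLin = T := by
    ext w
    have := mem_ker_jacobian_iff (K := ℂ) hf (y := v) (fun F hF =>
      hspec F ((h.aeval_eq_zero_iff F).2 hF)) w
    rw [mem_tangentSpace_mk]
    exact this
  -- The rank of the Jacobian does not drop, so the tangent space is no larger than the span of the
  -- `d` specialized columns it contains.
  have hle : Module.finrank ℂ T ≤ d := by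
    have h1 := ((jacobian f).map (aeval x)).mulVecLin.finrank_range_add_finrank_ker
    have h2 := ((jacobian f).map (eval v)).mulVecLin.finrank_range_add_finrank_ker
    rw [hker, ha.finrank_eq] at h1
    rw [hkerv] at h2
    have h3 := hr' v hspec hrv
    rw [Matrix.rank, Matrix.rank] at h3
    simp only [Module.finrank_fintype_fun_eq_card] at h1 h2
    omega
  let W : Submodule ℂ (Fin (N + 1) → ℂ) := Submodule.span ℂ (Set.range fun j => fun i => c i j)
  have hW : IsGraph W J c := by
    refine ⟨fun w => ⟨fun hw => ?_, fun hw => ?_⟩, hcJ⟩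
    · induction hw using Submodule.span_induction with
      | mem w hw =>
        obtain ⟨j, rfl⟩ := hw
        intro i
        simp [hcJ]
      | zero => simp
      | add w w' _ _ h1 h2 =>
        intro i
        simp only [Pi.add_apply, mul_add, Finset.sum_add_distrib, ← h1 i, ← h2 i]
      | smul s w _ h1 =>
        intro i
        simp only [Pi.smul_apply, smul_eq_mul, mul_left_comm _ s, ← Finset.mul_sum, ← h1 i]
    · have : w = ∑ j, w (J j) • fun i => c i j := by
        funext i
        rw [Finset.sum_apply, hw i]
        exact Finset.sum_congr rfl fun j _ => mul_comm _ _
      rw [this]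
      exact Submodule.sum_mem _ fun j _ => Submodule.smul_mem _ _ (Submodule.subset_span ⟨j, rfl⟩)
  have hWT : W = T := by
    refine Submodule.eq_of_le_of_finrank_le ?_ (by rw [hW.finrank_eq]; exact hle)
    rw [Submodule.span_le]
    rintro _ ⟨j, rfl⟩
    exact hcT j
  exact ⟨c, by rw [show tangentSpace X _ = W from hWT.symm]; exact hW⟩

/-- A nonzero rational function does not vanish at some point where the tangent space is a graph
over the chosen coordinates. -/
theorem IsGenericPoint.exists_point (h : IsGenericPoint X x) {J : PluckerIndex d N}
    {a : Fin (N + 1) → Fin d → K} (ha : IsGraph (genTangent ℂ x) J a) {z : K} (hz : z ≠ 0) :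
    ∃ (v : Fin (N + 1) → ℂ) (hv : v ≠ 0) (c : _), Projectivization.mk ℂ v hv ∈ X ∧
      IsSpecialization ℂ x v ∧ IsGraph (tangentSpace X (Projectivization.mk ℂ v hv)) J c ∧
      ∀ e, HasValue x v z e → e ≠ 0 := by
  obtain ⟨δ, hδ, hδ'⟩ := h.exists_isGraph_of_eval_ne_zero ha
  obtain ⟨f, g, hg, hfg⟩ := h.generates z
  have hf : aeval x f ≠ 0 := by
    rw [← hfg]
    exact mul_ne_zero hz hg
  have hne : δ * f * g ∉ homIdeal X := by
    rw [← h.aeval_eq_zero_iff, map_mul, map_mul]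
    exact mul_ne_zero (mul_ne_zero hδ hf) hg
  rw [mem_homIdeal] at hne
  push Not at hne
  obtain ⟨v, hv, hvX, hne⟩ := hne
  rw [map_mul, map_mul] at hne
  have hspec : IsSpecialization ℂ x v := h.isSpecialization_iff.2 fun F hF =>
    mem_homIdeal.1 hF v hv hvX
  obtain ⟨c, hc⟩ := hδ' v hv hspec (left_ne_zero_of_mul (left_ne_zero_of_mul hne))
  refine ⟨v, hv, c, hvX, hspec, hc, fun e he h0 => ?_⟩
  have hgv := right_ne_zero_of_mul hne
  have : HasValue x v z (eval v f / eval v g) :=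
    ⟨f, g, hgv, by rw [mul_comm, hfg], by field_simp⟩
  have h1 := he.unique hspec this
  rw [h0] at h1
  exact div_ne_zero (right_ne_zero_of_mul (left_ne_zero_of_mul hne)) hgv h1.symm

end GenericPoints

end GaussScroll

/-! ### Gauss charts and the dimension of the Gauss image. -/

namespace GaussScroll

open MvPolynomial

section GaussCharts

variable {N n g s m : ℕ} {X : Set (ℙ ℂ (Fin (N + 1) → ℂ))}

theorem map_maxMinor {R S : Type*} [CommRing R] [CommRing S] {d : ℕ} (φ : R →+* S)
    (a : Fin (N + 1) → Fin d → R) (I : Fin d → Fin (N + 1)) :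
    φ (maxMinor a I) = maxMinor (fun i j => φ (a i j)) I := by
  rw [maxMinor, RingHom.map_det]
  rfl

theorem IsSmoothPoint.finrank_tangentSpace (hdim : HasDim X n) {Q : ℙ ℂ (Fin (N + 1) → ℂ)}
    (hQ : IsSmoothPoint X Q) : Module.finrank ℂ (tangentSpace X Q) = n + 1 := by
  have h := hQ.2
  rw [show ringKrullDim (coordRing X) = _ from hdim] at h
  exact_mod_cast h

theorem isSmoothPoint_of_isGraph (hdim : HasDim X n) {Q : ℙ ℂ (Fin (N + 1) → ℂ)} (hQ : Q ∈ X)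
    {J : PluckerIndex (n + 1) N} {c : Fin (N + 1) → Fin (n + 1) → ℂ}
    (hc : IsGraph (tangentSpace X Q) J c) : IsSmoothPoint X Q := by
  refine ⟨hQ, ?_⟩
  rw [hc.finrank_eq, show ringKrullDim (coordRing X) = _ from hdim]

theorem IsGraph.pluckerVec_ne_zero {d : ℕ} {W : Submodule ℂ (Fin (N + 1) → ℂ)}
    {J : PluckerIndex d N} {a : Fin (N + 1) → Fin d → ℂ} (h : IsGraph W J a) :
    pluckerVec d W ≠ 0 := by
  obtain ⟨c, hc, hpl⟩ := h.pluckerVec_eq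
  intro h0
  have := congrFun h0 J
  rw [hpl] at this
  simp only [maxMinor_self h.normalized, mul_one] at this
  exact hc this

/-- A Gauss value with nonvanishing coordinate `J` is given by its coordinates in the chart. -/
theorem IsGaussValue.isGraph (hdim : HasDim X n) {Q : ℙ ℂ (Fin (N + 1) → ℂ)}
    {b : ℙ ℂ (PluckerIndex (n + 1) N → ℂ)} (h : IsGaussValue X n Q b)
    {J : PluckerIndex (n + 1) N} (hJ : b.rep J ≠ 0) :
    IsGraph (tangentSpace X Q) J fun i j => chartCoord J b.rep (i, j) := by
  have hb : ℂ ∙ b.rep = ℂ ∙ pluckerVec (n + 1) (tangentSpace X Q) := by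
    rw [← b.submodule_eq, h.2]
  have hne : pluckerVec (n + 1) (tangentSpace X Q) J ≠ 0 := by
    obtain ⟨t, ht⟩ := Submodule.mem_span_singleton.1 (hb ▸ Submodule.mem_span_singleton_self b.rep)
    intro h0
    apply hJ
    rw [← ht, Pi.smul_apply, h0, smul_zero]
  obtain ⟨c, hc⟩ := exists_isGraph_of_pluckerVec_ne_zero (h.1.finrank_tangentSpace hdim) hne
  have := (chartCoord_eq_of_isGraph hc b.rep_nonzero hb).2.1
  simpa only [this] using hc

/-- A point where the tangent space is a graph has a Gauss value. -/
theorem exists_isGaussValue_of_isGraph (hdim : HasDim X n) {Q : ℙ ℂ (Fin (N + 1) → ℂ)}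
    (hQ : Q ∈ X) {J : PluckerIndex (n + 1) N} {c : Fin (N + 1) → Fin (n + 1) → ℂ}
    (hc : IsGraph (tangentSpace X Q) J c) : ∃ b, IsGaussValue X n Q b ∧ b.rep J ≠ 0 ∧
      (∀ lj, chartCoord J b.rep lj = c lj.1 lj.2) ∧ ∀ I, b.rep I = b.rep J * maxMinor c I := by
  let b := Projectivization.mk ℂ _ hc.pluckerVec_ne_zero
  have hb : b.submodule = ℂ ∙ pluckerVec (n + 1) (tangentSpace X Q) :=
    Projectivization.submodule_mk _ _
  refine ⟨b, ⟨isSmoothPoint_of_isGraph hdim hQ hc, hb⟩, ?_⟩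
  exact chartCoord_eq_of_isGraph hc b.rep_nonzero (by rw [← b.submodule_eq, hb])

/-- A generic point `x` of the cone over `X` together with the matrix `a` of the generic tangent
space in the chart `J`, whose entries generate the function field `k` of the Gauss image. -/
structure GaussChart {k K : Type} [Field k] [Field K] [Algebra ℂ k] [Algebra k K] [Algebra ℂ K]
    (X : Set (ℙ ℂ (Fin (N + 1) → ℂ))) (n s m : ℕ) (x : Fin (N + 1) → K)
    (J : PluckerIndex (n + 1) N) (a : Fin (N + 1) → Fin (n + 1) → k) : Prop where
  generic : IsGenericPoint X x
  chart : TangentChart ℂ x J a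
  trdeg_base : Algebra.trdeg ℂ k = s
  trdeg_fibre : Algebra.trdeg k K = m
  add_eq : s + m = n + 1
  hasDim : HasDim X n

theorem exists_gaussChart (hX : IsIrreducible X) (hdim : HasDim X n) :
    ∃ (k K : Type) (_ : Field k) (_ : Field K) (_ : Algebra ℂ k) (_ : Algebra k K)
      (_ : Algebra ℂ K) (_ : IsScalarTower ℂ k K) (s m : ℕ) (x : Fin (N + 1) → K)
      (J : PluckerIndex (n + 1) N) (a : Fin (N + 1) → Fin (n + 1) → k),
      GaussChart X n s m x J a := by
  obtain ⟨K, _, _, x, hx⟩ := exists_isGenericPoint hX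
  obtain ⟨htr, hfin⟩ := hx.trdeg_and_finrank hdim
  obtain ⟨J, aK, ha⟩ := exists_isGraph _ hfin
  let q : Fin (N + 1) × Fin (n + 1) → K := fun ij => aK ij.1 ij.2
  let k := IntermediateField.adjoin ℂ (Set.range q)
  let a : Fin (N + 1) → Fin (n + 1) → k := fun i j =>
    ⟨aK i j, IntermediateField.subset_adjoin ℂ _ ⟨(i, j), rfl⟩⟩
  have hadd := trdeg_add_eq (R := ℂ) (S := k) (A := K)
  rw [htr] at hadd
  have hlt : Algebra.trdeg ℂ k < Cardinal.aleph0 ∧ Algebra.trdeg k K < Cardinal.aleph0 := by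
    rw [← Cardinal.add_lt_aleph0_iff, hadd]
    exact Cardinal.natCast_lt_aleph0
  obtain ⟨s, hs⟩ := Cardinal.lt_aleph0.1 hlt.1
  obtain ⟨m, hm⟩ := Cardinal.lt_aleph0.1 hlt.2
  refine ⟨k, K, inferInstance, inferInstance, inferInstance, inferInstance, inferInstance,
    inferInstance, s, m, x, J, a, hx, ⟨hx.generates, ?_, ha.mem_iff, ?_, ?_⟩, hs, hm, ?_, hdim⟩
  · intro F hF
    exact euler_of_mem (fun f hf i => homogeneousComponent_mem_homIdeal hf i)
      (fun f hf => (hx.aeval_eq_zero_iff f).2 hf) ((hx.aeval_eq_zero_iff F).1 hF)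
  · intro j' j
    refine Subtype.ext ?_
    refine (ha.normalized j' j).trans ?_
    split_ifs <;> rfl
  · exact generatesField_adjoin q
  · rw [hs, hm] at hadd
    exact_mod_cast hadd

namespace GaussChart

variable {k K : Type} [Field k] [Field K] [Algebra ℂ k] [Algebra k K] [Algebra ℂ K]
  [IsScalarTower ℂ k K] {x : Fin (N + 1) → K} {J : PluckerIndex (n + 1) N}
  {a : Fin (N + 1) → Fin (n + 1) → k}

theorem isGraph (h : GaussChart X n s m x J a) :
    IsGraph (genTangent ℂ x) J fun i j => algebraMap k K (a i j) := by
  refine ⟨h.chart.mem_iff, fun j' j => ?_⟩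
  rw [h.chart.normalized]
  split_ifs <;> simp

/-- Where the tangent space is a graph, the elements of `ℂ[a]` are defined. -/
theorem hasValue_aeval (h : GaussChart X n s m x J a) {v : Fin (N + 1) → ℂ} (hv : v ≠ 0)
    {c : Fin (N + 1) × Fin (n + 1) → ℂ}
    (hc : IsGraph (tangentSpace X (Projectivization.mk ℂ v hv)) J fun i j => c (i, j))
    (f : MvPolynomial (Fin (N + 1) × Fin (n + 1)) ℂ) :
    HasValue x v (algebraMap k K (aeval (fun ij : _ × _ => a ij.1 ij.2) f)) (eval c f) := by
  have hval : ∀ ij : Fin (N + 1) × Fin (n + 1),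
      HasValue x v (algebraMap k K (a ij.1 ij.2)) (c ij) := by
    rintro ⟨i, j⟩
    exact h.generic.hasValue_of_isGraph hv h.isGraph hc i j
  have h1 := HasValue.aeval hval f
  have h2 := aeval_algebraMap_comp (K := K)
    (fun ij : Fin (N + 1) × Fin (n + 1) => a ij.1 ij.2) f
  rwa [h2] at h1

/-- The entries of `a` are defined at every smooth point whose Gauss value has nonzero coordinate
`J`, so no generality of `b` is needed. -/
theorem isSpecialization_chartCoord (h : GaussChart X n s m x J a)
    {b : ℙ ℂ (PluckerIndex (n + 1) N → ℂ)} (hb : b ∈ gaussImage X n) (hJ : b.rep J ≠ 0) :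
    IsSpecialization ℂ (fun ij : Fin (N + 1) × Fin (n + 1) => a ij.1 ij.2)
      (chartCoord J b.rep) := by
  obtain ⟨Q, hQ⟩ := hb
  intro G hG
  refine HasValue.eq_zero (h.generic.isSpecialization_rep hQ.1.1) ?_
  rw [← map_zero (algebraMap k K), ← hG]
  refine h.hasValue_aeval Q.rep_nonzero ?_ G
  rw [Q.mk_rep]
  exact hQ.isGraph h.hasDim hJ

theorem exists_isGaussValue (h : GaussChart X n s m x J a) {z : K} (hz : z ≠ 0) :
    ∃ (v : Fin (N + 1) → ℂ) (hv : v ≠ 0) (b : _),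
      IsGaussValue X n (Projectivization.mk ℂ v hv) b ∧ b.rep J ≠ 0 ∧
      (∀ I, b.rep I = b.rep J * maxMinor (fun i j => chartCoord J b.rep (i, j)) I) ∧
      IsSpecialization ℂ x v ∧ ∀ e, HasValue x v z e → e ≠ 0 := by
  obtain ⟨v, hv, c, hvX, hspec, hc, hne⟩ := h.generic.exists_point h.isGraph hz
  obtain ⟨b, hb, hJ, hbc, hbI⟩ := exists_isGaussValue_of_isGraph h.hasDim hvX hc
  refine ⟨v, hv, b, hb, hJ, fun I => ?_, hspec, hne⟩
  rw [hbI I]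
  simp only [hbc]

theorem exists_eval_chartCoord_ne_zero (h : GaussChart X n s m x J a)
    {G : MvPolynomial (Fin (N + 1) × Fin (n + 1)) ℂ}
    (hG : aeval (fun ij : _ × _ => a ij.1 ij.2) G ≠ 0) :
    ∃ b ∈ gaussImage X n, b.rep J ≠ 0 ∧ eval (chartCoord J b.rep) G ≠ 0 := by
  obtain ⟨v, hv, b, hb, hJ, -, -, hne⟩ := h.exists_isGaussValue
    ((map_ne_zero (algebraMap k K)).2 hG)
  exact ⟨b, ⟨_, hb⟩, hJ, hne _ (h.hasValue_aeval hv (hb.isGraph h.hasDim hJ) G)⟩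

theorem exists_ne_zero (h : GaussChart X n s m x J a) : ∃ i, x i ≠ 0 := by
  obtain ⟨v, hv, b, -, -, -, hspec, -⟩ := h.exists_isGaussValue (one_ne_zero (α := K))
  by_contra! hx
  refine hv (funext fun i => ?_)
  simpa using hspec (MvPolynomial.X i) (by simpa using hx i)

/-- Scaling the generic Plücker vector by `x i₀`, transcendental over `k`, gives a point `q` of the
affine cone over the Gauss image. Its coordinates generate a field containing `k` and `x i₀`, so `1
+ s` is at most the dimension `g + 1` of that cone. The reverse inequality is not needed. -/
theorem le_of_hasDim (h : GaussChart X n s m x J a) (hg : HasDim (gaussImage X n) g) : s ≤ g := by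
  obtain ⟨i₀, hi₀⟩ := h.exists_ne_zero
  let q : PluckerIndex (n + 1) N → K := fun I => x i₀ * algebraMap k K (maxMinor a I)
  have hker : homIdeal (gaussImage X n) ≤ RingHom.ker (aeval q) := by
    intro F hF
    rw [RingHom.mem_ker]
    by_contra hne
    -- If `F` did not vanish at `q`, neither would its value at some actual point `v`; but there `q`
    -- takes as value a nonzero multiple of the Plücker vector of a Gauss value, where `F` is zero.
    obtain ⟨v, hv, b, hb, hJ, hbI, hspec, hval⟩ := h.exists_isGaussValue (mul_ne_zero hi₀ hne)
    let c := chartCoord J b.rep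
    let w : PluckerIndex (n + 1) N → ℂ := fun I => v i₀ * maxMinor (fun i j => c (i, j)) I
    have hq : ∀ I, HasValue x v (q I) (w I) := by
      intro I
      have := h.hasValue_aeval hv (hb.isGraph h.hasDim hJ)
        (maxMinor (fun i j => MvPolynomial.X (i, j)) I)
      rw [map_maxMinor] at this
      rw [← AlgHom.coe_toRingHom, map_maxMinor] at this
      simp only [AlgHom.coe_toRingHom, aeval_X, eval_X] at this
      exact (hasValue_self x v i₀).mul this
    have he := hval _ ((hasValue_self x v i₀).mul (HasValue.aeval hq F))
    have hvi := left_ne_zero_of_mul he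
    refine right_ne_zero_of_mul he ?_
    have hw : w = fun I => v i₀ / b.rep J * b.rep I := by
      funext I
      rw [hbI I]
      simp only [w, c]
      field_simp
    rw [hw]
    have hne' := mul_ne_zero_fun b.rep_nonzero (div_ne_zero hvi hJ)
    refine mem_homIdeal.1 hF _ hne' ?_
    rw [mk_smul_eq b.rep_nonzero, b.mk_rep]
    exact ⟨_, hb⟩
  obtain ⟨d, hd, htr⟩ := exists_ringKrullDim_eq_and_finrank_eq q
    (I := RingHom.ker (aeval (R := ℂ) q)) fun f => RingHom.mem_ker
  have hdg : d ≤ g + 1 := by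
    have h1 := ringKrullDim_le_of_surjective _ (Ideal.Quotient.factor_surjective hker)
    rw [hd, show ringKrullDim (MvPolynomial _ ℂ ⧸ homIdeal (gaussImage X n)) = _ from hg] at h1
    exact_mod_cast h1
  let E := IntermediateField.adjoin ℂ (Set.range q)
  have hqE : ∀ I, q I ∈ E := fun I => IntermediateField.subset_adjoin ℂ _ ⟨I, rfl⟩
  have hxE : x i₀ ∈ E := by
    have := hqE J
    rwa [show q J = x i₀ by simp only [q, maxMinor_self h.chart.normalized, map_one, mul_one]]
      at this
  have haE : ∀ i j, algebraMap k K (a i j) ∈ E := by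
    intro i j
    rw [exchange_maxMinor h.chart.normalized (i, j), map_mul]
    refine E.mul_mem (by rw [map_intCast]; exact E.intCast_mem _) ?_
    have := E.div_mem (hqE (exchangeIndex J (i, j))) hxE
    rwa [show q (exchangeIndex J (i, j)) = _ from rfl, mul_div_cancel_left₀ _ hi₀] at this
  have hkE : ∀ z : k, algebraMap k K z ∈ E := by
    intro z
    obtain ⟨f, g, hg, hz⟩ := h.chart.generates_chart z
    have hmem : ∀ f : MvPolynomial (Fin (N + 1) × Fin (n + 1)) ℂ,
        algebraMap k K (aeval (fun ij : _ × _ => a ij.1 ij.2) f) ∈ E := by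
      intro f
      rw [← aeval_algebraMap_comp (K := K) (fun ij : _ × _ => a ij.1 ij.2) f]
      have := aeval_algebraMap_comp (K := K) (fun ij : Fin (N + 1) × Fin (n + 1) =>
        (⟨_, haE ij.1 ij.2⟩ : E)) f
      exact (congrArg (· ∈ E) this).mpr (Subtype.prop _)
    rw [eq_div_of_mul_eq hg hz, map_div₀]
    exact E.div_mem (hmem f) (hmem g)
  obtain ⟨u, hu⟩ := exists_fin_isTranscendenceBasis h.trdeg_base
  have hind := hu.1.sumElim_comp (y := fun _ : Unit => x i₀) (A := K)
    ((algebraicIndependent_unique_type_iff (R := k)).2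
      (h.chart.transcendental h.trdeg_base hi₀))
  have hindE : AlgebraicIndependent ℂ (Sum.elim (fun _ : Unit => (⟨x i₀, hxE⟩ : E))
      fun i => ⟨algebraMap k K (u i), hkE (u i)⟩) := by
    refine AlgebraicIndependent.of_comp E.val ?_
    convert! hind using 1
    ext (_ | _) <;> rfl
  have hcard := hindE.lift_cardinalMk_le_trdeg
  rw [htr] at hcard
  simp only [Cardinal.mk_sum, Cardinal.mk_unit, Cardinal.mk_fin] at hcard
  simp only [Cardinal.lift_id] at hcard
  have : 1 + s ≤ d := by exact_mod_cast hcard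
  omega

end GaussChart

end GaussCharts

end GaussScroll

/-! ### Gauss fibres over general values, vertices, and rational maps. -/

namespace GaussScroll

open MvPolynomial

section Fibres

/-- `M` kills the columns of `A` generically, hence after specialization, which gives one inclusion;
the rank bound on `M` gives equality. -/
theorem SubspaceFamily.ker_eq_ker {F k ι σ α : Type*} [Field F] [Field k] [Algebra F k] [Fintype σ]
    [Fintype α] {z : ι → k} {V : Submodule k (σ → k)} {A B : Matrix σ σ (MvPolynomial ι F)}
    {r : MvPolynomial ι F} (h : SubspaceFamily z V A B r) {M : Matrix α σ (MvPolynomial ι F)}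
    (hM : LinearMap.ker (M.map (aeval z)).mulVecLin = V) {c : ι → F}
    (hc : IsSpecialization F z c) (hr : eval c r ≠ 0)
    (hrank : (M.map (aeval z)).rank ≤ (M.map (eval c)).rank) :
    LinearMap.ker (M.map (eval c)).mulVecLin = LinearMap.ker (B.map (eval c)).mulVecLin := by
  classical
  symm
  refine Submodule.eq_of_le_of_finrank_le ?_ ?_
  · rw [← h.range_eq_ker c hc hr]
    rintro _ ⟨u, rfl⟩
    have hMA : ∀ i j, ∑ l, eval c (M i l) * eval c (A l j) = 0 := by
      intro i j
      have h1 : (A.map (aeval z)).mulVecLin (Pi.single j 1) ∈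
          LinearMap.ker (M.map (aeval z)).mulVecLin := by
        rw [hM, ← h.range_eq]
        exact ⟨_, rfl⟩
      have h2 := hc (∑ l, M i l * A l j) (by
        have := congrFun (LinearMap.mem_ker.1 h1) i
        simpa [Matrix.mulVec, dotProduct] using this)
      simpa using h2
    rw [LinearMap.mem_ker, Matrix.mulVecLin_apply, Matrix.mulVecLin_apply, Matrix.mulVec_mulVec]
    have : M.map (eval c) * A.map (eval c) = 0 := by
      ext i j
      simpa [Matrix.mul_apply] using hMA i j
    rw [this, Matrix.zero_mulVec]
  · rw [h.finrank_ker c hc hr, ← hM]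
    have h1 := (M.map (aeval z)).mulVecLin.finrank_range_add_finrank_ker
    have h2 := (M.map (eval c)).mulVecLin.finrank_range_add_finrank_ker
    rw [Matrix.rank, Matrix.rank] at hrank
    simp only [Module.finrank_fintype_fun_eq_card] at h1 h2
    omega

variable {N n s m : ℕ} {X : Set (ℙ ℂ (Fin (N + 1) → ℂ))}

/-- Polynomials in the coordinates of a chart define a rational map by forms of one degree that
all vanish outside the basic open set where `r` does not vanish. -/
theorem exists_forms {d : ℕ} (J : PluckerIndex d N) {ι : Type} [Fintype ι]
    (P : ι → MvPolynomial (Fin (N + 1) × Fin d) ℂ) (r : MvPolynomial (Fin (N + 1) × Fin d) ℂ) :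
    ∃ (e e' : ℕ) (f : ι → MvPolynomial (PluckerIndex d N) ℂ)
      (R : MvPolynomial (PluckerIndex d N) ℂ),
      (∀ i, (f i).IsHomogeneous e) ∧ R.IsHomogeneous e' ∧
      (∀ v, eval v R ≠ 0 ↔ v J ≠ 0 ∧ eval (chartCoord J v) r ≠ 0) ∧
      (∀ v, eval v R = 0 → ∀ i, eval v (f i) = 0) ∧
      ∀ v, eval v R ≠ 0 → ∃ ρ : ℂ, ρ ≠ 0 ∧
        ∀ i, eval v (f i) = ρ * eval (chartCoord J v) (P i) := by
  let e₀ := Finset.univ.sup fun i => (P i).totalDegree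
  choose H hH hHv using fun i => exists_homogenization J (P i)
    (Finset.le_sup (f := fun i => (P i).totalDegree) (Finset.mem_univ i) : _ ≤ e₀)
  obtain ⟨T, hT, hTv⟩ := exists_homogenization J r le_rfl
  -- The common factor `X J * T` makes all the forms vanish outside the chosen open set. The image,
  -- taken over the whole Gauss image, then contains no unwanted values.
  refine ⟨1 + r.totalDegree + e₀, 1 + r.totalDegree, fun i => MvPolynomial.X J * T * H i,
    MvPolynomial.X J * T, fun i => ((isHomogeneous_X _ _).mul hT).mul (hH i),
    (isHomogeneous_X _ _).mul hT, fun v => ?_, fun v hv i => ?_, fun v hv => ?_⟩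
  · rw [map_mul, eval_X, mul_ne_zero_iff]
    refine and_congr_right fun hJ => ?_
    rw [hTv v hJ, mul_ne_zero_iff]
    exact and_iff_right (pow_ne_zero _ hJ)
  · rw [map_mul, hv, zero_mul]
  · have hJ : v J ≠ 0 := by
      rw [map_mul, eval_X] at hv
      exact left_ne_zero_of_mul hv
    refine ⟨eval v (MvPolynomial.X J * T) * v J ^ e₀, mul_ne_zero hv (pow_ne_zero _ hJ),
      fun i => ?_⟩
    rw [map_mul, hHv i v hJ, mul_assoc]

theorem isRatValue_mk {κ ι : Type} {f : ι → MvPolynomial κ ℂ} {b : ℙ ℂ (κ → ℂ)} {w : ι → ℂ}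
    (hw : w ≠ 0) {ρ : ℂ} (hρ : ρ ≠ 0) (h : ∀ i, eval b.rep (f i) = ρ * w i) :
    IsRatValue f b (Projectivization.mk ℂ w hw) := by
  rw [IsRatValue, Projectivization.submodule_mk, ← Submodule.span_singleton_smul_eq
    (IsUnit.mk0 ρ hρ) w]
  congr 2
  funext i
  rw [h, Pi.smul_apply, smul_eq_mul]

namespace GaussChart

variable {k K : Type} [Field k] [Field K] [Algebra ℂ k] [Algebra k K] [Algebra ℂ K]
  [IsScalarTower ℂ k K] {x : Fin (N + 1) → K} {J : PluckerIndex (n + 1) N}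
  {a : Fin (N + 1) → Fin (n + 1) → k}

/-- The linear space spanned by the generic fibre of the Gauss map lies in the cone over `X`. -/
theorem aeval_eq_zero_of_mem_solSpace (h : GaussChart X n s m x J a)
    {F : MvPolynomial (Fin (N + 1)) ℂ} (hF : F ∈ homIdeal X) {y : Fin (N + 1) → K}
    (hy : y ∈ solSpace (developableEqs ℂ J a) K) : aeval y F = 0 := by
  have := h.chart.aeval_eq_zero_of_mem_solSpace h.trdeg_base h.trdeg_fibre
    (G := MvPolynomial.map (algebraMap ℂ k) F)
    (by rw [aeval_map_algebraMap]; exact (h.generic.aeval_eq_zero_iff F).2 hF) hy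
  rwa [aeval_map_algebraMap] at this

/-- A constant point in the generic fibre of the Gauss map is a vertex of `X`. -/
theorem isCone (h : GaussChart X n s m x J a) (hX : IsClosed X) {p : Fin (N + 1) → k}
    (hp : p ∈ solSpace (developableEqs ℂ J a) k) (hp0 : p ≠ 0) {t : k} {c : Fin (N + 1) → ℂ}
    (hpc : ∀ i, p i = t * algebraMap ℂ k (c i)) : IsCone X := by
  have ht : t ≠ 0 := by
    rintro rfl
    exact hp0 (funext fun i => by rw [hpc, zero_mul]; rfl)
  have hc0 : c ≠ 0 := by
    rintro rfl
    exact hp0 (funext fun i => by rw [hpc]; simp)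
  have hcmem : (fun i => algebraMap ℂ K (c i)) ∈ solSpace (developableEqs ℂ J a) K := by
    have h1 : mapVec K (t⁻¹ • p) ∈ solSpace (developableEqs ℂ J a) K :=
      mapVec_mem_solSpace.2 (Submodule.smul_mem _ _ hp)
    convert h1 using 1
    funext i
    rw [mapVec, Pi.smul_apply, smul_eq_mul, hpc, inv_mul_cancel_left₀ ht,
      ← IsScalarTower.algebraMap_apply]
  -- The combination of `c` and `x` lies in the linear space spanned by the generic fibre, hence on
  -- the cone over `X`; specializing `x` to an arbitrary point `P` keeps the equation.
  have key : ∀ F ∈ homIdeal X, ∀ (α β : ℂ), ∀ P ∈ X,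
      eval (fun i => α * c i + β * P.rep i) F = 0 := by
    intro F hF α β P hP
    refine HasValue.eq_zero (h.generic.isSpecialization_rep hP) ?_
    have h0 : aeval (fun i => algebraMap ℂ K α * algebraMap ℂ K (c i) + algebraMap ℂ K β * x i)
        F = 0 :=
      h.aeval_eq_zero_of_mem_solSpace hF (Submodule.add_mem _ (Submodule.smul_mem _ _ hcmem)
        (Submodule.smul_mem _ _ h.chart.self_mem_solSpace))
    rw [← h0]
    exact HasValue.aeval (fun i => ((hasValue_algebraMap _ _ α).mul
      (hasValue_algebraMap _ _ (c i))).add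
        ((hasValue_algebraMap _ _ β).mul (hasValue_self _ _ i))) F
  obtain ⟨v, hv, b, hb, -⟩ := h.exists_isGaussValue (one_ne_zero (α := K))
  refine ⟨Projectivization.mk ℂ c hc0, mk_mem_of_isClosed hX hc0 fun F hF => ?_,
    fun P hP Q hQ => ?_⟩
  · have := key F hF 1 0 _ hb.1.1
    simpa using this
  · rw [mem_linearSubspace, Projectivization.submodule_mk, P.submodule_eq,
      Submodule.mem_sup] at hQ
    obtain ⟨y, hy, w, hw, hyw⟩ := hQ
    obtain ⟨α, rfl⟩ := Submodule.mem_span_singleton.1 hy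
    obtain ⟨β, rfl⟩ := Submodule.mem_span_singleton.1 hw
    rw [← Q.mk_rep]
    refine mk_mem_of_isClosed hX Q.rep_nonzero fun F hF => ?_
    rw [← hyw]
    exact key F hF α β P hP

/-- The ideal of the image of a rational map from the Gauss image, in terms of the value `p` at
the generic point. -/
theorem mem_homIdeal_ratImage_iff (h : GaussChart X n s m x J a)
    {P f : Fin (N + 1) → MvPolynomial _ ℂ} {r R : MvPolynomial _ ℂ}
    (hr : aeval (fun ij : _ × _ => a ij.1 ij.2) r ≠ 0)
    (hP : ∀ c, eval c r ≠ 0 → (fun i => eval c (P i)) ≠ 0)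
    (hR : ∀ v, eval v R ≠ 0 ↔ v J ≠ 0 ∧ eval (chartCoord J v) r ≠ 0)
    (hf₀ : ∀ v, eval v R = 0 → ∀ i, eval v (f i) = 0)
    (hf : ∀ v, eval v R ≠ 0 → ∃ ρ : ℂ, ρ ≠ 0 ∧
        ∀ i, eval v (f i) = ρ * eval (chartCoord J v) (P i))
    (F : MvPolynomial (Fin (N + 1)) ℂ) : F ∈ homIdeal (ratImage f (gaussImage X n)) ↔
      ∀ e, aeval (fun i => aeval (fun ij : _ × _ => a ij.1 ij.2) (P i))
        (homogeneousComponent e F) = 0 := by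
  have haev : ∀ G : MvPolynomial (Fin (N + 1)) ℂ,
      aeval (fun i => aeval (fun ij : Fin (N + 1) × Fin (n + 1) => a ij.1 ij.2) (P i)) G =
        aeval (fun ij : Fin (N + 1) × Fin (n + 1) => a ij.1 ij.2) (aeval P G) := fun G =>
    (DFunLike.congr_fun (comp_aeval P
      (aeval fun ij : Fin (N + 1) × Fin (n + 1) => a ij.1 ij.2)) G).symm
  have hev : ∀ (c : Fin (N + 1) × Fin (n + 1) → ℂ) (G : MvPolynomial (Fin (N + 1)) ℂ),
      eval (fun i => eval c (P i)) G = eval c (aeval P G) := fun c G =>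
    (DFunLike.congr_fun (comp_aeval P (aeval (R := ℂ) c)) G).symm
  have hmk : ∀ b : ℙ ℂ (PluckerIndex (n + 1) N → ℂ), ∀ hR' : eval b.rep R ≠ 0,
      IsRatValue f b (Projectivization.mk ℂ _ (hP _ ((hR _).1 hR').2)) := by
    intro b hR'
    obtain ⟨ρ, hρ, hρf⟩ := hf _ hR'
    exact isRatValue_mk _ hρ hρf
  rw [ratImage, homIdeal_closure, mem_homIdeal_iff_homogeneousComponent]
  refine forall_congr' fun e => ?_
  have hhom := homogeneousComponent_isHomogeneous e F
  rw [haev]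
  constructor
  · intro hall
    by_contra hne
    obtain ⟨b, hb, hJ, hbne⟩ := h.exists_eval_chartCoord_ne_zero
      (G := aeval P (homogeneousComponent e F) * r) (by
        rw [map_mul]
        exact mul_ne_zero hne hr)
    rw [map_mul] at hbne
    have hR' := (hR b.rep).2 ⟨hJ, right_ne_zero_of_mul hbne⟩
    have := hall _ ⟨b, hb, hmk b hR'⟩
    rw [eval_mk_rep_eq_zero_iff hhom, hev] at this
    exact left_ne_zero_of_mul hbne this
  · rintro hzero Q ⟨b, hb, hQ⟩
    have hR' : eval b.rep R ≠ 0 := by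
      intro h0
      have hQ0 : Q.rep ∈ ℂ ∙ fun i => eval b.rep (f i) := by
        rw [← hQ, Q.submodule_eq]
        exact Submodule.mem_span_singleton_self _
      rw [show (fun i => eval b.rep (f i)) = 0 from funext (hf₀ _ h0),
        Submodule.span_zero_singleton, Submodule.mem_bot] at hQ0
      exact Q.rep_nonzero hQ0
    have hQmk : Q = Projectivization.mk ℂ _ (hP _ ((hR _).1 hR').2) := by
      refine Projectivization.submodule_injective ?_
      rw [hQ, hmk b hR']
    rw [hQmk, eval_mk_rep_eq_zero_iff hhom, hev]
    exact h.isSpecialization_chartCoord hb ((hR _).1 hR').1 _ hzero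

/-- Over a general point, the closure of the fibre of the Gauss map is the corresponding member of
the family of linear spaces spanned by the generic fibre. -/
theorem closure_gaussFibre_eq (h : GaussChart X n s m x J a) (hX : IsClosed X)
    {A B : Matrix (Fin (N + 1)) (Fin (N + 1)) (MvPolynomial _ ℂ)} {r : MvPolynomial _ ℂ}
    (hAB : SubspaceFamily (fun ij : _ × _ => a ij.1 ij.2)
      (solSpace (developableEqs ℂ J a) k) A B r) :
    ∃ δ : MvPolynomial (Fin (N + 1) × Fin (n + 1)) ℂ, aeval (fun ij : _ × _ => a ij.1 ij.2) δ ≠ 0 ∧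
      ∀ b ∈ gaussImage X n, b.rep J ≠ 0 → eval (chartCoord J b.rep) δ ≠ 0 →
        eval (chartCoord J b.rep) r ≠ 0 → closure (gaussFibre X n b) =
          linearSubspace (LinearMap.ker (B.map (eval (chartCoord J b.rep))).mulVecLin) := by
  obtain ⟨δ, hδ, hδv⟩ := h.generic.exists_isGraph_of_eval_ne_zero h.isGraph
  obtain ⟨t, ht⟩ := exists_mulVec_eq_of_mem_solSpace hAB.range_eq h.chart.self_mem_solSpace
  -- Constant parameters `τ` for which the vector `A τ` avoids `δ`. The nonvanishing becomes a
  -- condition on the chart coordinates alone and marks a nonempty open part of each general member.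
  obtain ⟨τ, hτ⟩ := exists_aeval_mulVec_ne_zero ht hδ
  let z : Fin (N + 1) × Fin (n + 1) → k := fun ij => a ij.1 ij.2
  let y : (Fin (N + 1) → ℂ) → Fin (N + 1) → MvPolynomial (Fin (N + 1) × Fin (n + 1)) ℂ :=
    fun u i => ∑ j, A i j * C (u j)
  have hz : ∀ u, (fun i => ∑ j, A.map (aeval z) i j * algebraMap ℂ k (u j)) =
      fun i => aeval z (y u i) := fun u => by
    funext i
    simp [y]
  have haev : ∀ u (G : MvPolynomial (Fin (N + 1)) ℂ),
      aeval (fun i => aeval z (y u i)) G = aeval z (aeval (y u) G) := fun u G =>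
    (DFunLike.congr_fun (comp_aeval (y u) (aeval z)) G).symm
  have hev : ∀ (c : Fin (N + 1) × Fin (n + 1) → ℂ) u (G : MvPolynomial (Fin (N + 1)) ℂ),
      eval (fun i => eval c (y u i)) G = eval c (aeval (y u) G) := fun c u G =>
    (DFunLike.congr_fun (comp_aeval (y u) (aeval (R := ℂ) c)) G).symm
  refine ⟨aeval (y τ) δ, ?_, fun b hb hJ hbδ hbr => ?_⟩
  · rwa [hz, haev] at hτ
  set c := chartCoord J b.rep
  have hspec : IsSpecialization ℂ z c := h.isSpecialization_chartCoord hb hJ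
  have hrange := hAB.range_eq_ker c hspec hbr
  have hmem : ∀ u, (fun i => eval c (y u i)) ∈ LinearMap.ker (B.map (eval c)).mulVecLin := by
    intro u
    rw [← hrange]
    exact ⟨u, by funext i; simp [y, Matrix.mulVec, dotProduct]⟩
  have hexists : ∀ v ∈ LinearMap.ker (B.map (eval c)).mulVecLin,
      ∃ u, v = fun i => eval c (y u i) := by
    intro v hv
    rw [← hrange] at hv
    obtain ⟨u, rfl⟩ := hv
    exact ⟨u, by funext i; simp [y, Matrix.mulVec, dotProduct]⟩
  have hyk : ∀ u, (fun i => aeval z (y u i)) ∈ solSpace (developableEqs ℂ J a) k := by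
    intro u
    rw [← hAB.range_eq, ← hz]
    exact ⟨fun j => algebraMap ℂ k (u j), rfl⟩
  have hτδ : eval (fun i => eval c (y τ i)) δ ≠ 0 := by
    rw [hev]
    exact hbδ
  refine Set.Subset.antisymm (closure_subset_linearSubspace fun Q hQ => ?_)
    (linearSubspace_subset_closure (hmem τ) hτδ fun v hv hvB hvδ => ?_)
  · rw [mem_linearSubspace, LinearMap.mem_ker]
    funext i
    -- The equations `B` hold at the generic point `x`, so they specialize to every point of the
    -- fibre, where the chart coordinates take the value `c`.
    have hBx : ∑ l, algebraMap k K (aeval z (B i l)) * x l = 0 := by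
      have hBA : ∀ j, ∑ l, aeval z (B i l) * aeval z (A l j) = 0 := by
        intro j
        have h1 : (A.map (aeval z)).mulVecLin (Pi.single j 1) ∈
            LinearMap.ker (B.map (aeval z)).mulVecLin := by
          rw [hAB.ker_eq, ← hAB.range_eq]
          exact ⟨_, rfl⟩
        have := congrFun (LinearMap.mem_ker.1 h1) i
        simpa [Matrix.mulVec, dotProduct] using this
      simp only [ht, Finset.mul_sum]
      rw [Finset.sum_comm]
      refine Finset.sum_eq_zero fun j _ => ?_
      simp only [Matrix.map_apply, ← mul_assoc, ← map_mul]
      rw [← Finset.sum_mul, ← map_sum, hBA, map_zero, zero_mul]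
    have hgraph := hQ.isGraph h.hasDim hJ
    refine HasValue.eq_zero (h.generic.isSpecialization_rep hQ.1.1) ?_
    rw [← hBx]
    rw [← Q.mk_rep] at hgraph
    have hval : ∀ l, HasValue x Q.rep (algebraMap k K (aeval z (B i l)) * x l)
        (eval c (B i l) * Q.rep l) := fun l =>
      (h.hasValue_aeval Q.rep_nonzero hgraph (B i l)).mul (hasValue_self x Q.rep l)
    exact HasValue.sum hval
  -- Conversely, a vector of the linear space where `δ` is nonzero gives a point of `X` whose
  -- tangent space is a graph over `J`. It remains to identify the matrix with that of `b`.
  · obtain ⟨u, rfl⟩ := hexists v hvB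
    have hvanish : ∀ F ∈ homIdeal X, eval (fun i => eval c (y u i)) F = 0 := by
      intro F hF
      rw [hev]
      refine hspec _ ?_
      rw [← haev]
      refine (algebraMap k K).injective ?_
      rw [map_zero, ← aeval_algebraMap_comp]
      exact h.aeval_eq_zero_of_mem_solSpace hF (mapVec_mem_solSpace.2 (hyk u))
    have hvX := mk_mem_of_isClosed hX hv hvanish
    obtain ⟨c', hc'⟩ := hδv _ hv (h.generic.isSpecialization_iff.2 hvanish) hvδ
    obtain ⟨Q, hQ⟩ := hb
    have hgraph : IsGraph (tangentSpace X Q) J fun i j => c (i, j) := hQ.isGraph h.hasDim hJ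
    have hnorm : ∀ j' j, c (J j', j) = if j' = j then 1 else 0 := hgraph.normalized
    have hcol : ∀ j, (fun i => c (i, j)) ∈ tangentSpace X (Projectivization.mk ℂ _ hv) := by
      intro j
      rw [mem_tangentSpace_mk]
      intro F hF
      -- Tangency of column `j` at `x` is a polynomial equation over `k`. It therefore holds along
      -- the whole linear space: the tangent space is constant on it.
      have h1 : aeval (fun i => aeval z (y u i)) (∑ i, C (a i j) *
          MvPolynomial.map (algebraMap ℂ k) (pderiv i F)) = 0 := by
        refine (algebraMap k K).injective ?_
        rw [map_zero, ← aeval_algebraMap_comp]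
        refine h.chart.aeval_eq_zero_of_mem_solSpace h.trdeg_base h.trdeg_fibre ?_
          (mapVec_mem_solSpace.2 (hyk u))
        have := h.isGraph.column_mem j F ((h.generic.aeval_eq_zero_iff F).2 hF)
        simpa [aeval_map_algebraMap] using this
      have h2 := hspec (∑ i, MvPolynomial.X (i, j) * aeval (y u) (pderiv i F)) (by
        rw [map_sum] at h1 ⊢
        rw [← h1]
        refine Finset.sum_congr rfl fun i _ => ?_
        rw [map_mul, map_mul, aeval_X, algHom_C, aeval_map_algebraMap, haev]
        rfl)
      rw [map_sum] at h2
      rw [← h2]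
      refine Finset.sum_congr rfl fun i _ => ?_
      rw [map_mul, eval_X, hev]
    have hcc : (fun i j => c (i, j)) = c' := by
      funext i j
      have := (hc'.mem_iff _).1 (hcol j) i
      rw [this, Finset.sum_eq_single j, hnorm, if_pos rfl, mul_one]
      · intro j' _ hj'
        rw [hnorm, if_neg hj', mul_zero]
      · simp
    have hT : tangentSpace X (Projectivization.mk ℂ _ hv) = tangentSpace X Q := by
      ext w
      rw [hc'.mem_iff, hgraph.mem_iff, ← hcc]
    exact ⟨isSmoothPoint_of_isGraph h.hasDim hvX hc', by rw [hT]; exact hQ.2⟩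

end GaussChart

end Fibres

end GaussScroll

/-! ### The focal section and its inflated tangent scroll. -/

namespace GaussScroll

open MvPolynomial

section Scrolls

variable {N n g s m : ℕ} {X : Set (ℙ ℂ (Fin (N + 1) → ℂ))}

namespace GaussChart

variable {k K : Type} [Field k] [Field K] [Algebra ℂ k] [Algebra k K] [Algebra ℂ K]
  [IsScalarTower ℂ k K] {x : Fin (N + 1) → K} {J : PluckerIndex (n + 1) N}
  {a : Fin (N + 1) → Fin (n + 1) → k}

/-- The tangent space at the generic point of the image of a section of the generic fibre that
satisfies the focal condition. -/
theorem exists_tangent_submodule (h : GaussChart X n s m x J a) {p : Fin (N + 1) → k}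
    (hp : p ∈ solSpace (developableEqs ℂ J a) k)
    (hpδ : ∀ δ : Derivation ℂ k k, (fun i => δ (p i)) ∈ solSpace (developableEqs ℂ J a) k) :
    ∃ (I : Ideal (MvPolynomial (Fin (N + 1)) ℂ)) (V : Submodule k (Fin (N + 1) → k)),
      (∀ F, F ∈ I ↔ ∀ e, aeval p (homogeneousComponent e F) = 0) ∧
      V ≤ solSpace (developableEqs ℂ J a) k ∧
      (∀ w, w ∈ V ↔ ∀ F ∈ I, ∑ i, w i * aeval p (pderiv i F) = 0) ∧
      ringKrullDim (MvPolynomial (Fin (N + 1)) ℂ ⧸ I) = (Module.finrank k V : WithBot ℕ∞) := by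
  obtain ⟨i₀, hi₀⟩ := h.exists_ne_zero
  have hlam := h.chart.transcendental h.trdeg_base hi₀
  -- Scaling by the transcendental `x i₀` gives a generic point of the affine cone over `S`, so
  -- dimension and tangent space are those of the cone, as in the definitions.
  let q : Fin (N + 1) → K := fun i => x i₀ * algebraMap k K (p i)
  let I : Ideal (MvPolynomial (Fin (N + 1)) ℂ) := RingHom.ker (aeval q)
  have hIq : ∀ F, F ∈ I ↔ aeval q F = 0 := fun F => RingHom.mem_ker
  have hI : ∀ F, F ∈ I ↔ ∀ e, aeval p (homogeneousComponent e F) = 0 := fun F => by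
    rw [hIq, aeval_mul_eq_zero_iff_homogeneousComponent hlam]
  obtain ⟨d, hd, htr⟩ := exists_ringKrullDim_eq_and_finrank_eq q hIq
  let E : Set (Fin (N + 1) → k) := {e | ∃ F ∈ I, e = fun i => aeval p (pderiv i F)}
  have hsol : solSpace E K = genTangent ℂ q := by
    ext w
    rw [mem_genTangent_mul_iff hlam]
    constructor
    · exact fun hw F hF => hw _ ⟨F, (hIq F).2 hF, rfl⟩
    · rintro hw _ ⟨F, hF, rfl⟩
      exact hw F ((hIq F).1 hF)
  refine ⟨I, solSpace E k, hI, fun w hw => ?_, fun w => ⟨fun hw F hF => ?_, ?_⟩, ?_⟩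
  · rw [← mapVec_mem_solSpace (K := K)] at hw ⊢
    rw [hsol] at hw
    exact genTangent_le_solSpace h.trdeg_base hp hpδ (x i₀) htr hw
  · exact (Finset.sum_congr rfl fun i _ => mul_comm _ _).trans (hw _ ⟨F, hF, rfl⟩)
  · rintro hw _ ⟨F, hF, rfl⟩
    exact (Finset.sum_congr rfl fun i _ => mul_comm _ _).trans (hw F hF)
  · rw [hd, ← finrank_solSpace (K := K), hsol, (genTangent_eq_span_derivation q htr).1]

/-- At the generic point the tangent space `V` of the cone over `S` lies in the fibre space. Both
are spread out as families over the Gauss image; on an open set their members are the actual tangent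
spaces and closed fibres, and the inclusion and dimensions persist. -/
theorem isInflatedTangentScroll (h : GaussChart X n s m x J a) (hX : IsClosed X)
    {p : Fin (N + 1) → k} (hp : p ∈ solSpace (developableEqs ℂ J a) k)
    (hpδ : ∀ δ : Derivation ℂ k k, (fun i => δ (p i)) ∈ solSpace (developableEqs ℂ J a) k)
    (hpc : ∀ (t : k) (c : Fin (N + 1) → ℂ), ¬ ∀ i, p i = t * algebraMap ℂ k (c i)) :
    IsInflatedTangentScroll X n := by
  let z : Fin (N + 1) × Fin (n + 1) → k := fun ij => a ij.1 ij.2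
  -- Rescaling `p` to polynomial entries does not disturb the focal condition: Leibniz only adds
  -- multiples of `p`.
  obtain ⟨γ, P, hγ, hP⟩ := GeneratesField.exists_common_denominator (z := z)
    h.chart.generates_chart p
  have hPp : (fun i => aeval z (P i)) = aeval z γ • p := funext fun i => (hP i).symm
  have hPmem : (fun i => aeval z (P i)) ∈ solSpace (developableEqs ℂ J a) k := by
    rw [hPp]
    exact Submodule.smul_mem _ _ hp
  have hPδ : ∀ δ : Derivation ℂ k k,
      (fun i => δ (aeval z (P i))) ∈ solSpace (developableEqs ℂ J a) k := by
    intro δ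
    have : (fun i => δ (aeval z (P i))) =
        aeval z γ • (fun i => δ (p i)) + δ (aeval z γ) • p := by
      funext i
      rw [← hP, Derivation.leibniz]
      simp only [Pi.add_apply, Pi.smul_apply, smul_eq_mul]
      ring
    rw [this]
    exact Submodule.add_mem _ (Submodule.smul_mem _ _ (hpδ δ)) (Submodule.smul_mem _ _ hp)
  have hPc : ∀ (t : k) (c : Fin (N + 1) → ℂ), ¬ ∀ i, aeval z (P i) = t * algebraMap ℂ k (c i) := by
    intro t c hall
    refine hpc ((aeval z γ)⁻¹ * t) c fun i => ?_
    rw [mul_assoc, ← hall i, ← hP, inv_mul_cancel_left₀ hγ]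
  obtain ⟨i₁, hi₁⟩ : ∃ i, aeval z (P i) ≠ 0 := by
    by_contra! hall
    exact hPc 0 0 fun i => by rw [hall, zero_mul]
  obtain ⟨I, V, hI, hVL, hV, hVdim⟩ := h.exists_tangent_submodule hPmem hPδ
  obtain ⟨A, B, r₁, hAB⟩ := GeneratesField.exists_subspaceFamily (z := z)
    h.chart.generates_chart (solSpace (developableEqs ℂ J a) k)
  obtain ⟨A', B', r₂, hAB'⟩ := GeneratesField.exists_subspaceFamily (z := z)
    h.chart.generates_chart V
  obtain ⟨δ, hδ, hfibre⟩ := h.closure_gaussFibre_eq hX hAB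
  obtain ⟨l, f, hf⟩ := exists_fin_generators I
  let M : Matrix (Fin l) (Fin (N + 1)) (MvPolynomial (Fin (N + 1) × Fin (n + 1)) ℂ) :=
    (jacobian f).map (aeval P)
  obtain ⟨r₃, hr₃, hrank⟩ := GeneratesField.exists_rank_le (z := z) h.chart.generates_chart M
  have hpI : ∀ F ∈ I, aeval (fun i => aeval z (P i)) F = 0 := by
    intro F hF
    rw [← sum_homogeneousComponent F, map_sum]
    exact Finset.sum_eq_zero fun e _ => (hI F).1 hF e
  have hker : LinearMap.ker (M.map (aeval z)).mulVecLin = V := by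
    ext w
    have hM : M.map (aeval z) = (jacobian f).map (aeval fun i => aeval z (P i)) := by
      ext i j
      exact DFunLike.congr_fun (comp_aeval P (aeval z)) (jacobian f i j)
    rw [hM, mem_ker_jacobian_iff hf hpI, hV]
  -- All open conditions at once: both families, the rank of the Jacobian of `S`, the description of
  -- the fibre, and the nonvanishing of the point.
  let r := r₁ * r₂ * r₃ * δ * P i₁
  have hr : aeval z r ≠ 0 := by
    simp only [r, map_mul]
    exact mul_ne_zero (mul_ne_zero (mul_ne_zero (mul_ne_zero hAB.ne_zero hAB'.ne_zero) hr₃) hδ) hi₁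
  have hr_iff : ∀ c, eval c r ≠ 0 → eval c r₁ ≠ 0 ∧ eval c r₂ ≠ 0 ∧ eval c r₃ ≠ 0 ∧ eval c δ ≠ 0 ∧
      eval c (P i₁) ≠ 0 := by
    intro c hc
    simp only [r, map_mul, mul_ne_zero_iff] at hc
    tauto
  have hP0 : ∀ c, eval c r ≠ 0 → (fun i => eval c (P i)) ≠ 0 := fun c hc h0 =>
    (hr_iff c hc).2.2.2.2 (congrFun h0 i₁)
  obtain ⟨e, e', φ, R, hφ, hRhom, hR, hφ₀, hφρ⟩ := exists_forms J P r
  have hval : ∀ b : ℙ ℂ (PluckerIndex (n + 1) N → ℂ), ∀ hb : eval b.rep R ≠ 0,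
      IsRatValue φ b (Projectivization.mk ℂ _ (hP0 _ ((hR _).1 hb).2)) := by
    intro b hb
    obtain ⟨ρ, hρ, hρφ⟩ := hφρ _ hb
    exact isRatValue_mk _ hρ hρφ
  have hideal : homIdeal (ratImage φ (gaussImage X n)) = I := by
    ext F
    rw [hI]
    exact h.mem_homIdeal_ratImage_iff hr hP0 hR hφ₀ hφρ F
  have hS : ringKrullDim (coordRing (ratImage φ (gaussImage X n))) =
      (Module.finrank k V : WithBot ℕ∞) := by
    change ringKrullDim (MvPolynomial (Fin (N + 1)) ℂ ⧸ homIdeal _) = _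
    rw [hideal, hVdim]
  refine ⟨e, φ, hφ, ?_, {b | eval b.rep R ≠ 0}, isOpen_basicOpen hRhom, ?_, ?_⟩
  · rw [← Set.not_subsingleton_iff]
    intro hsub
    obtain ⟨b₀, hb₀, hJ₀, hbr₀⟩ := h.exists_eval_chartCoord_ne_zero hr
    have hw0 := hP0 _ hbr₀
    set w : Fin (N + 1) → ℂ := fun i => eval (chartCoord J b₀.rep) (P i)
    -- If `S` were a single point, the `2 × 2` minors of `P` against the constant vector `w` would
    -- vanish at all general Gauss values, hence generically, making `p` proportional to a constant
    -- vector.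
    have hprop : ∀ i j, aeval z (P i) * algebraMap ℂ k (w j) =
        aeval z (P j) * algebraMap ℂ k (w i) := by
      intro i j
      by_contra hne
      obtain ⟨b, hb, hJ, hbne⟩ := h.exists_eval_chartCoord_ne_zero
        (G := (P i * C (w j) - P j * C (w i)) * r) (by
          rw [map_mul]
          refine mul_ne_zero ?_ hr
          simpa [sub_eq_zero] using hne)
      rw [map_mul] at hbne
      have hbr := right_ne_zero_of_mul hbne
      have heq := hsub (subset_closure ⟨b, hb, hval b ((hR _).2 ⟨hJ, hbr⟩)⟩)
        (subset_closure ⟨b₀, hb₀, hval b₀ ((hR _).2 ⟨hJ₀, hbr₀⟩)⟩)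
      obtain ⟨t, ht⟩ := (Projectivization.mk_eq_mk_iff' ℂ _ _ _ _).1 heq
      have ht' : ∀ l, t * w l = eval (chartCoord J b.rep) (P l) := fun l => congrFun ht l
      refine left_ne_zero_of_mul hbne ?_
      simp only [map_sub, map_mul, eval_C, ← ht']
      ring
    obtain ⟨j, hj⟩ := Function.ne_iff.1 hw0
    have hj' : algebraMap ℂ k (w j) ≠ 0 := (map_ne_zero _).2 hj
    refine hPc (aeval z (P j) / algebraMap ℂ k (w j)) w fun i => ?_
    rw [div_mul_eq_mul_div, ← hprop i j, mul_div_cancel_right₀ _ hj']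
  · obtain ⟨b, hb, hJ, hbr⟩ := h.exists_eval_chartCoord_ne_zero hr
    exact ⟨b, (hR _).2 ⟨hJ, hbr⟩, hb⟩
  · rintro b ⟨hbR, hb⟩
    obtain ⟨hJ, hbr⟩ := (hR _).1 hbR
    obtain ⟨h1, h2, h3, h4, -⟩ := hr_iff _ hbr
    have hspec := h.isSpecialization_chartCoord hb hJ
    have hmem : Projectivization.mk ℂ _ (hP0 _ hbr) ∈ ratImage φ (gaussImage X n) :=
      subset_closure ⟨b, hb, hval b hbR⟩
    have htangent : tangentSpace (ratImage φ (gaussImage X n))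
        (Projectivization.mk ℂ _ (hP0 _ hbr)) =
        LinearMap.ker (B'.map (eval (chartCoord J b.rep))).mulVecLin := by
      rw [← hAB'.ker_eq_ker hker hspec h2 (hrank _ hspec h3)]
      have hM : M.map (eval (chartCoord J b.rep)) =
          (jacobian f).map (eval fun i => eval (chartCoord J b.rep) (P i)) := by
        ext i j
        exact DFunLike.congr_fun (comp_aeval P (aeval (R := ℂ) (chartCoord J b.rep)))
          (jacobian f i j)
      ext w
      rw [hM, mem_tangentSpace_mk, hideal]
      refine (mem_ker_jacobian_iff (K := ℂ) hf (fun F hF => ?_) w).symm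
      rw [← hideal] at hF
      exact mem_homIdeal.1 hF _ (hP0 _ hbr) hmem
    refine ⟨_, _, hfibre b hb hJ h4 h1, hval b hbR, ?_, ⟨hmem, ?_⟩, ?_⟩
    · exact (mk_mem_linearSubspace _).2 (hAB.eval_mem hspec hPmem)
    · rw [htangent, hAB'.finrank_ker _ hspec h2, hS]
    · rw [htangent]
      exact fun Q hQ => le_trans hQ (hAB'.ker_le_ker hAB hVL hspec h2)

end GaussChart

end Scrolls

end GaussScroll

/-! ### The dichotomy: fixed or moving focal point. -/

theorem mainTheorem8 (N n g : ℕ) (X : Set (ℙ ℂ (Fin (N + 1) → ℂ)))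
    (hclosed : IsClosed X) (hirr : IsIrreducible X)
    (hdim : GaussScroll.HasDim X n)
    (hgauss : GaussScroll.HasDim (GaussScroll.gaussImage X n) g)
    (hg : g * (g + 1) ≤ n) :
    GaussScroll.IsCone X ∨ GaussScroll.IsInflatedTangentScroll X n := by
  obtain ⟨k, K, _, _, _, _, _, _, s, m, x, J, a, h⟩ := GaussScroll.exists_gaussChart hirr hdim
  have hsg : s ≤ g := h.le_of_hasDim hgauss
  have hsm := h.add_eq
  -- From `s + m = n + 1` and `s ≤ g`: `m ≥ g * (g + 1) + 1 - s ≥ s * s + 1`.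
  have hlt : s * s < m := by nlinarith
  obtain ⟨p, hp, hp0, hpδ⟩ :=
    h.chart.exists_focal_vector h.trdeg_base h.trdeg_fibre hsm hlt
  by_cases hpc : ∃ (t : k) (c : Fin (N + 1) → ℂ), ∀ i, p i = t * algebraMap ℂ k (c i)
  · obtain ⟨t, c, hpc⟩ := hpc
    exact Or.inl (h.isCone hclosed hp hp0 hpc)
  · push Not at hpc
    exact Or.inr (h.isInflatedTangentScroll hclosed hp hpδ fun t c hall => by
      obtain ⟨i, hi⟩ := hpc t c
      exact hi (hall i))
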